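/- **Theorem (type safety).** Consider the following calculus. *Parameters.* Base types $B$, among them $\mathsf{bool}$; primitive values $p$, among them $\mathsf{true},\mathsf{false}$; operation names $\mathsf{op}$; a partial map $\zeta$ from pairs of a primitive value and a value to computations; a map $\mathrm{ty}$ from primitive values to value types; and a many-sorted predicate logic whose sorts are the base types, with an interpretation in which $\mathsf{bool}$ consists of two distinct truth values, denoted by $\mathsf{true}$ and $\mathsf{false}$. Terms are $t ::= x \mid p \mid f(\tilde t)$, with well-sorted terms denoting elements of their sort ($p$ has sort $B$ if $\mathrm{ty}(p)$ is of the form $\{x:B\mid\phi\}$); predicates are $A ::= X \mid \lambda(\tilde x:\tilde B).\phi$; formulas are $\phi ::= \top \mid t_1=t_2 \mid A(\tilde t) \mid o(\tilde t;\tilde A)$. Here $X$ ranges over predicate variables, $f$ over arbitrary function symbols, and $o$ over arbitrary logical symbols, each interpreted as a fixed relation between individuals and relations (atomic predicates, connectives, quantifiers). *Syntax.* Values $v ::= x \mid p \mid \mathsf{rec}(f,x).c$; computations $c ::= \mathsf{return}\,v \mid \mathsf{op}\,v \mid v_1\,v_2 \mid \mathsf{if}\,v\,\mathsf{then}\,c_1\,\mathsf{else}\,c_2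 \mid \mathsf{let}\,x=c_1\,\mathsf{in}\,c_2 \mid \mathsf{with}\,h\,\mathsf{handle}\,c$; handlers $h=\{\mathsf{return}\,x_r\mapsto c_r,\ (\mathsf{op}_i(x_i,k_i)\mapsto c_i)_i\}$; pure evaluation contexts $K ::= [\,] \mid \mathsf{let}\,x=K\,\mathsf{in}\,c$. Everything is taken up to renaming of bound variables, and substitution is capture-avoiding. *Evaluation* $\longrightarrow$ is the least relation with: $\mathsf{let}\,x=c_1\,\mathsf{in}\,c_2\longrightarrow\mathsf{let}\,x=c_1'\,\mathsf{in}\,c_2$ and $\mathsf{with}\,h\,\mathsf{handle}\,c_1\longrightarrow\mathsf{with}\,h\,\mathsf{handle}\,c_1'$ if $c_1\longrightarrow c_1'$; $\mathsf{let}\,x=\mathsf{return}\,v\,\mathsf{in}\,c\longrightarrow c[v/x]$; $\mathsf{if}\,\mathsf{true}\,\mathsf{then}\,c_1\,\mathsf{else}\,c_2\longrightarrow c_1$ and $\mathsf{if}\,\mathsf{false}\,\mathsf{then}\,c_1\,\mathsf{else}\,c_2\longrightarrow c_2$; $(\mathsf{rec}(f,x).c)\,v\longrightarrow c[v/x][\mathsf{rec}(f,x).c/f]$;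 $p\,v\longrightarrow\zeta(p,v)$ where defined; $\mathsf{with}\,h\,\mathsf{handle}\,\mathsf{return}\,v\longrightarrow c_r[v/x_r]$; and, if $h$ has a clause $\mathsf{op}_i(x_i,k_i)\mapsto c_i$, $\mathsf{with}\,h\,\mathsf{handle}\,K[\mathsf{op}_i\,v]\longrightarrow c_i[v/x_i][(\lambda y.\,\mathsf{with}\,h\,\mathsf{handle}\,K[\mathsf{return}\,y])/k_i]$. Write $\longrightarrow^*$ for the reflexive transitive closure. *Types.* Value types $T ::= \{x:B\mid\phi\}\mid(x:T)\to C$; computation types $C ::= \langle\Sigma\rangle T/S$; operation signatures $\Sigma$, which are finite partial maps from operation names to schemes $\forall\tilde X:\tilde B.\,F$ with $F=(x:T_1)\to((y:T_2)\to C_1)\to C_2$; control effects $S ::= \square\mid(\forall x.C_1)\Rightarrow C_2$; contexts $\Gamma$, which are lists of bindings $x:T$ and $X:\tilde B$. Write $B$ for $\{z:B\mid\top\}$, and $\Gamma,\phi$ for $\Gamma,x:\{z:\mathsf{bool}\mid\phi\}$ with $x,z$ fresh. Contexts, types, signatures, effects and predicates are well-formed ($\vdash\Gamma$, $\Gamma\vdash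 T$, …) if all formulas in them are well-sorted in their scope, where variables of function types may not occur in formulas, and bound names are distinct; in $\langle\Sigma\rangle T/((\forall x.C_1)\Rightarrow C_2)$ the variable $x$ has type $T$ in $C_1$. $\Gamma\vDash\phi$ means truth under all assignments satisfying the refinements in $\Gamma$ (predicate variables range over all relations of their arity). *Subtyping.* - $\Gamma\vdash\{x:B\mid\phi_1\}<:\{x:B\mid\phi_2\}$ if $\Gamma,x:B\vDash\phi_1\Rightarrow\phi_2$. - $\Gamma\vdash(x:T_1)\to C_1<:(x:T_2)\to C_2$ if $\Gamma\vdash T_2<:T_1$ and $\Gamma,x:T_2\vdash C_1<:C_2$; likewise for the function types $F$. - $\Gamma\vdash\Sigma_1<:\Sigma_2$ if for each $\mathsf{op}:\forall\tilde X:\tilde B.F_2$ in $\Sigma_2$ there is $\mathsf{op}:\forall\tilde X:\tilde B.F_1$ in $\Sigma_1$ with $\Gamma,\tilde X:\tilde B\vdash F_1<:F_2$. - $\Gamma\vdash\langle\Sigma_1\rangle T_1/S_1<:\langle\Sigma_2\rangle T_2/S_2$ if $\Gamma\vdash\Sigma_2<:\Sigma_1$, $\Gamma\vdash T_1<:T_2$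 and $\Gamma\mid T_1\vdash S_1<:S_2$. - $\Gamma\mid T\vdash\square<:\square$. $\Gamma\mid T\vdash(\forall x.C_{11})\Rightarrow C_{12}<:(\forall x.C_{21})\Rightarrow C_{22}$ if $\Gamma,x:T\vdash C_{21}<:C_{11}$ and $\Gamma\vdash C_{12}<:C_{22}$. $\Gamma\mid T\vdash\square<:(\forall x.C_1)\Rightarrow C_2$ if $\Gamma,x:T\vdash C_1<:C_2$ and $x\notin\mathrm{fv}(C_2)$. *Typing of values.* - If $\vdash\Gamma$: $\Gamma\vdash x:\{z:B\mid z=x\}$ when $\Gamma(x)=\{z:B\mid\phi\}$; $\Gamma\vdash x:\Gamma(x)$ when $\Gamma(x)$ is a function type; $\Gamma\vdash p:\mathrm{ty}(p)$. - $\Gamma\vdash\mathsf{rec}(f,x).c:(x:T)\to C$ if $\Gamma,f:(x:T)\to C,x:T\vdash c:C$. - Subsumption: from $\Gamma\vdash v:T_1$, $\Gamma\vdash T_1<:T_2$ and $\Gamma\vdash T_2$ infer $\Gamma\vdash v:T_2$; likewise for computations. *Typing of computations.* - $\Gamma\vdash\mathsf{return}\,v:\langle\emptyset\rangle T/\square$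 if $\Gamma\vdash v:T$. - $\Gamma\vdash v_1\,v_2:C[v_2/x]$ if $\Gamma\vdash v_1:(x:T)\to C$ and $\Gamma\vdash v_2:T$. - $\Gamma\vdash\mathsf{if}\,v\,\mathsf{then}\,c_1\,\mathsf{else}\,c_2:C$ if $\Gamma\vdash v:\{x:\mathsf{bool}\mid\phi\}$, $\Gamma,v=\mathsf{true}\vdash c_1:C$ and $\Gamma,v=\mathsf{false}\vdash c_2:C$. - $\Gamma\vdash\mathsf{let}\,x=c_1\,\mathsf{in}\,c_2:\langle\Sigma\rangle T_2/\square$ if $\Gamma\vdash c_1:\langle\Sigma\rangle T_1/\square$, $\Gamma,x:T_1\vdash c_2:\langle\Sigma\rangle T_2/\square$ and $x\notin\mathrm{fv}(T_2)\cup\mathrm{fv}(\Sigma)$. - $\Gamma\vdash\mathsf{let}\,x=c_1\,\mathsf{in}\,c_2:\langle\Sigma\rangle T_2/((\forall y.C_{21})\Rightarrow C_{12})$ if $\Gamma\vdash c_1:\langle\Sigma\rangle T_1/((\forall x.C)\Rightarrow C_{12})$, $\Gamma,x:T_1\vdash c_2:\langle\Sigma\rangle T_2/((\forall y.C_{21})\Rightarrow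 C)$ and $x\notin\mathrm{fv}(T_2)\cup\mathrm{fv}(\Sigma)\cup(\mathrm{fv}(C_{21})\setminus\{y\})$. - $\Gamma\vdash\mathsf{op}\,v:\langle\Sigma\rangle T_2[\tilde A/\tilde X][v/x]\,/\,((\forall y.C_1)\Rightarrow C_2)[\tilde A/\tilde X][v/x]$ if $\Sigma$ contains $\mathsf{op}:\forall\tilde X:\tilde B.(x:T_1)\to((y:T_2)\to C_1)\to C_2$, $\Gamma\vdash\Sigma$, the predicates $\tilde A$ are well-formed in $\Gamma$ of the arities $\tilde B$, and $\Gamma\vdash v:T_1[\tilde A/\tilde X]$. - $\Gamma\vdash\mathsf{with}\,h\,\mathsf{handle}\,c:C_2$ if $\Gamma\vdash c:\langle\Sigma\rangle T/((\forall x_r.C_1)\Rightarrow C_2)$, $\Gamma,x_r:T\vdash c_r:C_1$, the handler $h=\{\mathsf{return}\,x_r\mapsto c_r,(\mathsf{op}_i(x_i,k_i)\mapsto c_i)_i\}$ has clauses for exactly the operations of $\Sigma=\{(\mathsf{op}_i:\forall\tilde X_i:\tilde B_i.(x_i:T_{1i})\to((y_i:T_{2i})\to C_{1i})\to C_{2i})_i\}$,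 and $\Gamma,\tilde X_i:\tilde B_i,x_i:T_{1i},k_i:(y_i:T_{2i})\to C_{1i}\vdash c_i:C_{2i}$ for each $i$. *Assumption on primitive values.* For every $p$: $\emptyset\vdash\mathrm{ty}(p)$; if $\mathrm{ty}(p)=\{z:B\mid\phi\}$, then for all $z$ in $B$, $\phi$ holds if and only if $z=p$; $\mathrm{ty}(p)$ is a refinement of $\mathsf{bool}$ iff $p\in\{\mathsf{true},\mathsf{false}\}$; and if $\mathrm{ty}(p)=(x:T)\to C$, then for every $v$ with $\emptyset\vdash v:T$, $\zeta(p,v)$ is defined and $\emptyset\vdash\zeta(p,v):C[v/x]$. *Conclusion.* If $\emptyset\vdash c:\langle\Sigma\rangle T/S$ and $c\longrightarrow^* c'$, then one of the following holds: 1. $c'=\mathsf{return}\,v$ for some $v$ such that $\emptyset\vdash v:T$; 2. $c'=K[\mathsf{op}\,v]$ for some $K$, $\mathsf{op}$, $v$ such that $\mathsf{op}\in\mathrm{dom}(\Sigma)$; 3. $c'\longrightarrow c''$ for some $c''$ such that $\emptyset\vdash c'':\langle\Sigma\rangle T/S$. -/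

import Mathlib

universe u

namespace ARM

/-- The symbols over which the calculus and its refinement logic are built: base types (with the
Boolean type), primitive values (with the truth values), operation names, and a many-sorted
signature for the logic.  A logical symbol `o : Con` takes terms of the sorts `conDom o` and
predicates of the arities `conPreds o`; this covers atomic predicate symbols (no predicate
arguments) as well as connectives and quantifiers: `φ ∧ ψ` is a symbol applied to the two nullary
predicates `λ(). φ` and `λ(). ψ`, and `∀ x : B. φ` is a symbol applied to `λ(x : B). φ`. -/
structure Language where
  Base : Type u
  bool : Base
  Prim : Type u
  tt : Prim
  ff : Prim
  OpName : Type u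
  Fn : Type u
  fnArity : Fn → ℕ
  fnDom : (f : Fn) → Fin (fnArity f) → Base
  fnCod : Fn → Base
  Con : Type u
  conDom : Con → List Base
  conArity : Con → ℕ
  conPreds : (o : Con) → Fin (conArity o) → List Base

/-! ### Renamings of de Bruijn indices

Variables are de Bruijn indices, so that everything is taken up to renaming of bound variables.
Value variables `x` and predicate variables `X` are numbered separately. -/

/-- Extends a renaming below `k` binders. -/
def liftRen (k : ℕ) (ξ : ℕ → ℕ) : ℕ → ℕ :=
  fun i => if i < k then i else ξ (i - k) + k

/-! ### Values and computations -/

mutual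

/-- Values: variables, primitive values, and recursive functions `rec f x. c`
(in the body, `0` is the argument `x` and `1` is the function `f`). -/
inductive Value (L : Language.{u}) : Type u
  | var (x : ℕ)
  | prim (p : L.Prim)
  | fix (c : Comp L)

/-- Computations.  `letIn c₁ c₂` binds one variable in `c₂`.  In `handle cr cls c`, the handler
has the return clause `cr` (binding one variable) and the operation clauses `cls`. -/
inductive Comp (L : Language.{u}) : Type u
  | ret (v : Value L)
  | op (o : L.OpName) (v : Value L)
  | app (v₁ v₂ : Value L)
  | ite (v : Value L) (c₁ c₂ : Comp L)
  | letIn (c₁ c₂ : Comp L)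
  | handle (cr : Comp L) (cls : L.OpName → Clause L) (c : Comp L)

/-- The entry of a handler for one operation: no clause, or a clause `op(x, k) ↦ c`
(in `c`, `0` is the continuation `k` and `1` is the argument `x`).  Handlers are thus partial
maps on operation names; typing forces the domain to be that of an operation signature,
hence finite. -/
inductive Clause (L : Language.{u}) : Type u
  | absent
  | present (c : Comp L)

end

mutual

def Value.ren {L : Language.{u}} (ξ : ℕ → ℕ) : Value L → Value L
  | .var x => .var (ξ x)
  | .prim p => .prim p
  | .fix c => .fix (c.ren (liftRen 2 ξ))

def Comp.ren {L : Language.{u}} (ξ : ℕ → ℕ) : Comp L → Comp L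
  | .ret v => .ret (v.ren ξ)
  | .op o v => .op o (v.ren ξ)
  | .app v₁ v₂ => .app (v₁.ren ξ) (v₂.ren ξ)
  | .ite v c₁ c₂ => .ite (v.ren ξ) (c₁.ren ξ) (c₂.ren ξ)
  | .letIn c₁ c₂ => .letIn (c₁.ren ξ) (c₂.ren (liftRen 1 ξ))
  | .handle cr cls c =>
      .handle (cr.ren (liftRen 1 ξ)) (fun o => (cls o).ren ξ) (c.ren ξ)

def Clause.ren {L : Language.{u}} (ξ : ℕ → ℕ) : Clause L → Clause L
  | .absent => .absent
  | .present c => .present (c.ren (liftRen 2 ξ))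

end

/-- Extends a substitution below `k` binders. -/
def liftVal {L : Language.{u}} (k : ℕ) (σ : ℕ → Value L) : ℕ → Value L :=
  fun i => if i < k then .var i else (σ (i - k)).ren (· + k)

mutual

/-- Simultaneous capture-avoiding substitution of values for variables. -/
def Value.subst {L : Language.{u}} (σ : ℕ → Value L) : Value L → Value L
  | .var x => σ x
  | .prim p => .prim p
  | .fix c => .fix (c.subst (liftVal 2 σ))

def Comp.subst {L : Language.{u}} (σ : ℕ → Value L) : Comp L → Comp L
  | .ret v => .ret (v.subst σ)
  | .op o v => .op o (v.subst σ)
  | .app v₁ v₂ => .app (v₁.subst σ) (v₂.subst σ)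
  | .ite v c₁ c₂ => .ite (v.subst σ) (c₁.subst σ) (c₂.subst σ)
  | .letIn c₁ c₂ => .letIn (c₁.subst σ) (c₂.subst (liftVal 1 σ))
  | .handle cr cls c =>
      .handle (cr.subst (liftVal 1 σ)) (fun o => (cls o).subst σ) (c.subst σ)

def Clause.subst {L : Language.{u}} (σ : ℕ → Value L) : Clause L → Clause L
  | .absent => .absent
  | .present c => .present (c.subst (liftVal 2 σ))

end

/-- The substitution that replaces variable `0` by `v`. -/
def inst1 {L : Language.{u}} (v : Value L) : ℕ → Value L
  | 0 => v
  | n + 1 => .var n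

/-- The substitution that replaces variable `0` by `v` and variable `1` by `w`. -/
def inst2 {L : Language.{u}} (v w : Value L) : ℕ → Value L
  | 0 => v
  | 1 => w
  | n + 2 => .var n

/-- Pure evaluation contexts `K ::= [] | let x = K in c`. -/
inductive ECtx (L : Language.{u}) : Type u
  | hole
  | letIn (K : ECtx L) (c : Comp L)

/-- `K[c]`. -/
def ECtx.plug {L : Language.{u}} : ECtx L → Comp L → Comp L
  | .hole, c => c
  | .letIn K c₂, c => .letIn (K.plug c) c₂

def ECtx.ren {L : Language.{u}} (ξ : ℕ → ℕ) : ECtx L → ECtx L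
  | .hole => .hole
  | .letIn K c => .letIn (K.ren ξ) (c.ren (liftRen 1 ξ))

/-- The function `λ y. with h handle K[return y]` that reifies the continuation `K` under the
handler with clauses `cr`, `cls`. -/
def contFun {L : Language.{u}} (cr : Comp L) (cls : L.OpName → Clause L) (K : ECtx L) :
    Value L :=
  .fix (.handle (cr.ren (liftRen 1 (· + 2))) (fun o => (cls o).ren (· + 2))
    ((K.ren (· + 2)).plug (.ret (.var 0))))

/-! ### The refinement logic: terms, predicates and formulas -/

/-- Terms of the logic: variables, primitive values, and applications of function symbols.
`func` has no sort: it is what is left of a function value (which is not a term) that is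
substituted for a variable. -/
inductive Term (L : Language.{u}) : Type u
  | var (x : ℕ)
  | prim (p : L.Prim)
  | fn (f : L.Fn) (ts : Fin (L.fnArity f) → Term L)
  | func

mutual

/-- Formulas: truth, equations, applications `A(t₁, …, tₙ)` of predicates, and applications of
logical symbols. -/
inductive Formula (L : Language.{u}) : Type u
  | tru
  | eq (t₁ t₂ : Term L)
  | app (A : Pred L) (ts : List (Term L))
  | con (o : L.Con) (ts : List (Term L)) (As : Fin (L.conArity o) → Pred L)

/-- Predicates: predicate variables `X`, and abstractions `λ(x₁ : B₁, …, xₙ : Bₙ). φ`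
(in `φ`, index `i < n` is the `i`-th parameter). -/
inductive Pred (L : Language.{u}) : Type u
  | pvar (X : ℕ)
  | abs (Bs : List L.Base) (φ : Formula L)

end

/-- A value as a term of the logic. -/
def Value.toTerm {L : Language.{u}} : Value L → Term L
  | .var x => .var x
  | .prim p => .prim p
  | .fix _ => .func

def Term.ren {L : Language.{u}} (ξ : ℕ → ℕ) : Term L → Term L
  | .var x => .var (ξ x)
  | .prim p => .prim p
  | .fn f ts => .fn f (fun i => (ts i).ren ξ)
  | .func => .func

def Term.subst {L : Language.{u}} (τ : ℕ → Term L) : Term L → Term L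
  | .var x => τ x
  | .prim p => .prim p
  | .fn f ts => .fn f (fun i => (ts i).subst τ)
  | .func => .func

mutual

/-- Renaming of value variables by `ξ` and of predicate variables by `η`. -/
def Formula.ren {L : Language.{u}} (ξ η : ℕ → ℕ) : Formula L → Formula L
  | .tru => .tru
  | .eq t₁ t₂ => .eq (t₁.ren ξ) (t₂.ren ξ)
  | .app A ts => .app (A.ren ξ η) (ts.map (Term.ren ξ))
  | .con o ts As => .con o (ts.map (Term.ren ξ)) (fun i => (As i).ren ξ η)

def Pred.ren {L : Language.{u}} (ξ η : ℕ → ℕ) : Pred L → Pred L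
  | .pvar X => .pvar (η X)
  | .abs Bs φ => .abs Bs (φ.ren (liftRen Bs.length ξ) η)

end

/-- Extends a substitution of terms below `k` value binders. -/
def liftTm {L : Language.{u}} (k : ℕ) (τ : ℕ → Term L) : ℕ → Term L :=
  fun i => if i < k then .var i else (τ (i - k)).ren (· + k)

/-- Weakens a substitution of predicates below `k` value binders. -/
def weakPr {L : Language.{u}} (k : ℕ) (π : ℕ → Pred L) : ℕ → Pred L :=
  fun i => (π i).ren (· + k) id

/-- Extends a substitution of predicates below `k` predicate binders. -/
def liftPr {L : Language.{u}} (k : ℕ) (π : ℕ → Pred L) : ℕ → Pred L :=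
  fun i => if i < k then .pvar i else (π (i - k)).ren id (· + k)

mutual

/-- Simultaneous substitution of terms for value variables and of predicates for predicate
variables. -/
def Formula.subst {L : Language.{u}} (τ : ℕ → Term L) (π : ℕ → Pred L) : Formula L → Formula L
  | .tru => .tru
  | .eq t₁ t₂ => .eq (t₁.subst τ) (t₂.subst τ)
  | .app A ts => .app (A.subst τ π) (ts.map (Term.subst τ))
  | .con o ts As => .con o (ts.map (Term.subst τ)) (fun i => (As i).subst τ π)

def Pred.subst {L : Language.{u}} (τ : ℕ → Term L) (π : ℕ → Pred L) : Pred L → Pred L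
  | .pvar X => π X
  | .abs Bs φ => .abs Bs (φ.subst (liftTm Bs.length τ) (weakPr Bs.length π))

end

/-! ### Types -/

mutual

/-- Value types: `{x : B | φ}` (binding one value variable in `φ`) and `(x : T) → C`
(binding one value variable in `C`). -/
inductive VTy (L : Language.{u}) : Type u
  | rfn (B : L.Base) (φ : Formula L)
  | arr (T : VTy L) (C : CTy L)

/-- Computation types `⟨Sg⟩ T / S`.  The signature `Sg` is a partial map from operation names to
type schemes (finiteness of its domain is part of well-formedness). -/
inductive CTy (L : Language.{u}) : Type u
  | comp (Sg : L.OpName → Scheme L) (T : VTy L) (S : Eff L)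

/-- The entry of a signature for one operation: nothing, or a type scheme
`∀ X₁ : Bs₁, …, Xₙ : Bsₙ. (x : T₁) → ((y : T₂) → C₁) → C₂`
(in all components, predicate index `i < n` is the `i`-th quantified predicate variable;
`T₂`, `C₂` are below `x`, and `C₁` is below `x`, `y`). -/
inductive Scheme (L : Language.{u}) : Type u
  | absent
  | present (Bss : List (List L.Base)) (T₁ T₂ : VTy L) (C₁ C₂ : CTy L)

/-- Control effects: pure, or `(∀ x. C₁) ⇒ C₂` (binding one value variable in `C₁`). -/
inductive Eff (L : Language.{u}) : Type u
  | pure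
  | atm (C₁ C₂ : CTy L)

end

mutual

def VTy.ren {L : Language.{u}} (ξ η : ℕ → ℕ) : VTy L → VTy L
  | .rfn B φ => .rfn B (φ.ren (liftRen 1 ξ) η)
  | .arr T C => .arr (T.ren ξ η) (C.ren (liftRen 1 ξ) η)

def CTy.ren {L : Language.{u}} (ξ η : ℕ → ℕ) : CTy L → CTy L
  | .comp Sg T S => .comp (fun o => (Sg o).ren ξ η) (T.ren ξ η) (S.ren ξ η)

def Scheme.ren {L : Language.{u}} (ξ η : ℕ → ℕ) : Scheme L → Scheme L
  | .absent => .absent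
  | .present Bss T₁ T₂ C₁ C₂ =>
      .present Bss
        (T₁.ren ξ (liftRen Bss.length η))
        (T₂.ren (liftRen 1 ξ) (liftRen Bss.length η))
        (C₁.ren (liftRen 2 ξ) (liftRen Bss.length η))
        (C₂.ren (liftRen 1 ξ) (liftRen Bss.length η))

def Eff.ren {L : Language.{u}} (ξ η : ℕ → ℕ) : Eff L → Eff L
  | .pure => .pure
  | .atm C₁ C₂ => .atm (C₁.ren (liftRen 1 ξ) η) (C₂.ren ξ η)

end

mutual

def VTy.subst {L : Language.{u}} (τ : ℕ → Term L) (π : ℕ → Pred L) : VTy L → VTy L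
  | .rfn B φ => .rfn B (φ.subst (liftTm 1 τ) (weakPr 1 π))
  | .arr T C => .arr (T.subst τ π) (C.subst (liftTm 1 τ) (weakPr 1 π))

def CTy.subst {L : Language.{u}} (τ : ℕ → Term L) (π : ℕ → Pred L) : CTy L → CTy L
  | .comp Sg T S => .comp (fun o => (Sg o).subst τ π) (T.subst τ π) (S.subst τ π)

def Scheme.subst {L : Language.{u}} (τ : ℕ → Term L) (π : ℕ → Pred L) : Scheme L → Scheme L
  | .absent => .absent
  | .present Bss T₁ T₂ C₁ C₂ =>
      .present Bss
        (T₁.subst τ (liftPr Bss.length π))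
        (T₂.subst (liftTm 1 τ) (weakPr 1 (liftPr Bss.length π)))
        (C₁.subst (liftTm 2 τ) (weakPr 2 (liftPr Bss.length π)))
        (C₂.subst (liftTm 1 τ) (weakPr 1 (liftPr Bss.length π)))

def Eff.subst {L : Language.{u}} (τ : ℕ → Term L) (π : ℕ → Pred L) : Eff L → Eff L
  | .pure => .pure
  | .atm C₁ C₂ => .atm (C₁.subst (liftTm 1 τ) (weakPr 1 π)) (C₂.subst τ π)

end

/-- Weakening by one value variable. -/
def VTy.up {L : Language.{u}} (T : VTy L) : VTy L := T.ren (· + 1) id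

/-- Weakening by one value variable. -/
def CTy.up {L : Language.{u}} (C : CTy L) : CTy L := C.ren (· + 1) id

/-- Weakening by one value variable, inserted below the innermost one. -/
def CTy.upUnder {L : Language.{u}} (C : CTy L) : CTy L := C.ren (liftRen 1 (· + 1)) id

/-- Replaces value variable `0` by the value `v`. -/
def instTm {L : Language.{u}} (v : Value L) : ℕ → Term L
  | 0 => v.toTerm
  | n + 1 => .var n

/-- Replaces the first predicate variables by the predicates `As`. -/
def instPr {L : Language.{u}} (As : List (Pred L)) : ℕ → Pred L :=
  fun i => (As[i]?).getD (.pvar (i - As.length))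

/-- The empty operation signature. -/
def emptySig {L : Language.{u}} : L.OpName → Scheme L := fun _ => .absent

/-- The base type `B` as the value type `{z : B | true}`. -/
def VTy.base {L : Language.{u}} (B : L.Base) : VTy L := .rfn B .tru

/-! ### Typing contexts -/

/-- Bindings `x : T` and `X : Bs`. -/
inductive Entry (L : Language.{u}) : Type u
  | val (T : VTy L)
  | pred (Bs : List L.Base)

/-- Typing contexts; the most recent binding comes first. -/
abbrev Ctx (L : Language.{u}) : Type u := List (Entry L)

/-- The type of a value variable, weakened to the whole context. -/
def Ctx.lookup {L : Language.{u}} : Ctx L → ℕ → Option (VTy L)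
  | [], _ => none
  | .val T :: _, 0 => some T.up
  | .val _ :: Γ, n + 1 => (Ctx.lookup Γ n).map VTy.up
  | .pred _ :: Γ, n => (Ctx.lookup Γ n).map (VTy.ren id (· + 1))

/-- The argument sorts of a predicate variable. -/
def Ctx.plookup {L : Language.{u}} : Ctx L → ℕ → Option (List L.Base)
  | [], _ => none
  | .val _ :: Γ, n => Ctx.plookup Γ n
  | .pred Bs :: _, 0 => some Bs
  | .pred _ :: Γ, n + 1 => Ctx.plookup Γ n

/-- `Γ` extended by variables of the base types `Bs`. -/
def Ctx.addVals {L : Language.{u}} (Γ : Ctx L) (Bs : List L.Base) : Ctx L :=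
  Bs.map (fun B => Entry.val (VTy.base B)) ++ Γ

/-- `Γ` extended by predicate variables of the arities `Bss`. -/
def Ctx.addPreds {L : Language.{u}} (Γ : Ctx L) (Bss : List (List L.Base)) : Ctx L :=
  Bss.map Entry.pred ++ Γ

/-- `Γ, v = p`: the context `Γ, x : {z : bool | v = p}` with `x`, `z` fresh. -/
def Ctx.assume {L : Language.{u}} (Γ : Ctx L) (v : Value L) (p : L.Prim) : Ctx L :=
  .val (.rfn L.bool (.eq (v.toTerm.ren (· + 1)) (.prim p))) :: Γ

/-! ### The parameters of the calculus -/

/-- The types `ty(p)` and the reduction function `ζ` of primitive values, and an interpretation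
of the logic: a domain of individuals in which every base type is a set, primitive values are
individuals, and function symbols and logical symbols are functions and relations.
Logical symbols receive relations on base types as predicate arguments. -/
structure Calculus (L : Language.{u}) where
  ty : L.Prim → VTy L
  zeta : L.Prim → Value L → Option (Comp L)
  U : Type u
  carrier : L.Base → Set U
  den : L.Prim → U
  fnI : (f : L.Fn) → (Fin (L.fnArity f) → U) → U
  conI : (o : L.Con) → List U → (Fin (L.conArity o) → List U → Prop) → Prop
  den_mem : ∀ p B φ, ty p = .rfn B φ → den p ∈ carrier B
  fn_mem : ∀ f us, (∀ i, us i ∈ carrier (L.fnDom f i)) → fnI f us ∈ carrier (L.fnCod f)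
  carrier_bool : carrier L.bool = {den L.tt, den L.ff}
  tt_ne_ff : den L.tt ≠ den L.ff

variable {L : Language.{u}}

/-! ### Semantics of the logic -/

/-- The value of a term. -/
def Term.eval (M : Calculus L) (ρ : ℕ → M.U) : Term L → M.U
  | .var x => ρ x
  | .prim p => M.den p
  | .fn f ts => M.fnI f (fun i => (ts i).eval M ρ)
  | .func => M.den L.tt

/-- Extends an environment by the individuals in `l`. -/
def push {U : Type u} (l : List U) (ρ : ℕ → U) : ℕ → U :=
  fun i => (l[i]?).getD (ρ (i - l.length))

/-- `l` is a tuple of individuals of the sorts `Bs`. -/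
def IsTuple (M : Calculus L) (Bs : List L.Base) (l : List M.U) : Prop :=
  List.Forall₂ (fun u B => u ∈ M.carrier B) l Bs

mutual

/-- Truth of a formula under an assignment `ρ` to value variables and an assignment `θ` of
relations to predicate variables. -/
def Formula.Holds (M : Calculus L) (ρ : ℕ → M.U) (θ : ℕ → List M.U → Prop) : Formula L → Prop
  | .tru => True
  | .eq t₁ t₂ => t₁.eval M ρ = t₂.eval M ρ
  | .app A ts => A.Rel M ρ θ (ts.map (Term.eval M ρ))
  | .con o ts As => M.conI o (ts.map (Term.eval M ρ)) (fun i l => (As i).Rel M ρ θ l)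

/-- The relation (in `l`) denoted by a predicate. -/
def Pred.Rel (M : Calculus L) (ρ : ℕ → M.U) (θ : ℕ → List M.U → Prop) (l : List M.U) :
    Pred L → Prop
  | .pvar X => θ X l
  | .abs Bs φ => IsTuple M Bs l ∧ φ.Holds M (push l ρ) θ

end

/-- The assignments that satisfy a context: variables of a type `{z : B | φ}` denote elements of
`B` with the property `φ`, variables of function types are unconstrained, and predicate
variables denote relations of the declared arity. -/
def Ctx.Sat (M : Calculus L) : Ctx L → (ℕ → M.U) → (ℕ → List M.U → Prop) → Prop
  | [], _, _ => True
  | .val (.rfn B φ) :: Γ, ρ, θ =>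
      ρ 0 ∈ M.carrier B ∧ φ.Holds M ρ θ ∧ Ctx.Sat M Γ (fun n => ρ (n + 1)) θ
  | .val (.arr _ _) :: Γ, ρ, θ => Ctx.Sat M Γ (fun n => ρ (n + 1)) θ
  | .pred Bs :: Γ, ρ, θ =>
      (∀ l, θ 0 l → IsTuple M Bs l) ∧ Ctx.Sat M Γ ρ (fun n => θ (n + 1))

/-- `Γ ⊨ φ₁ ⟹ φ₂`. -/
def ValidImp (M : Calculus L) (Γ : Ctx L) (φ₁ φ₂ : Formula L) : Prop :=
  ∀ ρ θ, Ctx.Sat M Γ ρ θ → φ₁.Holds M ρ θ → φ₂.Holds M ρ θ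

/-! ### Well-formedness -/

/-- `Γ ⊢ t : B` for terms of the logic. -/
inductive HasSort (M : Calculus L) (Γ : Ctx L) : Term L → L.Base → Prop
  | var {x B φ} : Ctx.lookup Γ x = some (.rfn B φ) → HasSort M Γ (.var x) B
  | prim {p B φ} : M.ty p = .rfn B φ → HasSort M Γ (.prim p) B
  | fn {f ts} : (∀ i, HasSort M Γ (ts i) (L.fnDom f i)) → HasSort M Γ (.fn f ts) (L.fnCod f)

mutual

/-- `Γ ⊢ φ`. -/
inductive FormulaWF (M : Calculus L) : Ctx L → Formula L → Prop
  | tru {Γ} : FormulaWF M Γ .tru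
  | eq {Γ t₁ t₂ B} : HasSort M Γ t₁ B → HasSort M Γ t₂ B → FormulaWF M Γ (.eq t₁ t₂)
  | app {Γ A ts Bs} : PredWF M Γ A Bs → List.Forall₂ (HasSort M Γ) ts Bs →
      FormulaWF M Γ (.app A ts)
  | con {Γ o ts As} : List.Forall₂ (HasSort M Γ) ts (L.conDom o) →
      (∀ i, PredWF M Γ (As i) (L.conPreds o i)) → FormulaWF M Γ (.con o ts As)

/-- `Γ ⊢ A : Bs`. -/
inductive PredWF (M : Calculus L) : Ctx L → Pred L → List L.Base → Prop
  | pvar {Γ X Bs} : Ctx.plookup Γ X = some Bs → PredWF M Γ (.pvar X) Bs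
  | abs {Γ Bs φ} : FormulaWF M (Ctx.addVals Γ Bs) φ → PredWF M Γ (.abs Bs φ) Bs

end

mutual

/-- `⊢ Γ`. -/
inductive CtxWF (M : Calculus L) : Ctx L → Prop
  | nil : CtxWF M []
  | val {Γ T} : CtxWF M Γ → VTyWF M Γ T → CtxWF M (.val T :: Γ)
  | pred {Γ Bs} : CtxWF M Γ → CtxWF M (.pred Bs :: Γ)

/-- `Γ ⊢ T`. -/
inductive VTyWF (M : Calculus L) : Ctx L → VTy L → Prop
  | rfn {Γ B φ} : CtxWF M Γ → FormulaWF M (.val (VTy.base B) :: Γ) φ → VTyWF M Γ (.rfn B φ)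
  | arr {Γ T C} : CTyWF M (.val T :: Γ) C → VTyWF M Γ (.arr T C)

/-- `Γ ⊢ C`. -/
inductive CTyWF (M : Calculus L) : Ctx L → CTy L → Prop
  | comp {Γ Sg T S} : SigWF M Γ Sg → VTyWF M Γ T → EffWF M Γ T S → CTyWF M Γ (.comp Sg T S)

/-- `Γ ⊢ Sg`. -/
inductive SigWF (M : Calculus L) : Ctx L → (L.OpName → Scheme L) → Prop
  | mk {Γ Sg} : Set.Finite {o | Sg o ≠ .absent} → (∀ o, SchemeWF M Γ (Sg o)) → SigWF M Γ Sg

/-- Well-formedness of a single type scheme of a signature. -/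
inductive SchemeWF (M : Calculus L) : Ctx L → Scheme L → Prop
  | absent {Γ} : SchemeWF M Γ .absent
  | present {Γ Bss T₁ T₂ C₁ C₂} :
      VTyWF M (.val T₁ :: Ctx.addPreds Γ Bss) (.arr T₂ C₁) →
      CTyWF M (.val T₁ :: Ctx.addPreds Γ Bss) C₂ →
      SchemeWF M Γ (.present Bss T₁ T₂ C₁ C₂)

/-- `Γ | T ⊢ S`. -/
inductive EffWF (M : Calculus L) : Ctx L → VTy L → Eff L → Prop
  | pure {Γ T} : CtxWF M Γ → EffWF M Γ T .pure
  | atm {Γ T C₁ C₂} : CTyWF M (.val T :: Γ) C₁ → CTyWF M Γ C₂ → EffWF M Γ T (.atm C₁ C₂)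

end

/-! ### Subtyping -/

mutual

/-- `Γ ⊢ T₁ <: T₂`. -/
inductive VSub (M : Calculus L) : Ctx L → VTy L → VTy L → Prop
  | rfn {Γ B φ₁ φ₂} : ValidImp M (.val (VTy.base B) :: Γ) φ₁ φ₂ →
      VSub M Γ (.rfn B φ₁) (.rfn B φ₂)
  | arr {Γ T₁ T₂ C₁ C₂} : VSub M Γ T₂ T₁ → CSub M (.val T₂ :: Γ) C₁ C₂ →
      VSub M Γ (.arr T₁ C₁) (.arr T₂ C₂)

/-- `Γ ⊢ C₁ <: C₂`. -/
inductive CSub (M : Calculus L) : Ctx L → CTy L → CTy L → Prop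
  | comp {Γ Sg₁ Sg₂ T₁ T₂ S₁ S₂} : SigSub M Γ Sg₂ Sg₁ → VSub M Γ T₁ T₂ → EffSub M Γ T₁ S₁ S₂ →
      CSub M Γ (.comp Sg₁ T₁ S₁) (.comp Sg₂ T₂ S₂)

/-- `Γ ⊢ Sg₁ <: Sg₂`. -/
inductive SigSub (M : Calculus L) : Ctx L → (L.OpName → Scheme L) → (L.OpName → Scheme L) → Prop
  | mk {Γ Sg₁ Sg₂} : (∀ o, SchemeSub M Γ (Sg₁ o) (Sg₂ o)) → SigSub M Γ Sg₁ Sg₂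

/-- Subtyping at a single operation: the smaller signature may have additional operations, and
schemes over the same predicate variables are compared as function types. -/
inductive SchemeSub (M : Calculus L) : Ctx L → Scheme L → Scheme L → Prop
  | absent {Γ s} : SchemeSub M Γ s .absent
  | present {Γ Bss T₁ T₂ C₁ C₂ T₁' T₂' C₁' C₂'} :
      VSub M (Ctx.addPreds Γ Bss) T₁' T₁ →
      VSub M (.val T₁' :: Ctx.addPreds Γ Bss) (.arr T₂' C₁') (.arr T₂ C₁) →
      CSub M (.val T₁' :: Ctx.addPreds Γ Bss) C₂ C₂' →
      SchemeSub M Γ (.present Bss T₁ T₂ C₁ C₂) (.present Bss T₁' T₂' C₁' C₂')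

/-- `Γ | T ⊢ S₁ <: S₂`. -/
inductive EffSub (M : Calculus L) : Ctx L → VTy L → Eff L → Eff L → Prop
  | pure {Γ T} : EffSub M Γ T .pure .pure
  | atm {Γ T C₁₁ C₁₂ C₂₁ C₂₂} : CSub M (.val T :: Γ) C₂₁ C₁₁ → CSub M Γ C₁₂ C₂₂ →
      EffSub M Γ T (.atm C₁₁ C₁₂) (.atm C₂₁ C₂₂)
  | embed {Γ T C₁ C₂} : CSub M (.val T :: Γ) C₁ C₂.up → EffSub M Γ T .pure (.atm C₁ C₂)

end

/-! ### Typing -/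

mutual

/-- `Γ ⊢ v : T`. -/
inductive VTyping (M : Calculus L) : Ctx L → Value L → VTy L → Prop
  | cvar {Γ x B φ} : CtxWF M Γ → Ctx.lookup Γ x = some (.rfn B φ) →
      VTyping M Γ (.var x) (.rfn B (.eq (.var 0) (.var (x + 1))))
  | var {Γ x T} : CtxWF M Γ → Ctx.lookup Γ x = some T → (∀ B φ, T ≠ .rfn B φ) →
      VTyping M Γ (.var x) T
  | prim {Γ p} : CtxWF M Γ → VTyping M Γ (.prim p) (M.ty p)
  | fix {Γ c T C} : CTyping M (.val T.up :: .val (.arr T C) :: Γ) c C.upUnder →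
      VTyping M Γ (.fix c) (.arr T C)
  | sub {Γ v T₁ T₂} : VTyping M Γ v T₁ → VSub M Γ T₁ T₂ → VTyWF M Γ T₂ → VTyping M Γ v T₂

/-- `Γ ⊢ c : C`. -/
inductive CTyping (M : Calculus L) : Ctx L → Comp L → CTy L → Prop
  | ret {Γ v T} : VTyping M Γ v T → CTyping M Γ (.ret v) (.comp emptySig T .pure)
  | app {Γ v₁ v₂ T C} : VTyping M Γ v₁ (.arr T C) → VTyping M Γ v₂ T →
      CTyping M Γ (.app v₁ v₂) (C.subst (instTm v₂) .pvar)
  | ite {Γ v c₁ c₂ φ C} : VTyping M Γ v (.rfn L.bool φ) →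
      CTyping M (Ctx.assume Γ v L.tt) (c₁.ren (· + 1)) C.up →
      CTyping M (Ctx.assume Γ v L.ff) (c₂.ren (· + 1)) C.up →
      CTyping M Γ (.ite v c₁ c₂) C
  | sub {Γ c C₁ C₂} : CTyping M Γ c C₁ → CSub M Γ C₁ C₂ → CTyWF M Γ C₂ → CTyping M Γ c C₂
  | letP {Γ c₁ c₂ Sg T₁ T₂} : CTyping M Γ c₁ (.comp Sg T₁ .pure) →
      CTyping M (.val T₁ :: Γ) c₂ (.comp (fun o => (Sg o).ren (· + 1) id) T₂.up .pure) →
      CTyping M Γ (.letIn c₁ c₂) (.comp Sg T₂ .pure)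
  | letIp {Γ c₁ c₂ Sg T₁ T₂ C C₁₂ C₂₁} : CTyping M Γ c₁ (.comp Sg T₁ (.atm C C₁₂)) →
      CTyping M (.val T₁ :: Γ) c₂
        (.comp (fun o => (Sg o).ren (· + 1) id) T₂.up (.atm C₂₁.upUnder C)) →
      CTyping M Γ (.letIn c₁ c₂) (.comp Sg T₂ (.atm C₂₁ C₁₂))
  | op {Γ o v Sg Bss T₁ T₂ C₁ C₂ As} : Sg o = .present Bss T₁ T₂ C₁ C₂ → SigWF M Γ Sg →
      List.Forall₂ (PredWF M Γ) As Bss → VTyping M Γ v (T₁.subst .var (instPr As)) →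
      CTyping M Γ (.op o v)
        (.comp Sg (T₂.subst (instTm v) (instPr As))
          ((Eff.atm C₁ C₂).subst (instTm v) (instPr As)))
  | handle {Γ cr cls c Sg T C₁ C₂} : CTyping M Γ c (.comp Sg T (.atm C₁ C₂)) →
      CTyping M (.val T :: Γ) cr C₁ → (∀ o, ClauseTyping M Γ (Sg o) (cls o)) →
      CTyping M Γ (.handle cr cls c) C₂

/-- The operation clause (if any) of a handler matches the type scheme (if any) of the
signature: the handler and the signature have the same operations. -/
inductive ClauseTyping (M : Calculus L) : Ctx L → Scheme L → Clause L → Prop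
  | absent {Γ} : ClauseTyping M Γ .absent .absent
  | present {Γ Bss T₁ T₂ C₁ C₂ c} :
      CTyping M (.val (.arr T₂ C₁) :: .val T₁ :: Ctx.addPreds Γ Bss) c C₂.up →
      ClauseTyping M Γ (.present Bss T₁ T₂ C₁ C₂) (.present c)

end

/-! ### Evaluation -/

/-- The one-step evaluation relation. -/
inductive Step (M : Calculus L) : Comp L → Comp L → Prop
  | letIn {c₁ c₁' c₂} : Step M c₁ c₁' → Step M (.letIn c₁ c₂) (.letIn c₁' c₂)
  | letRet {v c₂} : Step M (.letIn (.ret v) c₂) (c₂.subst (inst1 v))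
  | iteT {c₁ c₂} : Step M (.ite (.prim L.tt) c₁ c₂) c₁
  | iteF {c₁ c₂} : Step M (.ite (.prim L.ff) c₁ c₂) c₂
  | app {c v} : Step M (.app (.fix c) v) (c.subst (inst2 v (.fix c)))
  | prim {p v c} : M.zeta p v = some c → Step M (.app (.prim p) v) c
  | handle {cr cls c c'} : Step M c c' → Step M (.handle cr cls c) (.handle cr cls c')
  | handleRet {cr cls v} : Step M (.handle cr cls (.ret v)) (cr.subst (inst1 v))
  | handleOp {cr cls K o v c} : cls o = .present c →
      Step M (.handle cr cls (ECtx.plug K (.op o v))) (c.subst (inst2 (contFun cr cls K) v))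

/-! ### Appropriate types of primitive values -/

/-- The standing assumption that `ty` assigns an appropriate type to every primitive value:
types are closed and well-formed; a primitive value `p` of a base type has a singleton type
(its refinement holds exactly of `p`); the primitive values of type `bool` are the truth values;
and a primitive value of type `(x : T) → C`, applied to a value `v : T`, reduces by `ζ` to a
computation of type `C[v/x]`. -/
structure Calculus.Appropriate (M : Calculus L) : Prop where
  wf : ∀ p, VTyWF M [] (M.ty p)
  base : ∀ p B φ, M.ty p = .rfn B φ →
    ValidImp M [.val (VTy.base B)] φ (.eq (.var 0) (.prim p)) ∧
    ValidImp M [.val (VTy.base B)] (.eq (.var 0) (.prim p)) φ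
  bool : ∀ p, (∃ φ, M.ty p = .rfn L.bool φ) ↔ p = L.tt ∨ p = L.ff
  arr : ∀ p T C, M.ty p = .arr T C → ∀ v, VTyping M [] v T →
    ∃ c, M.zeta p v = some c ∧ CTyping M [] c (C.subst (instTm v) .pvar)

end ARM

/-! # Type safety for answer refinement types

Type safety follows from progress (`CTyping.progress`) and preservation (`Step.preservation`) for
closed computations. Both read off the typing rule for the outermost construct of a computation
(`CTyping.inv`); the uses of subsumption in between are merged by transitivity of subtyping.

Subtyping compares refinements only through the semantics of formulas, so weakening, narrowing and
substitution all preserve it for one reason: they turn satisfying assignments of the new context into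
satisfying assignments of the old one (`SemSubst`, `VSub.subst`). Transitivity (`VSub.trans`) needs
narrowing and is an induction on the type in the middle. Substitutions with equal denotations give
mutual subtypes (`VSub.of_semEq`), which yields reflexivity and the replacement of equals by equals.

Well-formed formulas contain no variables of function types. Well-formedness is therefore preserved by
every substitution that respects the sorts of the other variables (`SortSubst`), it is reflected by
weakening (`SortReflect`), and a substitution matters only at those other variables (`AgreeOn`).
It follows that all derivable types are well-formed (`CTyping.wf`).

The substitution lemma (`CTyping.subst`) covers values and predicates simultaneously. It asks that
a substituted value be typed in every renaming of the target context (`TySubst`), so that its instance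
for variables gives weakening without a separate induction. Where a variable `x` of a refinement type
receives the singleton type `{z | z = x}`, the substituted value has the corresponding singleton type
(`VTyping.self`) because it is a variable or a primitive value.

The central case of preservation is a handler that meets `K[op v]`. Inversion along the evaluation
context (`CTyping.plug_op_inv`) finds the instance of the scheme of `op` at which the operation is
performed, and types the captured continuation: if `op` expects from its continuation the answer type
`D(y)`, then `K[return y]` has `D(y)` as its final answer type. At the hole this says that returning
`y` turns `D(y)` into itself (`CTyping.ret_var_zero`); frames `let x = K in c` compose answer types,
and subsumption narrows the type of `y`. The substitution lemma then applies to the operation clause,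
with the predicates, the argument and the reified continuation (`OpInContext.contFun_typing`). -/

namespace ARM
variable {L : Language.{u}}

/-! ### Substitution algebra for values and computations -/

theorem liftRen_id (k : ℕ) : liftRen k (fun x => x) = fun x => x := by
  funext i; simp only [liftRen]; split <;> omega

theorem liftRen_add (k : ℕ) (ξ : ℕ → ℕ) (x : ℕ) : liftRen k ξ (x + k) = ξ x + k := by
  simp [liftRen]

theorem liftRen_one_zero (ξ : ℕ → ℕ) : liftRen 1 ξ 0 = 0 := rfl

theorem liftRen_one_succ (ξ : ℕ → ℕ) (x : ℕ) : liftRen 1 ξ (x + 1) = ξ x + 1 :=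
  liftRen_add 1 ξ x

theorem liftRen_two (ξ : ℕ → ℕ) : liftRen 2 ξ = liftRen 1 (liftRen 1 ξ) := by
  funext i
  rcases i with _ | _ | i
  · rfl
  · rfl
  · rw [liftRen_add 2, liftRen_one_succ, liftRen_one_succ]

theorem liftVal_var (k : ℕ) (ξ : ℕ → ℕ) :
    liftVal k (fun x => (.var (ξ x) : Value L)) = fun x => .var (liftRen k ξ x) := by
  funext i; simp only [liftVal, liftRen]; split <;> rfl

theorem liftVal_liftRen (k : ℕ) (ξ : ℕ → ℕ) (σ : ℕ → Value L) :
    (fun x => liftVal k σ (liftRen k ξ x)) = liftVal k (fun x => σ (ξ x)) := by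
  funext i
  by_cases h : i < k <;> simp [liftVal, liftRen, h]

mutual

theorem Value.ren_eq_subst (ξ : ℕ → ℕ) : ∀ v : Value L, v.ren ξ = v.subst (fun x => .var (ξ x))
  | .var x => rfl
  | .prim p => rfl
  | .fix c => by simp only [Value.ren, Value.subst, liftVal_var, Comp.ren_eq_subst _ c]

theorem Comp.ren_eq_subst (ξ : ℕ → ℕ) : ∀ c : Comp L, c.ren ξ = c.subst (fun x => .var (ξ x))
  | .ret v => by simp only [Comp.ren, Comp.subst, Value.ren_eq_subst _ v]
  | .op o v => by simp only [Comp.ren, Comp.subst, Value.ren_eq_subst _ v]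
  | .app v w => by
      simp only [Comp.ren, Comp.subst, Value.ren_eq_subst _ v, Value.ren_eq_subst _ w]
  | .ite v c d => by
      simp only [Comp.ren, Comp.subst, Value.ren_eq_subst _ v, Comp.ren_eq_subst _ c,
        Comp.ren_eq_subst _ d]
  | .letIn c d => by
      simp only [Comp.ren, Comp.subst, liftVal_var, Comp.ren_eq_subst _ c, Comp.ren_eq_subst _ d]
  | .handle cr cls c => by
      simp only [Comp.ren, Comp.subst, liftVal_var, Comp.ren_eq_subst _ cr,
        Comp.ren_eq_subst _ c, fun o => Clause.ren_eq_subst ξ (cls o)]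

theorem Clause.ren_eq_subst (ξ : ℕ → ℕ) :
    ∀ d : Clause L, d.ren ξ = d.subst (fun x => .var (ξ x))
  | .absent => rfl
  | .present c => by simp only [Clause.ren, Clause.subst, liftVal_var, Comp.ren_eq_subst _ c]

end

mutual

theorem Value.ren_subst (ξ : ℕ → ℕ) (σ : ℕ → Value L) :
    ∀ v : Value L, (v.ren ξ).subst σ = v.subst (fun x => σ (ξ x))
  | .var x => rfl
  | .prim p => rfl
  | .fix c => by simp only [Value.ren, Value.subst, liftVal_liftRen, Comp.ren_subst _ _ c]

theorem Comp.ren_subst (ξ : ℕ → ℕ) (σ : ℕ → Value L) :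
    ∀ c : Comp L, (c.ren ξ).subst σ = c.subst (fun x => σ (ξ x))
  | .ret v => by simp only [Comp.ren, Comp.subst, Value.ren_subst _ _ v]
  | .op o v => by simp only [Comp.ren, Comp.subst, Value.ren_subst _ _ v]
  | .app v w => by
      simp only [Comp.ren, Comp.subst, Value.ren_subst _ _ v, Value.ren_subst _ _ w]
  | .ite v c d => by
      simp only [Comp.ren, Comp.subst, Value.ren_subst _ _ v, Comp.ren_subst _ _ c,
        Comp.ren_subst _ _ d]
  | .letIn c d => by
      simp only [Comp.ren, Comp.subst, liftVal_liftRen, Comp.ren_subst _ _ c,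
        Comp.ren_subst _ _ d]
  | .handle cr cls c => by
      simp only [Comp.ren, Comp.subst, liftVal_liftRen, Comp.ren_subst _ _ cr,
        Comp.ren_subst _ _ c, fun o => Clause.ren_subst ξ σ (cls o)]

theorem Clause.ren_subst (ξ : ℕ → ℕ) (σ : ℕ → Value L) :
    ∀ d : Clause L, (d.ren ξ).subst σ = d.subst (fun x => σ (ξ x))
  | .absent => rfl
  | .present c => by
      simp only [Clause.ren, Clause.subst, liftVal_liftRen, Comp.ren_subst _ _ c]

end

theorem Value.ren_ren (ξ ξ' : ℕ → ℕ) (v : Value L) :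
    (v.ren ξ).ren ξ' = v.ren (fun x => ξ' (ξ x)) := by
  rw [Value.ren_eq_subst ξ', Value.ren_subst, ← Value.ren_eq_subst]

theorem Comp.ren_ren (ξ ξ' : ℕ → ℕ) (c : Comp L) :
    (c.ren ξ).ren ξ' = c.ren (fun x => ξ' (ξ x)) := by
  rw [Comp.ren_eq_subst ξ', Comp.ren_subst, ← Comp.ren_eq_subst]

theorem liftVal_ren (k : ℕ) (ξ : ℕ → ℕ) (σ : ℕ → Value L) :
    (fun x => (liftVal k σ x).ren (liftRen k ξ)) = liftVal k (fun x => (σ x).ren ξ) := by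
  funext i
  by_cases h : i < k
  · simp [liftVal, liftRen, h, Value.ren]
  · simp only [liftVal, h, if_false, Value.ren_ren, liftRen_add]

mutual

theorem Value.subst_ren (σ : ℕ → Value L) (ξ : ℕ → ℕ) :
    ∀ v : Value L, (v.subst σ).ren ξ = v.subst (fun x => (σ x).ren ξ)
  | .var x => rfl
  | .prim p => rfl
  | .fix c => by simp only [Value.ren, Value.subst, Comp.subst_ren _ _ c, liftVal_ren]

theorem Comp.subst_ren (σ : ℕ → Value L) (ξ : ℕ → ℕ) :
    ∀ c : Comp L, (c.subst σ).ren ξ = c.subst (fun x => (σ x).ren ξ)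
  | .ret v => by simp only [Comp.ren, Comp.subst, Value.subst_ren _ _ v]
  | .op o v => by simp only [Comp.ren, Comp.subst, Value.subst_ren _ _ v]
  | .app v w => by
      simp only [Comp.ren, Comp.subst, Value.subst_ren _ _ v, Value.subst_ren _ _ w]
  | .ite v c d => by
      simp only [Comp.ren, Comp.subst, Value.subst_ren _ _ v, Comp.subst_ren _ _ c,
        Comp.subst_ren _ _ d]
  | .letIn c d => by
      simp only [Comp.ren, Comp.subst, Comp.subst_ren _ _ c, Comp.subst_ren _ _ d, liftVal_ren]
  | .handle cr cls c => by
      simp only [Comp.ren, Comp.subst, Comp.subst_ren _ _ cr, liftVal_ren,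
        Comp.subst_ren _ _ c, fun o => Clause.subst_ren σ ξ (cls o)]

theorem Clause.subst_ren (σ : ℕ → Value L) (ξ : ℕ → ℕ) :
    ∀ d : Clause L, (d.subst σ).ren ξ = d.subst (fun x => (σ x).ren ξ)
  | .absent => rfl
  | .present c => by
      simp only [Clause.ren, Clause.subst, Comp.subst_ren _ _ c, liftVal_ren]

end

theorem liftVal_id (k : ℕ) : liftVal k (.var : ℕ → Value L) = .var := by
  have := liftVal_var (L := L) k (fun x => x)
  rwa [liftRen_id] at this

mutual

theorem Value.subst_id : ∀ v : Value L, v.subst .var = v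
  | .var x => rfl
  | .prim p => rfl
  | .fix c => by simp only [Value.subst, liftVal_id, Comp.subst_id c]

theorem Comp.subst_id : ∀ c : Comp L, c.subst .var = c
  | .ret v => by simp only [Comp.subst, Value.subst_id v]
  | .op o v => by simp only [Comp.subst, Value.subst_id v]
  | .app v w => by simp only [Comp.subst, Value.subst_id v, Value.subst_id w]
  | .ite v c d => by simp only [Comp.subst, Value.subst_id v, Comp.subst_id c, Comp.subst_id d]
  | .letIn c d => by simp only [Comp.subst, liftVal_id, Comp.subst_id c, Comp.subst_id d]
  | .handle cr cls c => by
      simp only [Comp.subst, liftVal_id, Comp.subst_id cr, Comp.subst_id c,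
        fun o => Clause.subst_id (cls o)]

theorem Clause.subst_id : ∀ d : Clause L, d.subst .var = d
  | .absent => rfl
  | .present c => by simp only [Clause.subst, liftVal_id, Comp.subst_id c]

end

theorem Value.ren_id (v : Value L) : v.ren (fun x => x) = v := by
  rw [Value.ren_eq_subst]; exact v.subst_id

theorem liftVal_one_succ (σ : ℕ → Value L) (x : ℕ) :
    liftVal 1 σ (x + 1) = (σ x).ren (· + 1) := by
  simp [liftVal]

theorem liftVal_two (σ : ℕ → Value L) : liftVal 2 σ = liftVal 1 (liftVal 1 σ) := by
  funext i
  rcases i with _ | _ | i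
  · rfl
  · rfl
  · rw [liftVal_one_succ, liftVal_one_succ, Value.ren_ren]; simp [liftVal]

/-- Weakening commutes with substitution. -/
theorem Comp.ren_succ_subst (σ : ℕ → Value L) (c : Comp L) :
    (c.ren (· + 1)).subst (liftVal 1 σ) = (c.subst σ).ren (· + 1) := by
  rw [Comp.ren_subst, Comp.subst_ren]; congr 1

theorem Comp.ren_succ_inst (v : Value L) (c : Comp L) :
    (c.ren (· + 1)).subst (inst1 v) = c := by
  rw [Comp.ren_subst]; exact c.subst_id

/-! ### Substitution algebra for the refinement logic -/

theorem Term.ren_eq_subst (ξ : ℕ → ℕ) (t : Term L) : t.ren ξ = t.subst (fun x => .var (ξ x)) := by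
  induction t with
  | fn f ts ih => simp only [Term.ren, Term.subst, ih]
  | _ => rfl

theorem Term.subst_subst (τ τ' : ℕ → Term L) (t : Term L) :
    (t.subst τ).subst τ' = t.subst (fun x => (τ x).subst τ') := by
  induction t with
  | fn f ts ih => simp only [Term.subst, ih]
  | _ => rfl

theorem Term.subst_id (t : Term L) : t.subst .var = t := by
  induction t with
  | fn f ts ih => simp only [Term.subst, ih]
  | _ => rfl

theorem Term.ren_subst (ξ : ℕ → ℕ) (τ : ℕ → Term L) (t : Term L) :
    (t.ren ξ).subst τ = t.subst (fun x => τ (ξ x)) := by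
  rw [Term.ren_eq_subst, Term.subst_subst]; rfl

theorem Term.subst_ren (τ : ℕ → Term L) (ξ : ℕ → ℕ) (t : Term L) :
    (t.subst τ).ren ξ = t.subst (fun x => (τ x).ren ξ) := by
  simp only [Term.ren_eq_subst, Term.subst_subst]

theorem Term.ren_ren (ξ ξ' : ℕ → ℕ) (t : Term L) :
    (t.ren ξ).ren ξ' = t.ren (fun x => ξ' (ξ x)) := by
  simp only [Term.ren_eq_subst, Term.subst_subst, Term.subst]

theorem Term.ren_id (t : Term L) : t.ren (fun x => x) = t := by
  rw [Term.ren_eq_subst]; exact t.subst_id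

theorem liftTm_var (k : ℕ) (ξ : ℕ → ℕ) :
    liftTm k (fun x => (.var (ξ x) : Term L)) = fun x => .var (liftRen k ξ x) := by
  funext i; simp only [liftTm, liftRen]; split <;> rfl

theorem liftTm_id (k : ℕ) : liftTm k (.var : ℕ → Term L) = .var := by
  have := liftTm_var (L := L) k (fun x => x)
  rwa [liftRen_id] at this

theorem liftTm_liftRen (k : ℕ) (ξ : ℕ → ℕ) (τ : ℕ → Term L) :
    (fun x => liftTm k τ (liftRen k ξ x)) = liftTm k (fun x => τ (ξ x)) := by
  funext i
  by_cases h : i < k <;> simp [liftTm, liftRen, h]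

theorem liftTm_add (k : ℕ) (τ : ℕ → Term L) (x : ℕ) : liftTm k τ (x + k) = (τ x).ren (· + k) := by
  simp [liftTm]

theorem liftTm_ren (k : ℕ) (ξ : ℕ → ℕ) (τ : ℕ → Term L) :
    (fun x => (liftTm k τ x).ren (liftRen k ξ)) = liftTm k (fun x => (τ x).ren ξ) := by
  funext i
  by_cases h : i < k
  · simp [liftTm, liftRen, h, Term.ren]
  · simp only [liftTm, h, if_false, Term.ren_ren, liftRen_add]

theorem liftTm_subst (k : ℕ) (τ τ' : ℕ → Term L) :
    (fun x => (liftTm k τ x).subst (liftTm k τ')) = liftTm k (fun x => (τ x).subst τ') := by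
  funext i
  by_cases h : i < k
  · simp [liftTm, h, Term.subst]
  · simp only [liftTm, h, if_false, Term.subst_ren, Term.ren_subst]
    simp

theorem weakPr_pvar (k : ℕ) (η : ℕ → ℕ) :
    weakPr k (fun X => (.pvar (η X) : Pred L)) = fun X => .pvar (η X) := rfl

mutual

theorem Formula.ren_eq_subst (ξ η : ℕ → ℕ) :
    ∀ φ : Formula L, φ.ren ξ η = φ.subst (fun x => .var (ξ x)) (fun X => .pvar (η X))
  | .tru => rfl
  | .eq t s => by simp only [Formula.ren, Formula.subst, Term.ren_eq_subst]
  | .app A ts => by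
      simp only [Formula.ren, Formula.subst, Pred.ren_eq_subst _ _ A, funext (Term.ren_eq_subst ξ)]
  | .con o ts As => by
      simp only [Formula.ren, Formula.subst, funext (Term.ren_eq_subst ξ),
        fun i => Pred.ren_eq_subst ξ η (As i)]

theorem Pred.ren_eq_subst (ξ η : ℕ → ℕ) :
    ∀ A : Pred L, A.ren ξ η = A.subst (fun x => .var (ξ x)) (fun X => .pvar (η X))
  | .pvar X => rfl
  | .abs Bs φ => by
      simp only [Pred.ren, Pred.subst, Formula.ren_eq_subst _ _ φ, liftTm_var, weakPr_pvar]

end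

mutual

theorem Formula.ren_subst (ξ η : ℕ → ℕ) (τ : ℕ → Term L) (π : ℕ → Pred L) :
    ∀ φ : Formula L, (φ.ren ξ η).subst τ π = φ.subst (fun x => τ (ξ x)) (fun X => π (η X))
  | .tru => rfl
  | .eq t s => by simp only [Formula.ren, Formula.subst, Term.ren_subst]
  | .app A ts => by
      simp only [Formula.ren, Formula.subst, Pred.ren_subst _ _ _ _ A, List.map_map,
        Function.comp_def, Term.ren_subst]
  | .con o ts As => by
      simp only [Formula.ren, Formula.subst, List.map_map, Function.comp_def, Term.ren_subst,
        fun i => Pred.ren_subst ξ η τ π (As i)]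

theorem Pred.ren_subst (ξ η : ℕ → ℕ) (τ : ℕ → Term L) (π : ℕ → Pred L) :
    ∀ A : Pred L, (A.ren ξ η).subst τ π = A.subst (fun x => τ (ξ x)) (fun X => π (η X))
  | .pvar X => rfl
  | .abs Bs φ => by
      simp only [Pred.ren, Pred.subst, Formula.ren_subst _ _ _ _ φ, liftTm_liftRen]; rfl

end

theorem Pred.ren_ren (ξ η ξ' η' : ℕ → ℕ) (A : Pred L) :
    (A.ren ξ η).ren ξ' η' = A.ren (fun x => ξ' (ξ x)) (fun X => η' (η X)) := by
  rw [Pred.ren_eq_subst ξ', Pred.ren_subst, ← Pred.ren_eq_subst]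

theorem weakPr_ren (k : ℕ) (ξ η : ℕ → ℕ) (π : ℕ → Pred L) :
    (fun X => (weakPr k π X).ren (liftRen k ξ) η) = weakPr k (fun X => (π X).ren ξ η) := by
  funext X; simp only [weakPr, Pred.ren_ren, liftRen_add, id]

mutual

theorem Formula.subst_ren (τ : ℕ → Term L) (π : ℕ → Pred L) (ξ η : ℕ → ℕ) :
    ∀ φ : Formula L, (φ.subst τ π).ren ξ η =
      φ.subst (fun x => (τ x).ren ξ) (fun X => (π X).ren ξ η)
  | .tru => rfl
  | .eq t s => by simp only [Formula.ren, Formula.subst, Term.subst_ren]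
  | .app A ts => by
      simp only [Formula.ren, Formula.subst, Pred.subst_ren _ _ _ _ A, List.map_map,
        Function.comp_def, Term.subst_ren]
  | .con o ts As => by
      simp only [Formula.ren, Formula.subst, List.map_map, Function.comp_def, Term.subst_ren,
        fun i => Pred.subst_ren τ π ξ η (As i)]

theorem Pred.subst_ren (τ : ℕ → Term L) (π : ℕ → Pred L) (ξ η : ℕ → ℕ) :
    ∀ A : Pred L, (A.subst τ π).ren ξ η =
      A.subst (fun x => (τ x).ren ξ) (fun X => (π X).ren ξ η)
  | .pvar X => rfl
  | .abs Bs φ => by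
      simp only [Pred.ren, Pred.subst, Formula.subst_ren _ _ _ _ φ, liftTm_ren, weakPr_ren]

end

theorem weakPr_subst (k : ℕ) (τ' : ℕ → Term L) (π π' : ℕ → Pred L) :
    (fun X => (weakPr k π X).subst (liftTm k τ') (weakPr k π')) =
      weakPr k (fun X => (π X).subst τ' π') := by
  funext X
  simp only [weakPr, Pred.ren_subst, Pred.subst_ren, liftTm_add, id]

mutual

theorem Formula.subst_subst (τ τ' : ℕ → Term L) (π π' : ℕ → Pred L) :
    ∀ φ : Formula L, (φ.subst τ π).subst τ' π' =
      φ.subst (fun x => (τ x).subst τ') (fun X => (π X).subst τ' π')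
  | .tru => rfl
  | .eq t s => by simp only [Formula.subst, Term.subst_subst]
  | .app A ts => by
      simp only [Formula.subst, Pred.subst_subst _ _ _ _ A, List.map_map,
        Function.comp_def, Term.subst_subst]
  | .con o ts As => by
      simp only [Formula.subst, List.map_map, Function.comp_def, Term.subst_subst,
        fun i => Pred.subst_subst τ τ' π π' (As i)]

theorem Pred.subst_subst (τ τ' : ℕ → Term L) (π π' : ℕ → Pred L) :
    ∀ A : Pred L, (A.subst τ π).subst τ' π' =
      A.subst (fun x => (τ x).subst τ') (fun X => (π X).subst τ' π')
  | .pvar X => rfl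
  | .abs Bs φ => by
      simp only [Pred.subst, Formula.subst_subst _ _ _ _ φ, liftTm_subst, weakPr_subst]

end

mutual

theorem Formula.subst_id : ∀ φ : Formula L, φ.subst .var .pvar = φ
  | .tru => rfl
  | .eq t s => by simp only [Formula.subst, Term.subst_id]
  | .app A ts => by
      simp only [Formula.subst, Pred.subst_id A, funext (Term.subst_id (L := L)), List.map_id']
  | .con o ts As => by
      simp only [Formula.subst, funext (Term.subst_id (L := L)), List.map_id',
        fun i => Pred.subst_id (As i)]

theorem Pred.subst_id : ∀ A : Pred L, A.subst .var .pvar = A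
  | .pvar X => rfl
  | .abs Bs φ => by
      simp only [Pred.subst, liftTm_id]; exact congrArg _ (Formula.subst_id φ)

end

/-! ### Substitution algebra for types -/

theorem liftPr_pvar (k : ℕ) (η : ℕ → ℕ) :
    liftPr k (fun X => (.pvar (η X) : Pred L)) = fun X => .pvar (liftRen k η X) := by
  funext i; simp only [liftPr, liftRen]; split <;> rfl

theorem liftPr_id (k : ℕ) : liftPr k (.pvar : ℕ → Pred L) = .pvar := by
  have := liftPr_pvar (L := L) k (fun x => x)
  rwa [liftRen_id] at this

theorem liftPr_subst (k : ℕ) (τ : ℕ → Term L) (π π' : ℕ → Pred L) :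
    (fun X => (liftPr k π X).subst τ (liftPr k π')) =
      liftPr k (fun X => (π X).subst τ π') := by
  funext i
  by_cases h : i < k
  · simp [liftPr, h, Pred.subst]
  · simp only [liftPr, h, if_false, Pred.subst_ren, Pred.ren_subst]
    congr 1
    · funext x; exact (Term.ren_id _).symm
    · funext x; simp

mutual

theorem VTy.ren_eq_subst (ξ η : ℕ → ℕ) :
    ∀ T : VTy L, T.ren ξ η = T.subst (fun x => .var (ξ x)) (fun X => .pvar (η X))
  | .rfn B φ => by simp only [VTy.ren, VTy.subst, Formula.ren_eq_subst, liftTm_var, weakPr_pvar]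
  | .arr T C => by
      simp only [VTy.ren, VTy.subst, liftTm_var, weakPr_pvar, VTy.ren_eq_subst _ _ T,
        CTy.ren_eq_subst _ _ C]

theorem CTy.ren_eq_subst (ξ η : ℕ → ℕ) :
    ∀ C : CTy L, C.ren ξ η = C.subst (fun x => .var (ξ x)) (fun X => .pvar (η X))
  | .comp Sg T S => by
      simp only [CTy.ren, CTy.subst, VTy.ren_eq_subst _ _ T, Eff.ren_eq_subst _ _ S,
        fun o => Scheme.ren_eq_subst ξ η (Sg o)]

theorem Scheme.ren_eq_subst (ξ η : ℕ → ℕ) :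
    ∀ s : Scheme L, s.ren ξ η = s.subst (fun x => .var (ξ x)) (fun X => .pvar (η X))
  | .absent => rfl
  | .present Bss T₁ T₂ C₁ C₂ => by
      simp only [Scheme.ren, Scheme.subst, liftTm_var, weakPr_pvar, liftPr_pvar,
        VTy.ren_eq_subst _ _ T₁, VTy.ren_eq_subst _ _ T₂, CTy.ren_eq_subst _ _ C₁,
        CTy.ren_eq_subst _ _ C₂]

theorem Eff.ren_eq_subst (ξ η : ℕ → ℕ) :
    ∀ S : Eff L, S.ren ξ η = S.subst (fun x => .var (ξ x)) (fun X => .pvar (η X))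
  | .pure => rfl
  | .atm C₁ C₂ => by
      simp only [Eff.ren, Eff.subst, liftTm_var, weakPr_pvar, CTy.ren_eq_subst _ _ C₁,
        CTy.ren_eq_subst _ _ C₂]

end

mutual

theorem VTy.subst_subst (τ τ' : ℕ → Term L) (π π' : ℕ → Pred L) :
    ∀ T : VTy L, (T.subst τ π).subst τ' π' =
      T.subst (fun x => (τ x).subst τ') (fun X => (π X).subst τ' π')
  | .rfn B φ => by simp only [VTy.subst, Formula.subst_subst, liftTm_subst, weakPr_subst]
  | .arr T C => by
      simp only [VTy.subst, liftTm_subst, weakPr_subst, VTy.subst_subst _ _ _ _ T,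
        CTy.subst_subst _ _ _ _ C]

theorem CTy.subst_subst (τ τ' : ℕ → Term L) (π π' : ℕ → Pred L) :
    ∀ C : CTy L, (C.subst τ π).subst τ' π' =
      C.subst (fun x => (τ x).subst τ') (fun X => (π X).subst τ' π')
  | .comp Sg T S => by
      simp only [CTy.subst, VTy.subst_subst _ _ _ _ T, Eff.subst_subst _ _ _ _ S,
        fun o => Scheme.subst_subst τ τ' π π' (Sg o)]

theorem Scheme.subst_subst (τ τ' : ℕ → Term L) (π π' : ℕ → Pred L) :
    ∀ s : Scheme L, (s.subst τ π).subst τ' π' =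
      s.subst (fun x => (τ x).subst τ') (fun X => (π X).subst τ' π')
  | .absent => rfl
  | .present Bss T₁ T₂ C₁ C₂ => by
      simp only [Scheme.subst, VTy.subst_subst _ _ _ _ T₁, VTy.subst_subst _ _ _ _ T₂,
        CTy.subst_subst _ _ _ _ C₁, CTy.subst_subst _ _ _ _ C₂, liftTm_subst, weakPr_subst,
        liftPr_subst]

theorem Eff.subst_subst (τ τ' : ℕ → Term L) (π π' : ℕ → Pred L) :
    ∀ S : Eff L, (S.subst τ π).subst τ' π' =
      S.subst (fun x => (τ x).subst τ') (fun X => (π X).subst τ' π')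
  | .pure => rfl
  | .atm C₁ C₂ => by
      simp only [Eff.subst, liftTm_subst, weakPr_subst, CTy.subst_subst _ _ _ _ C₁,
        CTy.subst_subst _ _ _ _ C₂]

end

theorem weakPr_id (k : ℕ) : weakPr k (.pvar : ℕ → Pred L) = .pvar := rfl

mutual

theorem VTy.subst_id : ∀ T : VTy L, T.subst .var .pvar = T
  | .rfn B φ => by simp only [VTy.subst, Formula.subst_id, liftTm_id, weakPr_id]
  | .arr T C => by simp only [VTy.subst, liftTm_id, weakPr_id, VTy.subst_id T, CTy.subst_id C]

theorem CTy.subst_id : ∀ C : CTy L, C.subst .var .pvar = C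
  | .comp Sg T S => by
      simp only [CTy.subst, VTy.subst_id T, Eff.subst_id S, fun o => Scheme.subst_id (Sg o)]

theorem Scheme.subst_id : ∀ s : Scheme L, s.subst .var .pvar = s
  | .absent => rfl
  | .present Bss T₁ T₂ C₁ C₂ => by
      simp only [Scheme.subst, VTy.subst_id T₁, VTy.subst_id T₂, CTy.subst_id C₁,
        CTy.subst_id C₂, liftTm_id, weakPr_id, liftPr_id]

theorem Eff.subst_id : ∀ S : Eff L, S.subst .var .pvar = S
  | .pure => rfl
  | .atm C₁ C₂ => by
      simp only [Eff.subst, liftTm_id, weakPr_id, CTy.subst_id C₁, CTy.subst_id C₂]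

end

/-! ### Commutation of substitution with weakening and instantiation -/

theorem liftTm_one_succ (τ : ℕ → Term L) (x : ℕ) : liftTm 1 τ (x + 1) = (τ x).ren (· + 1) :=
  liftTm_add 1 τ x

theorem liftTm_two (τ : ℕ → Term L) : liftTm 2 τ = liftTm 1 (liftTm 1 τ) := by
  funext i
  rcases i with _ | _ | i
  · rfl
  · rfl
  · rw [liftTm_one_succ, liftTm_one_succ, Term.ren_ren, liftTm_add 2]

theorem weakPr_two (π : ℕ → Pred L) : weakPr 2 π = weakPr 1 (weakPr 1 π) := by
  funext i; simp only [weakPr, Pred.ren_ren]; rfl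

/-- The terms denoted by a substitution of values. -/
def toTm (σ : ℕ → Value L) : ℕ → Term L := fun x => (σ x).toTerm

theorem Value.toTerm_subst (σ : ℕ → Value L) (v : Value L) :
    (v.subst σ).toTerm = v.toTerm.subst (toTm σ) := by
  cases v <;> rfl

theorem Value.toTerm_ren (ξ : ℕ → ℕ) (v : Value L) : (v.ren ξ).toTerm = v.toTerm.ren ξ := by
  cases v <;> rfl

theorem toTm_liftVal (k : ℕ) (σ : ℕ → Value L) : toTm (liftVal k σ) = liftTm k (toTm σ) := by
  funext i
  by_cases h : i < k
  · simp [toTm, liftVal, liftTm, h, Value.toTerm]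
  · simp [toTm, liftVal, liftTm, h, Value.toTerm_ren]

theorem toTm_var : toTm (.var : ℕ → Value L) = .var := rfl

theorem toTm_inst1 (v : Value L) : toTm (inst1 v) = instTm v := by
  funext i; cases i <;> rfl

theorem VTy.ren_subst (ξ η : ℕ → ℕ) (τ : ℕ → Term L) (π : ℕ → Pred L) (T : VTy L) :
    (T.ren ξ η).subst τ π = T.subst (fun x => τ (ξ x)) (fun X => π (η X)) := by
  rw [VTy.ren_eq_subst, VTy.subst_subst]; rfl

theorem CTy.ren_subst (ξ η : ℕ → ℕ) (τ : ℕ → Term L) (π : ℕ → Pred L) (C : CTy L) :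
    (C.ren ξ η).subst τ π = C.subst (fun x => τ (ξ x)) (fun X => π (η X)) := by
  rw [CTy.ren_eq_subst, CTy.subst_subst]; rfl

theorem Scheme.ren_subst (ξ η : ℕ → ℕ) (τ : ℕ → Term L) (π : ℕ → Pred L) (s : Scheme L) :
    (s.ren ξ η).subst τ π = s.subst (fun x => τ (ξ x)) (fun X => π (η X)) := by
  rw [Scheme.ren_eq_subst, Scheme.subst_subst]; rfl

theorem VTy.subst_ren (ξ η : ℕ → ℕ) (τ : ℕ → Term L) (π : ℕ → Pred L) (T : VTy L) :
    (T.subst τ π).ren ξ η = T.subst (fun x => (τ x).ren ξ) (fun X => (π X).ren ξ η) := by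
  simp only [VTy.ren_eq_subst, VTy.subst_subst, Term.ren_eq_subst, Pred.ren_eq_subst]

theorem CTy.subst_ren (ξ η : ℕ → ℕ) (τ : ℕ → Term L) (π : ℕ → Pred L) (C : CTy L) :
    (C.subst τ π).ren ξ η = C.subst (fun x => (τ x).ren ξ) (fun X => (π X).ren ξ η) := by
  simp only [CTy.ren_eq_subst, CTy.subst_subst, Term.ren_eq_subst, Pred.ren_eq_subst]

theorem Scheme.subst_ren (ξ η : ℕ → ℕ) (τ : ℕ → Term L) (π : ℕ → Pred L) (s : Scheme L) :
    (s.subst τ π).ren ξ η = s.subst (fun x => (τ x).ren ξ) (fun X => (π X).ren ξ η) := by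
  simp only [Scheme.ren_eq_subst, Scheme.subst_subst, Term.ren_eq_subst, Pred.ren_eq_subst]

theorem VTy.ren_ren (ξ η ξ' η' : ℕ → ℕ) (T : VTy L) :
    (T.ren ξ η).ren ξ' η' = T.ren (fun x => ξ' (ξ x)) (fun X => η' (η X)) := by
  simp only [VTy.ren_eq_subst, VTy.subst_subst, Term.subst, Pred.subst]

theorem CTy.ren_ren (ξ η ξ' η' : ℕ → ℕ) (C : CTy L) :
    (C.ren ξ η).ren ξ' η' = C.ren (fun x => ξ' (ξ x)) (fun X => η' (η X)) := by
  simp only [CTy.ren_eq_subst, CTy.subst_subst, Term.subst, Pred.subst]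

theorem Scheme.ren_ren (ξ η ξ' η' : ℕ → ℕ) (s : Scheme L) :
    (s.ren ξ η).ren ξ' η' = s.ren (fun x => ξ' (ξ x)) (fun X => η' (η X)) := by
  simp only [Scheme.ren_eq_subst, Scheme.subst_subst, Term.subst, Pred.subst]

theorem VTy.ren_id (T : VTy L) : T.ren (fun x => x) (fun X => X) = T := by
  rw [VTy.ren_eq_subst]; exact T.subst_id

theorem VTy.up_subst (τ : ℕ → Term L) (π : ℕ → Pred L) (T : VTy L) :
    T.up.subst (liftTm 1 τ) (weakPr 1 π) = (T.subst τ π).up := by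
  simp only [VTy.up, VTy.ren_subst, VTy.subst_ren, liftTm_one_succ]; rfl

theorem CTy.up_subst (τ : ℕ → Term L) (π : ℕ → Pred L) (C : CTy L) :
    C.up.subst (liftTm 1 τ) (weakPr 1 π) = (C.subst τ π).up := by
  simp only [CTy.up, CTy.ren_subst, CTy.subst_ren, liftTm_one_succ]; rfl

theorem Scheme.up_subst (τ : ℕ → Term L) (π : ℕ → Pred L) (s : Scheme L) :
    (s.ren (· + 1) id).subst (liftTm 1 τ) (weakPr 1 π) = (s.subst τ π).ren (· + 1) id := by
  simp only [Scheme.ren_subst, Scheme.subst_ren, liftTm_one_succ]; rfl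

theorem CTy.upUnder_subst (τ : ℕ → Term L) (π : ℕ → Pred L) (C : CTy L) :
    C.upUnder.subst (liftTm 1 (liftTm 1 τ)) (weakPr 1 (weakPr 1 π)) =
      (C.subst (liftTm 1 τ) (weakPr 1 π)).upUnder := by
  simp only [CTy.upUnder, CTy.ren_subst, CTy.subst_ren]
  congr 1
  · funext x
    cases x with
    | zero => rfl
    | succ x =>
      simp only [liftRen_one_succ, liftTm_one_succ, Term.ren_ren]
  · funext X
    simp only [weakPr, Pred.ren_ren, id, liftRen_one_succ]

theorem VTy.up_inst (v : Value L) (π : ℕ → Pred L) (T : VTy L) :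
    T.up.subst (instTm v) π = T.subst .var π := by
  simp only [VTy.up, VTy.ren_subst]; rfl

theorem CTy.up_inst (v : Value L) (π : ℕ → Pred L) (C : CTy L) :
    C.up.subst (instTm v) π = C.subst .var π := by
  simp only [CTy.up, CTy.ren_subst]; rfl

theorem Scheme.up_inst (v : Value L) (s : Scheme L) :
    (s.ren (· + 1) id).subst (instTm v) .pvar = s := by
  rw [Scheme.ren_subst]; exact s.subst_id

theorem CTy.upUnder_inst (v : Value L) (C : CTy L) :
    C.upUnder.subst (liftTm 1 (instTm v)) .pvar = C := by
  rw [CTy.upUnder, CTy.ren_subst]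
  refine Eq.trans ?_ C.subst_id
  congr 1
  funext x
  cases x with
  | zero => rfl
  | succ x => rw [liftRen_one_succ, liftTm_one_succ]; rfl

/-- Substitution distributes over the instantiation of the innermost variable. -/
theorem CTy.inst_subst (v : Value L) (σ : ℕ → Value L) (π : ℕ → Pred L) (C : CTy L) :
    (C.subst (instTm v) .pvar).subst (toTm σ) π =
      (C.subst (liftTm 1 (toTm σ)) (weakPr 1 π)).subst (instTm (v.subst σ)) .pvar := by
  simp only [CTy.subst_subst]
  congr 1
  · funext x
    cases x with
    | zero => exact (Value.toTerm_subst σ v).symm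
    | succ x =>
      rw [liftTm_one_succ, Term.ren_subst]
      exact (Term.subst_id _).symm
  · funext X
    simp only [weakPr, Pred.ren_subst, Pred.subst]
    exact (Pred.subst_id _).symm

theorem instPr_add (As : List (Pred L)) (X : ℕ) : instPr As (X + As.length) = .pvar X := by
  simp [instPr]

theorem instPr_subst (As : List (Pred L)) (τ : ℕ → Term L) (π : ℕ → Pred L) (X : ℕ) :
    (instPr As X).subst τ π =
      (liftPr As.length π X).subst .var (instPr (As.map (Pred.subst τ π))) := by
  by_cases h : X < As.length
  · simp [instPr, liftPr, h, Pred.subst]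
  · have h' : As.length ≤ X := not_lt.mp h
    simp only [liftPr, h, if_false, Pred.ren_subst]
    simp only [instPr, List.getElem?_eq_none h', Option.getD_none, Pred.subst]
    refine (Pred.subst_id _).symm.trans ?_
    congr 1
    funext Y
    simp

/-- Substitution distributes over the instantiation of the quantified predicate variables of an
operation and of its argument. -/
theorem VTy.inst_op_subst (v : Value L) (As : List (Pred L)) (σ : ℕ → Value L) (π : ℕ → Pred L)
    (T : VTy L) :
    (T.subst (instTm v) (instPr As)).subst (toTm σ) π =
      (T.subst (liftTm 1 (toTm σ)) (weakPr 1 (liftPr As.length π))).subst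
        (instTm (v.subst σ)) (instPr (As.map (Pred.subst (toTm σ) π))) := by
  simp only [VTy.subst_subst]
  congr 1
  · funext x
    cases x with
    | zero => exact (Value.toTerm_subst σ v).symm
    | succ x =>
      rw [liftTm_one_succ, Term.ren_subst]
      exact (Term.subst_id _).symm
  · funext X
    rw [instPr_subst, weakPr, Pred.ren_subst]
    rfl

theorem CTy.inst_op_subst (v : Value L) (As : List (Pred L)) (σ : ℕ → Value L) (π : ℕ → Pred L)
    (C : CTy L) :
    (C.subst (instTm v) (instPr As)).subst (toTm σ) π =
      (C.subst (liftTm 1 (toTm σ)) (weakPr 1 (liftPr As.length π))).subst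
        (instTm (v.subst σ)) (instPr (As.map (Pred.subst (toTm σ) π))) := by
  simp only [CTy.subst_subst]
  congr 1
  · funext x
    cases x with
    | zero => exact (Value.toTerm_subst σ v).symm
    | succ x =>
      rw [liftTm_one_succ, Term.ren_subst]
      exact (Term.subst_id _).symm
  · funext X
    rw [instPr_subst, weakPr, Pred.ren_subst]
    rfl

/-- The variant of `CTy.inst_op_subst` for the answer type of the continuation, which is below
its own argument as well. -/
theorem CTy.inst_op_subst_lift (v : Value L) (As : List (Pred L)) (σ : ℕ → Value L)
    (π : ℕ → Pred L) (C : CTy L) :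
    (C.subst (liftTm 1 (instTm v)) (weakPr 1 (instPr As))).subst
        (liftTm 1 (toTm σ)) (weakPr 1 π) =
      (C.subst (liftTm 2 (toTm σ)) (weakPr 2 (liftPr As.length π))).subst
        (liftTm 1 (instTm (v.subst σ)))
        (weakPr 1 (instPr (As.map (Pred.subst (toTm σ) π)))) := by
  simp only [CTy.subst_subst]
  rw [liftTm_subst, weakPr_subst, liftTm_two, liftTm_subst, weakPr_two, weakPr_subst]
  congr 2
  · funext x
    cases x with
    | zero => exact (Value.toTerm_subst σ v).symm
    | succ x =>
      rw [liftTm_one_succ, Term.ren_subst]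
      exact (Term.subst_id _).symm
  · funext X
    rw [instPr_subst, weakPr, Pred.ren_subst]
    rfl

theorem VTy.inst_arg_subst (As : List (Pred L)) (τ : ℕ → Term L) (π : ℕ → Pred L) (T : VTy L) :
    (T.subst .var (instPr As)).subst τ π =
      (T.subst τ (liftPr As.length π)).subst .var (instPr (As.map (Pred.subst τ π))) := by
  simp only [VTy.subst_subst]
  congr 1
  · funext x; exact (Term.subst_id _).symm
  · funext X; exact instPr_subst As τ π X

theorem VTy.pup_subst (n : ℕ) (τ : ℕ → Term L) (π : ℕ → Pred L) (T : VTy L) :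
    (T.ren id (· + n)).subst τ (liftPr n π) = (T.subst τ π).ren id (· + n) := by
  simp only [VTy.ren_subst, VTy.subst_ren]
  congr 1
  · funext x; exact (Term.ren_id _).symm
  · funext X; simp [liftPr]

/-! ### Contexts -/

/-- The sort of a value type: its base type, if it is a refinement type. -/
def VTy.sort : VTy L → Option L.Base
  | .rfn B _ => some B
  | .arr _ _ => none

@[simp] theorem VTy.sort_ren (ξ η : ℕ → ℕ) (T : VTy L) : (T.ren ξ η).sort = T.sort := by
  cases T <;> rfl

@[simp] theorem VTy.sort_subst (τ : ℕ → Term L) (π : ℕ → Pred L) (T : VTy L) :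
    (T.subst τ π).sort = T.sort := by
  cases T <;> rfl

@[simp] theorem VTy.sort_up (T : VTy L) : T.up.sort = T.sort := T.sort_ren _ _

theorem VTy.sort_eq_some {T : VTy L} {B : L.Base} : T.sort = some B ↔ ∃ φ, T = .rfn B φ := by
  cases T <;> simp [VTy.sort, eq_comm]

/-- The sort of a variable that may occur in formulas, that is, of a variable of a refinement
type. -/
def Ctx.sort (Γ : Ctx L) (x : ℕ) : Option L.Base := (Γ.lookup x).bind VTy.sort

@[simp] theorem Ctx.sort_nil (x : ℕ) : Ctx.sort ([] : Ctx L) x = none := rfl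

@[simp] theorem Ctx.sort_val_zero (T : VTy L) (Γ : Ctx L) :
    Ctx.sort (.val T :: Γ) 0 = T.sort := by
  simp [Ctx.sort, Ctx.lookup]

@[simp] theorem Ctx.sort_val_succ (T : VTy L) (Γ : Ctx L) (x : ℕ) :
    Ctx.sort (.val T :: Γ) (x + 1) = Ctx.sort Γ x := by
  simp only [Ctx.sort, Ctx.lookup]; cases Ctx.lookup Γ x <;> simp

@[simp] theorem Ctx.sort_pred (Bs : List L.Base) (Γ : Ctx L) (x : ℕ) :
    Ctx.sort (.pred Bs :: Γ) x = Ctx.sort Γ x := by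
  simp only [Ctx.sort, Ctx.lookup]; cases Ctx.lookup Γ x <;> simp

theorem Ctx.sort_eq_some {Γ : Ctx L} {x : ℕ} {B : L.Base} :
    Γ.sort x = some B ↔ ∃ φ, Γ.lookup x = some (.rfn B φ) := by
  simp only [Ctx.sort, Option.bind_eq_some_iff, VTy.sort_eq_some]
  constructor
  · rintro ⟨T, h, φ, rfl⟩; exact ⟨φ, h⟩
  · rintro ⟨φ, h⟩; exact ⟨_, h, φ, rfl⟩

theorem Ctx.sort_addPreds (Γ : Ctx L) (Bss : List (List L.Base)) (x : ℕ) :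
    (Γ.addPreds Bss).sort x = Γ.sort x := by
  induction Bss with
  | nil => rfl
  | cons Bs Bss ih => exact (Ctx.sort_pred _ _ _).trans ih

theorem Ctx.sort_addVals_lt (Γ : Ctx L) (Bs : List L.Base) {x : ℕ} (h : x < Bs.length) :
    (Γ.addVals Bs).sort x = Bs[x]? := by
  induction Bs generalizing x with
  | nil => simp at h
  | cons B Bs ih =>
    cases x with
    | zero => exact Ctx.sort_val_zero _ _
    | succ x =>
      exact (Ctx.sort_val_succ _ _ _).trans ((ih (Nat.lt_of_succ_lt_succ h)).trans (by simp))

theorem Ctx.sort_addVals_add (Γ : Ctx L) (Bs : List L.Base) (x : ℕ) :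
    (Γ.addVals Bs).sort (x + Bs.length) = Γ.sort x := by
  induction Bs with
  | nil => rfl
  | cons B Bs ih => exact (Ctx.sort_val_succ _ _ _).trans ih

theorem Ctx.plookup_addVals (Γ : Ctx L) (Bs : List L.Base) (X : ℕ) :
    (Γ.addVals Bs).plookup X = Γ.plookup X := by
  induction Bs with
  | nil => rfl
  | cons B Bs ih => exact ih

theorem Ctx.plookup_addPreds_lt (Γ : Ctx L) (Bss : List (List L.Base)) {X : ℕ}
    (h : X < Bss.length) : (Γ.addPreds Bss).plookup X = Bss[X]? := by
  induction Bss generalizing X with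
  | nil => simp at h
  | cons B Bs ih =>
    cases X with
    | zero => rfl
    | succ x => exact (ih (Nat.lt_of_succ_lt_succ h)).trans (by simp)

theorem Ctx.plookup_addPreds_add (Γ : Ctx L) (Bss : List (List L.Base)) (X : ℕ) :
    (Γ.addPreds Bss).plookup (X + Bss.length) = Γ.plookup X := by
  induction Bss with
  | nil => rfl
  | cons B Bs ih => exact ih

theorem Ctx.lookup_addPreds (Γ : Ctx L) (Bss : List (List L.Base)) (x : ℕ) :
    (Γ.addPreds Bss).lookup x = (Γ.lookup x).map (VTy.ren id (· + Bss.length)) := by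
  induction Bss with
  | nil =>
    change Γ.lookup x = _
    cases Γ.lookup x with
    | none => rfl
    | some T => exact congrArg some T.ren_id.symm
  | cons Bs Bss ih =>
    change (Ctx.lookup (Ctx.addPreds Γ Bss) x).map _ = _
    rw [ih]
    cases Γ.lookup x with
    | none => rfl
    | some T =>
      simp only [Option.map_some, VTy.ren_ren, List.length_cons]
      rfl

/-! ### Well-formedness under substitution -/

variable {M : Calculus L}

theorem HasSort.var_iff {Γ : Ctx L} {x : ℕ} {B : L.Base} :
    HasSort M Γ (.var x) B ↔ Γ.sort x = some B := by
  rw [Ctx.sort_eq_some]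
  exact ⟨fun h => by cases h with | var h => exact ⟨_, h⟩, fun ⟨_, h⟩ => .var h⟩

/-- A renaming from `Γ` to `Γ'` that preserves the sorts of variables and the arities of predicate
variables. -/
structure SortRen (Γ' : Ctx L) (ξ η : ℕ → ℕ) (Γ : Ctx L) : Prop where
  tm : ∀ x B, Γ.sort x = some B → Γ'.sort (ξ x) = some B
  pr : ∀ X Bs, Γ.plookup X = some Bs → Γ'.plookup (η X) = some Bs

theorem SortRen.addVals {Γ Γ' : Ctx L} {ξ η : ℕ → ℕ} (h : SortRen Γ' ξ η Γ) (Bs : List L.Base) :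
    SortRen (Γ'.addVals Bs) (liftRen Bs.length ξ) η (Γ.addVals Bs) where
  tm x B hx := by
    by_cases hlt : x < Bs.length
    · simp only [liftRen, hlt, if_true]
      rw [Ctx.sort_addVals_lt _ _ hlt] at hx ⊢; exact hx
    · obtain ⟨y, rfl⟩ := Nat.exists_eq_add_of_le' (not_lt.mp hlt)
      rw [liftRen_add]
      rw [Ctx.sort_addVals_add] at hx ⊢; exact h.tm _ _ hx
  pr X Bs' hX := by
    rw [Ctx.plookup_addVals] at hX ⊢; exact h.pr _ _ hX

theorem HasSort.ren {Γ Γ' : Ctx L} {ξ η : ℕ → ℕ} (h : SortRen Γ' ξ η Γ) {t : Term L} {B : L.Base}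
    (ht : HasSort M Γ t B) : HasSort M Γ' (t.ren ξ) B := by
  induction ht with
  | var hx => exact HasSort.var_iff.mpr (h.tm _ _ (Ctx.sort_eq_some.mpr ⟨_, hx⟩))
  | prim hp => exact .prim hp
  | fn _ ih => exact .fn ih

theorem forall₂_map_hasSort {Γ Γ' : Ctx L} {f : Term L → Term L}
    (hf : ∀ t B, HasSort M Γ t B → HasSort M Γ' (f t) B) {ts : List (Term L)} {Bs : List L.Base}
    (h : List.Forall₂ (HasSort M Γ) ts Bs) : List.Forall₂ (HasSort M Γ') (ts.map f) Bs := by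
  induction h with
  | nil => exact .nil
  | cons h _ ih => exact .cons (hf _ _ h) ih

mutual

theorem FormulaWF.ren {Γ Γ' : Ctx L} {ξ η : ℕ → ℕ} {φ : Formula L} (h : SortRen Γ' ξ η Γ)
    (hφ : FormulaWF M Γ φ) : FormulaWF M Γ' (φ.ren ξ η) :=
  match hφ with
  | .tru => .tru
  | .eq h₁ h₂ => .eq (h₁.ren h) (h₂.ren h)
  | .app hA hts => .app (hA.ren h) (forall₂_map_hasSort (fun _ _ => HasSort.ren h) hts)
  | .con hts hAs =>
      .con (forall₂_map_hasSort (fun _ _ => HasSort.ren h) hts) (fun i => (hAs i).ren h)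

theorem PredWF.ren {Γ Γ' : Ctx L} {ξ η : ℕ → ℕ} {A : Pred L} {Bs : List L.Base}
    (h : SortRen Γ' ξ η Γ) (hA : PredWF M Γ A Bs) : PredWF M Γ' (A.ren ξ η) Bs :=
  match hA with
  | .pvar hX => .pvar (h.pr _ _ hX)
  | .abs hφ => .abs (hφ.ren (h.addVals _))

end

theorem SortRen.succ (T : VTy L) (Γ : Ctx L) : SortRen (.val T :: Γ) (· + 1) id Γ where
  tm x _ h := (Ctx.sort_val_succ T Γ x).trans h
  pr _ _ h := h

theorem SortRen.addVals_add (Bs : List L.Base) (Γ : Ctx L) :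
    SortRen (Γ.addVals Bs) (· + Bs.length) id Γ where
  tm x _ h := (Ctx.sort_addVals_add Γ Bs x).trans h
  pr X _ h := (Ctx.plookup_addVals Γ Bs X).trans h

theorem SortRen.addPreds_add (Bss : List (List L.Base)) (Γ : Ctx L) :
    SortRen (Γ.addPreds Bss) id (· + Bss.length) Γ where
  tm x _ h := (Ctx.sort_addPreds Γ Bss x).trans h
  pr X _ h := (Ctx.plookup_addPreds_add Γ Bss X).trans h

variable (M) in
/-- A substitution from `Γ` to `Γ'` that respects the sorts of variables and the arities of
predicate variables.  Nothing is required at variables of function types, which do not occur in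
well-formed formulas. -/
structure SortSubst (Γ' : Ctx L) (τ : ℕ → Term L) (π : ℕ → Pred L) (Γ : Ctx L) : Prop where
  tm : ∀ x B, Γ.sort x = some B → HasSort M Γ' (τ x) B
  pr : ∀ X Bs, Γ.plookup X = some Bs → PredWF M Γ' (π X) Bs

theorem SortRen.sortSubst {Γ Γ' : Ctx L} {ξ η : ℕ → ℕ} (h : SortRen Γ' ξ η Γ) :
    SortSubst M Γ' (fun x => .var (ξ x)) (fun X => .pvar (η X)) Γ where
  tm x B hx := HasSort.var_iff.mpr (h.tm x B hx)
  pr X Bs hX := .pvar (h.pr X Bs hX)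

theorem SortSubst.addVals {Γ Γ' : Ctx L} {τ : ℕ → Term L} {π : ℕ → Pred L}
    (h : SortSubst M Γ' τ π Γ) (Bs : List L.Base) :
    SortSubst M (Γ'.addVals Bs) (liftTm Bs.length τ) (weakPr Bs.length π) (Γ.addVals Bs) where
  tm x B hx := by
    by_cases hlt : x < Bs.length
    · simp only [liftTm, hlt, if_true]
      rw [Ctx.sort_addVals_lt _ _ hlt] at hx
      rw [HasSort.var_iff, Ctx.sort_addVals_lt _ _ hlt]; exact hx
    · obtain ⟨y, rfl⟩ := Nat.exists_eq_add_of_le' (not_lt.mp hlt)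
      rw [liftTm_add]
      rw [Ctx.sort_addVals_add] at hx
      exact (h.tm _ _ hx).ren (SortRen.addVals_add Bs Γ')
  pr X Bs' hX := by
    rw [Ctx.plookup_addVals] at hX
    exact (h.pr _ _ hX).ren (SortRen.addVals_add Bs Γ')

theorem SortSubst.val {Γ Γ' : Ctx L} {τ : ℕ → Term L} {π : ℕ → Pred L}
    (h : SortSubst M Γ' τ π Γ) {T T' : VTy L} (hT : T'.sort = T.sort) :
    SortSubst M (.val T' :: Γ') (liftTm 1 τ) (weakPr 1 π) (.val T :: Γ) where
  tm x B hx := by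
    cases x with
    | zero =>
      rw [Ctx.sort_val_zero] at hx
      exact HasSort.var_iff.mpr ((Ctx.sort_val_zero _ _).trans (hT.trans hx))
    | succ x =>
      rw [Ctx.sort_val_succ] at hx
      rw [liftTm_one_succ]
      exact (h.tm _ _ hx).ren (SortRen.succ T' Γ')
  pr X Bs' hX := (h.pr _ _ hX).ren (SortRen.succ T' Γ')

theorem SortSubst.addPreds {Γ Γ' : Ctx L} {τ : ℕ → Term L} {π : ℕ → Pred L}
    (h : SortSubst M Γ' τ π Γ) (Bss : List (List L.Base)) :
    SortSubst M (Γ'.addPreds Bss) τ (liftPr Bss.length π) (Γ.addPreds Bss) where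
  tm x B hx := by
    rw [Ctx.sort_addPreds] at hx
    have := (h.tm _ _ hx).ren (SortRen.addPreds_add Bss Γ')
    rwa [show (id : ℕ → ℕ) = fun x => x from rfl, Term.ren_id] at this
  pr X Bs hX := by
    by_cases hlt : X < Bss.length
    · simp only [liftPr, hlt, if_true]
      rw [Ctx.plookup_addPreds_lt _ _ hlt] at hX
      exact .pvar ((Ctx.plookup_addPreds_lt _ _ hlt).trans hX)
    · obtain ⟨Y, rfl⟩ := Nat.exists_eq_add_of_le' (not_lt.mp hlt)
      rw [Ctx.plookup_addPreds_add] at hX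
      simpa [liftPr] using (h.pr _ _ hX).ren (SortRen.addPreds_add Bss Γ')

theorem HasSort.subst {Γ Γ' : Ctx L} {τ : ℕ → Term L} {π : ℕ → Pred L}
    (h : SortSubst M Γ' τ π Γ) {t : Term L} {B : L.Base}
    (ht : HasSort M Γ t B) : HasSort M Γ' (t.subst τ) B := by
  induction ht with
  | var hx => exact h.tm _ _ (Ctx.sort_eq_some.mpr ⟨_, hx⟩)
  | prim hp => exact .prim hp
  | fn _ ih => exact .fn ih

mutual

theorem FormulaWF.subst {Γ Γ' : Ctx L} {τ : ℕ → Term L} {π : ℕ → Pred L} {φ : Formula L}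
    (h : SortSubst M Γ' τ π Γ) (hφ : FormulaWF M Γ φ) : FormulaWF M Γ' (φ.subst τ π) :=
  match hφ with
  | .tru => .tru
  | .eq h₁ h₂ => .eq (h₁.subst h) (h₂.subst h)
  | .app hA hts => .app (hA.subst h) (forall₂_map_hasSort (fun _ _ => HasSort.subst h) hts)
  | .con hts hAs =>
      .con (forall₂_map_hasSort (fun _ _ => HasSort.subst h) hts) (fun i => (hAs i).subst h)

theorem PredWF.subst {Γ Γ' : Ctx L} {τ : ℕ → Term L} {π : ℕ → Pred L} {A : Pred L}
    {Bs : List L.Base} (h : SortSubst M Γ' τ π Γ) (hA : PredWF M Γ A Bs) :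
    PredWF M Γ' (A.subst τ π) Bs :=
  match hA with
  | .pvar hX => h.pr _ _ hX
  | .abs hφ => .abs (hφ.subst (h.addVals _))

end

mutual

theorem VTyWF.ctxWF {Γ : Ctx L} {T : VTy L} (h : VTyWF M Γ T) : CtxWF M Γ :=
  match h with
  | .rfn h _ => h
  | .arr h => by cases h.ctxWF with | val h _ => exact h

theorem CTyWF.ctxWF {Γ : Ctx L} {C : CTy L} (h : CTyWF M Γ C) : CtxWF M Γ :=
  match h with
  | .comp _ h _ => h.ctxWF

end

theorem CtxWF.tail {Γ : Ctx L} {T : VTy L} (h : CtxWF M (.val T :: Γ)) : CtxWF M Γ := by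
  cases h with | val h _ => exact h

theorem CtxWF.head {Γ : Ctx L} {T : VTy L} (h : CtxWF M (.val T :: Γ)) : VTyWF M Γ T := by
  cases h with | val _ h => exact h

theorem CtxWF.addPreds {Γ : Ctx L} (h : CtxWF M Γ) (Bss : List (List L.Base)) :
    CtxWF M (Γ.addPreds Bss) := by
  induction Bss with
  | nil => exact h
  | cons Bs Bss ih => exact .pred ih

theorem VTyWF.arr_inv {Γ : Ctx L} {T : VTy L} {C : CTy L} (h : VTyWF M Γ (.arr T C)) :
    CTyWF M (.val T :: Γ) C := by
  cases h with | arr h => exact h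

theorem VTyWF.rfn_inv {Γ : Ctx L} {B : L.Base} {φ : Formula L} (h : VTyWF M Γ (.rfn B φ)) :
    FormulaWF M (.val (VTy.base B) :: Γ) φ := by
  cases h with | rfn _ h => exact h

theorem CTyWF.sig {Γ : Ctx L} {Sg : L.OpName → Scheme L} {T : VTy L} {S : Eff L}
    (h : CTyWF M Γ (.comp Sg T S)) : SigWF M Γ Sg := by
  cases h with | comp h _ _ => exact h

theorem CTyWF.vty {Γ : Ctx L} {Sg : L.OpName → Scheme L} {T : VTy L} {S : Eff L}
    (h : CTyWF M Γ (.comp Sg T S)) : VTyWF M Γ T := by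
  cases h with | comp _ h _ => exact h

theorem CTyWF.eff {Γ : Ctx L} {Sg : L.OpName → Scheme L} {T : VTy L} {S : Eff L}
    (h : CTyWF M Γ (.comp Sg T S)) : EffWF M Γ T S := by
  cases h with | comp _ _ h => exact h

theorem EffWF.arg {Γ : Ctx L} {T : VTy L} {C₁ C₂ : CTy L} (h : EffWF M Γ T (.atm C₁ C₂)) :
    CTyWF M (.val T :: Γ) C₁ := by
  cases h with | atm h _ => exact h

theorem EffWF.ans {Γ : Ctx L} {T : VTy L} {C₁ C₂ : CTy L} (h : EffWF M Γ T (.atm C₁ C₂)) :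
    CTyWF M Γ C₂ := by
  cases h with | atm _ h => exact h

theorem SigWF.scheme {Γ : Ctx L} {Sg : L.OpName → Scheme L} (h : SigWF M Γ Sg) (o : L.OpName) :
    SchemeWF M Γ (Sg o) := by
  cases h with | mk _ h => exact h o

theorem SigWF.finite {Γ : Ctx L} {Sg : L.OpName → Scheme L} (h : SigWF M Γ Sg) :
    Set.Finite {o | Sg o ≠ .absent} := by
  cases h with | mk h _ => exact h

section
variable {Γ : Ctx L} {Bss : List (List L.Base)} {T₁ T₂ : VTy L} {C₁ C₂ : CTy L}

theorem SchemeWF.fn (h : SchemeWF M Γ (.present Bss T₁ T₂ C₁ C₂)) :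
    VTyWF M (.val T₁ :: Ctx.addPreds Γ Bss) (.arr T₂ C₁) := by
  cases h with | present h _ => exact h

theorem SchemeWF.ans (h : SchemeWF M Γ (.present Bss T₁ T₂ C₁ C₂)) :
    CTyWF M (.val T₁ :: Ctx.addPreds Γ Bss) C₂ := by
  cases h with | present _ h => exact h

theorem SchemeWF.arg (h : SchemeWF M Γ (.present Bss T₁ T₂ C₁ C₂)) :
    VTyWF M (Ctx.addPreds Γ Bss) T₁ :=
  h.ans.ctxWF.head

theorem SchemeWF.res (h : SchemeWF M Γ (.present Bss T₁ T₂ C₁ C₂)) :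
    VTyWF M (.val T₁ :: Ctx.addPreds Γ Bss) T₂ :=
  h.fn.arr_inv.ctxWF.head

end

theorem Scheme.subst_ne_absent {τ : ℕ → Term L} {π : ℕ → Pred L} {s : Scheme L} :
    s.subst τ π ≠ .absent ↔ s ≠ .absent := by
  cases s <;> simp [Scheme.subst]

theorem Scheme.ren_ne_absent {ξ η : ℕ → ℕ} {s : Scheme L} :
    s.ren ξ η ≠ .absent ↔ s ≠ .absent := by
  cases s <;> simp [Scheme.ren]

mutual

theorem VTyWF.subst : ∀ {T : VTy L} {Γ Γ' : Ctx L} {τ : ℕ → Term L} {π : ℕ → Pred L},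
    CtxWF M Γ' → SortSubst M Γ' τ π Γ → VTyWF M Γ T → VTyWF M Γ' (T.subst τ π)
  | .rfn _ _, _, _, _, _, hΓ, h, hT => .rfn hΓ (hT.rfn_inv.subst (h.val rfl))
  | .arr _ _, _, _, _, _, hΓ, h, hT =>
      have hC := hT.arr_inv
      .arr (CTyWF.subst (.val hΓ (VTyWF.subst hΓ h hC.ctxWF.head)) (h.val (VTy.sort_subst _ _ _)) hC)

theorem CTyWF.subst : ∀ {C : CTy L} {Γ Γ' : Ctx L} {τ : ℕ → Term L} {π : ℕ → Pred L},
    CtxWF M Γ' → SortSubst M Γ' τ π Γ → CTyWF M Γ C → CTyWF M Γ' (C.subst τ π)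
  | .comp Sg _ _, _, _, _, _, hΓ, h, hC =>
      .comp (.mk (by simpa only [Scheme.subst_ne_absent] using hC.sig.finite)
        (fun o => SchemeWF.subst hΓ h (hC.sig.scheme o)))
        (VTyWF.subst hΓ h hC.vty) (EffWF.subst hΓ h (VTyWF.subst hΓ h hC.vty) hC.eff)

theorem SchemeWF.subst : ∀ {s : Scheme L} {Γ Γ' : Ctx L} {τ : ℕ → Term L} {π : ℕ → Pred L},
    CtxWF M Γ' → SortSubst M Γ' τ π Γ → SchemeWF M Γ s → SchemeWF M Γ' (s.subst τ π)
  | .absent, _, _, _, _, _, _, _ => .absent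
  | .present Bss T₁ T₂ C₁ C₂, _, _, τ, π, hΓ, h, hs => by
      have h₁ := h.addPreds Bss
      have hT₁ := VTyWF.subst (hΓ.addPreds Bss) h₁ hs.arg
      have hΓ₁ := CtxWF.val (hΓ.addPreds Bss) hT₁
      have h₂ := h₁.val (VTy.sort_subst τ (liftPr Bss.length π) T₁)
      have hT₂ := VTyWF.subst hΓ₁ h₂ hs.res
      have h₃ := h₂.val (VTy.sort_subst (liftTm 1 τ) (weakPr 1 (liftPr Bss.length π)) T₂)
      have hC₁ := CTyWF.subst (.val hΓ₁ hT₂) h₃ hs.fn.arr_inv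
      rw [← liftTm_two, ← weakPr_two] at hC₁
      exact .present (.arr hC₁) (CTyWF.subst hΓ₁ h₂ hs.ans)

theorem EffWF.subst : ∀ {S : Eff L} {Γ Γ' : Ctx L} {T : VTy L} {τ : ℕ → Term L} {π : ℕ → Pred L},
    CtxWF M Γ' → SortSubst M Γ' τ π Γ → VTyWF M Γ' (T.subst τ π) → EffWF M Γ T S →
      EffWF M Γ' (T.subst τ π) (S.subst τ π)
  | .pure, _, _, _, _, _, hΓ, _, _, _ => .pure hΓ
  | .atm _ _, _, _, _, _, _, hΓ, h, hT, hS =>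
      .atm (CTyWF.subst (.val hΓ hT) (h.val (VTy.sort_subst _ _ _)) hS.arg)
        (CTyWF.subst hΓ h hS.ans)

end

theorem SigWF.subst {Sg : L.OpName → Scheme L} {Γ Γ' : Ctx L} {τ : ℕ → Term L} {π : ℕ → Pred L}
    (hΓ : CtxWF M Γ') (h : SortSubst M Γ' τ π Γ) (hS : SigWF M Γ Sg) :
    SigWF M Γ' (fun o => (Sg o).subst τ π) :=
  .mk (by simpa only [Scheme.subst_ne_absent] using hS.finite)
    (fun o => (hS.scheme o).subst hΓ h)

theorem VTyWF.ren {T : VTy L} {Γ Γ' : Ctx L} {ξ η : ℕ → ℕ} (hΓ : CtxWF M Γ')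
    (h : SortRen Γ' ξ η Γ) (hT : VTyWF M Γ T) : VTyWF M Γ' (T.ren ξ η) := by
  rw [VTy.ren_eq_subst]; exact hT.subst hΓ h.sortSubst

theorem CTyWF.ren {C : CTy L} {Γ Γ' : Ctx L} {ξ η : ℕ → ℕ} (hΓ : CtxWF M Γ')
    (h : SortRen Γ' ξ η Γ) (hC : CTyWF M Γ C) : CTyWF M Γ' (C.ren ξ η) := by
  rw [CTy.ren_eq_subst]; exact hC.subst hΓ h.sortSubst

/-! ### Strengthening of well-formedness -/

/-- A renaming from `Γ` to `Γ'` that reflects sorts and arities.  Well-formedness is reflected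
along such renamings; this is how variables that do not occur in a type are dropped. -/
structure SortReflect (Γ' : Ctx L) (ξ η : ℕ → ℕ) (Γ : Ctx L) : Prop where
  tm : ∀ x B, Γ'.sort (ξ x) = some B → Γ.sort x = some B
  pr : ∀ X Bs, Γ'.plookup (η X) = some Bs → Γ.plookup X = some Bs

theorem SortReflect.addVals {Γ Γ' : Ctx L} {ξ η : ℕ → ℕ} (h : SortReflect Γ' ξ η Γ)
    (Bs : List L.Base) :
    SortReflect (Γ'.addVals Bs) (liftRen Bs.length ξ) η (Γ.addVals Bs) where
  tm x B hx := by
    by_cases hlt : x < Bs.length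
    · simp only [liftRen, hlt, if_true] at hx
      rw [Ctx.sort_addVals_lt _ _ hlt] at hx ⊢; exact hx
    · obtain ⟨y, rfl⟩ := Nat.exists_eq_add_of_le' (not_lt.mp hlt)
      rw [liftRen_add] at hx
      rw [Ctx.sort_addVals_add] at hx ⊢; exact h.tm _ _ hx
  pr X Bs' hX := by
    rw [Ctx.plookup_addVals] at hX ⊢; exact h.pr _ _ hX

theorem SortReflect.val {Γ Γ' : Ctx L} {ξ η : ℕ → ℕ} (h : SortReflect Γ' ξ η Γ) {T T' : VTy L}
    (hT : T'.sort = T.sort) : SortReflect (.val T' :: Γ') (liftRen 1 ξ) η (.val T :: Γ) where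
  tm x B hx := by
    cases x with
    | zero => rw [liftRen_one_zero, Ctx.sort_val_zero] at hx; rw [Ctx.sort_val_zero, ← hT, hx]
    | succ x =>
      rw [liftRen_one_succ, Ctx.sort_val_succ] at hx
      rw [Ctx.sort_val_succ]; exact h.tm _ _ hx
  pr := h.pr

theorem SortReflect.addPreds {Γ Γ' : Ctx L} {ξ η : ℕ → ℕ} (h : SortReflect Γ' ξ η Γ)
    (Bss : List (List L.Base)) :
    SortReflect (Γ'.addPreds Bss) ξ (liftRen Bss.length η) (Γ.addPreds Bss) where
  tm x B hx := by rw [Ctx.sort_addPreds] at hx ⊢; exact h.tm _ _ hx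
  pr X Bs hX := by
    by_cases hlt : X < Bss.length
    · simp only [liftRen, hlt, if_true] at hX
      rw [Ctx.plookup_addPreds_lt _ _ hlt] at hX ⊢; exact hX
    · obtain ⟨Y, rfl⟩ := Nat.exists_eq_add_of_le' (not_lt.mp hlt)
      rw [liftRen_add] at hX
      rw [Ctx.plookup_addPreds_add] at hX ⊢; exact h.pr _ _ hX

theorem HasSort.of_ren {Γ Γ' : Ctx L} {ξ η : ℕ → ℕ} (h : SortReflect Γ' ξ η Γ) {t : Term L}
    {B : L.Base} (ht : HasSort M Γ' (t.ren ξ) B) : HasSort M Γ t B := by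
  induction t generalizing B with
  | var x => exact HasSort.var_iff.mpr (h.tm _ _ (HasSort.var_iff.mp ht))
  | prim p => cases ht with | prim hp => exact .prim hp
  | fn f ts ih => cases ht with | fn hts => exact .fn (fun i => ih i (hts i))
  | func => cases ht

theorem forall₂_hasSort_of_map {Γ Γ' : Ctx L} {ξ η : ℕ → ℕ} (h : SortReflect Γ' ξ η Γ)
    {ts : List (Term L)} {Bs : List L.Base}
    (hts : List.Forall₂ (HasSort M Γ') (ts.map (Term.ren ξ)) Bs) :
    List.Forall₂ (HasSort M Γ) ts Bs := by
  rw [List.forall₂_map_left_iff] at hts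
  exact hts.imp (fun _ _ => HasSort.of_ren h)

mutual

theorem FormulaWF.of_ren : ∀ {φ : Formula L} {Γ Γ' : Ctx L} {ξ η : ℕ → ℕ},
    SortReflect Γ' ξ η Γ → FormulaWF M Γ' (φ.ren ξ η) → FormulaWF M Γ φ
  | .tru, _, _, _, _, _, _ => .tru
  | .eq _ _, _, _, _, _, h, .eq h₁ h₂ => .eq (h₁.of_ren h) (h₂.of_ren h)
  | .app _ _, _, _, _, _, h, .app hA hts =>
      .app (PredWF.of_ren h hA) (forall₂_hasSort_of_map h hts)
  | .con _ _ As, _, _, _, _, h, .con hts hAs =>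
      .con (forall₂_hasSort_of_map h hts) (fun i => PredWF.of_ren (A := As i) h (hAs i))

theorem PredWF.of_ren : ∀ {A : Pred L} {Γ Γ' : Ctx L} {ξ η : ℕ → ℕ} {Bs : List L.Base},
    SortReflect Γ' ξ η Γ → PredWF M Γ' (A.ren ξ η) Bs → PredWF M Γ A Bs
  | .pvar _, _, _, _, _, _, h, .pvar hX => .pvar (h.pr _ _ hX)
  | .abs _ _, _, _, _, _, _, h, .abs hφ => .abs (FormulaWF.of_ren (h.addVals _) hφ)

end

mutual

theorem VTyWF.of_ren : ∀ {T : VTy L} {Γ Γ' : Ctx L} {ξ η : ℕ → ℕ},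
    CtxWF M Γ → SortReflect Γ' ξ η Γ → VTyWF M Γ' (T.ren ξ η) → VTyWF M Γ T
  | .rfn _ _, _, _, _, _, hΓ, h, hT => .rfn hΓ (hT.rfn_inv.of_ren (h.val rfl))
  | .arr _ _, _, _, _, _, hΓ, h, hT =>
      have hC := hT.arr_inv
      .arr (CTyWF.of_ren (.val hΓ (VTyWF.of_ren hΓ h hC.ctxWF.head))
        (h.val (VTy.sort_ren _ _ _)) hC)

theorem CTyWF.of_ren : ∀ {C : CTy L} {Γ Γ' : Ctx L} {ξ η : ℕ → ℕ},
    CtxWF M Γ → SortReflect Γ' ξ η Γ → CTyWF M Γ' (C.ren ξ η) → CTyWF M Γ C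
  | .comp Sg _ _, _, _, _, _, hΓ, h, hC =>
      .comp (.mk (by simpa only [Scheme.ren_ne_absent] using hC.sig.finite)
        (fun o => SchemeWF.of_ren (s := Sg o) hΓ h (hC.sig.scheme o)))
        (VTyWF.of_ren hΓ h hC.vty) (EffWF.of_ren hΓ h (VTyWF.of_ren hΓ h hC.vty) hC.eff)

theorem SchemeWF.of_ren : ∀ {s : Scheme L} {Γ Γ' : Ctx L} {ξ η : ℕ → ℕ},
    CtxWF M Γ → SortReflect Γ' ξ η Γ → SchemeWF M Γ' (s.ren ξ η) → SchemeWF M Γ s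
  | .absent, _, _, _, _, _, _, _ => .absent
  | .present Bss T₁ T₂ C₁ C₂, _, _, ξ, η, hΓ, h, hs => by
      have h₁ := h.addPreds Bss
      have hT₁ := VTyWF.of_ren (hΓ.addPreds Bss) h₁ hs.arg
      have hΓ₁ := CtxWF.val (hΓ.addPreds Bss) hT₁
      have h₂ := h₁.val (VTy.sort_ren ξ (liftRen Bss.length η) T₁)
      have hT₂ := VTyWF.of_ren hΓ₁ h₂ hs.res
      have h₃ := h₂.val (VTy.sort_ren (liftRen 1 ξ) (liftRen Bss.length η) T₂)
      rw [← liftRen_two] at h₃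
      exact .present (.arr (CTyWF.of_ren (.val hΓ₁ hT₂) h₃ hs.fn.arr_inv))
        (CTyWF.of_ren hΓ₁ h₂ hs.ans)

theorem EffWF.of_ren : ∀ {S : Eff L} {Γ Γ' : Ctx L} {T : VTy L} {ξ η : ℕ → ℕ},
    CtxWF M Γ → SortReflect Γ' ξ η Γ → VTyWF M Γ T → EffWF M Γ' (T.ren ξ η) (S.ren ξ η) →
      EffWF M Γ T S
  | .pure, _, _, _, _, _, hΓ, _, _, _ => .pure hΓ
  | .atm _ _, _, _, _, _, _, hΓ, h, hT, hS =>
      .atm (CTyWF.of_ren (.val hΓ hT) (h.val (VTy.sort_ren _ _ _)) hS.arg)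
        (CTyWF.of_ren hΓ h hS.ans)

end

theorem SortReflect.succ (T : VTy L) (Γ : Ctx L) : SortReflect (.val T :: Γ) (· + 1) id Γ where
  tm x _ h := (Ctx.sort_val_succ T Γ x).symm.trans h
  pr _ _ h := h

/-! ### Substitution depends only on the variables that may occur -/

/-- Two substitutions agree on the variables of `Γ` that may occur in formulas. -/
structure AgreeOn (Γ : Ctx L) (τ τ' : ℕ → Term L) (π π' : ℕ → Pred L) : Prop where
  tm : ∀ x B, Γ.sort x = some B → τ x = τ' x
  pr : ∀ X Bs, Γ.plookup X = some Bs → π X = π' X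

theorem AgreeOn.addVals {Γ : Ctx L} {τ τ' : ℕ → Term L} {π π' : ℕ → Pred L}
    (h : AgreeOn Γ τ τ' π π') (Bs : List L.Base) :
    AgreeOn (Γ.addVals Bs) (liftTm Bs.length τ) (liftTm Bs.length τ')
      (weakPr Bs.length π) (weakPr Bs.length π') where
  tm x B hx := by
    by_cases hlt : x < Bs.length
    · simp only [liftTm, hlt, if_true]
    · obtain ⟨y, rfl⟩ := Nat.exists_eq_add_of_le' (not_lt.mp hlt)
      rw [Ctx.sort_addVals_add] at hx
      rw [liftTm_add, liftTm_add, h.tm _ _ hx]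
  pr X Bs' hX := by
    rw [Ctx.plookup_addVals] at hX
    rw [weakPr, weakPr, h.pr _ _ hX]

theorem AgreeOn.val {Γ : Ctx L} {τ τ' : ℕ → Term L} {π π' : ℕ → Pred L}
    (h : AgreeOn Γ τ τ' π π') (T : VTy L) :
    AgreeOn (.val T :: Γ) (liftTm 1 τ) (liftTm 1 τ') (weakPr 1 π) (weakPr 1 π') where
  tm x B hx := by
    cases x with
    | zero => rfl
    | succ x =>
      rw [Ctx.sort_val_succ] at hx
      rw [liftTm_one_succ, liftTm_one_succ, h.tm _ _ hx]
  pr X Bs' hX := by rw [weakPr, weakPr, h.pr X Bs' hX]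

theorem AgreeOn.addPreds {Γ : Ctx L} {τ τ' : ℕ → Term L} {π π' : ℕ → Pred L}
    (h : AgreeOn Γ τ τ' π π') (Bss : List (List L.Base)) :
    AgreeOn (Γ.addPreds Bss) τ τ' (liftPr Bss.length π) (liftPr Bss.length π') where
  tm x B hx := by rw [Ctx.sort_addPreds] at hx; exact h.tm _ _ hx
  pr X Bs hX := by
    by_cases hlt : X < Bss.length
    · simp only [liftPr, hlt, if_true]
    · obtain ⟨Y, rfl⟩ := Nat.exists_eq_add_of_le' (not_lt.mp hlt)
      rw [Ctx.plookup_addPreds_add] at hX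
      simp [liftPr, h.pr _ _ hX]

theorem HasSort.subst_congr {Γ : Ctx L} {τ τ' : ℕ → Term L} {π π' : ℕ → Pred L} {t : Term L}
    {B : L.Base} (h : AgreeOn Γ τ τ' π π') (ht : HasSort M Γ t B) : t.subst τ = t.subst τ' := by
  induction ht with
  | var hx => exact h.tm _ _ (Ctx.sort_eq_some.mpr ⟨_, hx⟩)
  | prim hp => rfl
  | fn _ ih => simp only [Term.subst, ih]

theorem map_subst_congr {Γ : Ctx L} {τ τ' : ℕ → Term L} {π π' : ℕ → Pred L} {ts : List (Term L)}
    {Bs : List L.Base} (h : AgreeOn Γ τ τ' π π') (hts : List.Forall₂ (HasSort M Γ) ts Bs) :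
    ts.map (Term.subst τ) = ts.map (Term.subst τ') := by
  induction hts with
  | nil => rfl
  | cons ht _ ih => rw [List.map_cons, List.map_cons, ih, ht.subst_congr h]

mutual

theorem FormulaWF.subst_congr {Γ : Ctx L} {τ τ' : ℕ → Term L} {π π' : ℕ → Pred L}
    {φ : Formula L} (h : AgreeOn Γ τ τ' π π') (hφ : FormulaWF M Γ φ) :
    φ.subst τ π = φ.subst τ' π' :=
  match hφ with
  | .tru => rfl
  | .eq h₁ h₂ => by simp only [Formula.subst, h₁.subst_congr h, h₂.subst_congr h]
  | .app hA hts => by simp only [Formula.subst, hA.subst_congr h, map_subst_congr h hts]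
  | .con hts hAs => by
      simp only [Formula.subst, map_subst_congr h hts, fun i => (hAs i).subst_congr h]

theorem PredWF.subst_congr {Γ : Ctx L} {τ τ' : ℕ → Term L} {π π' : ℕ → Pred L} {A : Pred L}
    {Bs : List L.Base} (h : AgreeOn Γ τ τ' π π') (hA : PredWF M Γ A Bs) :
    A.subst τ π = A.subst τ' π' :=
  match hA with
  | .pvar hX => h.pr _ _ hX
  | .abs hφ => by simp only [Pred.subst, hφ.subst_congr (h.addVals _)]

end

mutual

theorem VTyWF.subst_congr : ∀ {T : VTy L} {Γ : Ctx L} {τ τ' : ℕ → Term L} {π π' : ℕ → Pred L},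
    AgreeOn Γ τ τ' π π' → VTyWF M Γ T → T.subst τ π = T.subst τ' π'
  | .rfn _ _, _, _, _, _, _, h, hT => by
      simp only [VTy.subst, hT.rfn_inv.subst_congr (h.val _)]
  | .arr _ _, _, _, _, _, _, h, hT => by
      simp only [VTy.subst, VTyWF.subst_congr h hT.arr_inv.ctxWF.head,
        CTyWF.subst_congr (h.val _) hT.arr_inv]

theorem CTyWF.subst_congr : ∀ {C : CTy L} {Γ : Ctx L} {τ τ' : ℕ → Term L} {π π' : ℕ → Pred L},
    AgreeOn Γ τ τ' π π' → CTyWF M Γ C → C.subst τ π = C.subst τ' π'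
  | .comp Sg _ _, _, _, _, _, _, h, hC => by
      simp only [CTy.subst, VTyWF.subst_congr h hC.vty, EffWF.subst_congr h hC.eff,
        fun o => SchemeWF.subst_congr (s := Sg o) h (hC.sig.scheme o)]

theorem SchemeWF.subst_congr :
    ∀ {s : Scheme L} {Γ : Ctx L} {τ τ' : ℕ → Term L} {π π' : ℕ → Pred L},
      AgreeOn Γ τ τ' π π' → SchemeWF M Γ s → s.subst τ π = s.subst τ' π'
  | .absent, _, _, _, _, _, _, _ => rfl
  | .present Bss _ _ _ _, _, _, _, _, _, h, hs => by
      simp only [Scheme.subst, liftTm_two, weakPr_two, VTyWF.subst_congr (h.addPreds Bss) hs.arg,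
        VTyWF.subst_congr ((h.addPreds Bss).val _) hs.res,
        CTyWF.subst_congr ((h.addPreds Bss).val _) hs.ans,
        CTyWF.subst_congr (((h.addPreds Bss).val _).val _) hs.fn.arr_inv]

theorem EffWF.subst_congr :
    ∀ {S : Eff L} {Γ : Ctx L} {T : VTy L} {τ τ' : ℕ → Term L} {π π' : ℕ → Pred L},
      AgreeOn Γ τ τ' π π' → EffWF M Γ T S → S.subst τ π = S.subst τ' π'
  | .pure, _, _, _, _, _, _, _, _ => rfl
  | .atm _ _, _, _, _, _, _, _, h, hS => by
      simp only [Eff.subst, CTyWF.subst_congr (h.val _) hS.arg, CTyWF.subst_congr h hS.ans]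

end

/-- Closed well-formed types, such as those of primitive values, are invariant under substitution. -/
theorem VTyWF.subst_closed {T : VTy L} (hT : VTyWF M [] T) (τ : ℕ → Term L) (π : ℕ → Pred L) :
    T.subst τ π = T :=
  (hT.subst_congr (τ' := .var) (π' := .pvar) ⟨by simp, by simp [Ctx.plookup]⟩).trans T.subst_id

/-! ### Semantics of substitution -/

theorem push_lt {U : Type u} {l : List U} {ρ ρ' : ℕ → U} {i : ℕ} (h : i < l.length) :
    push l ρ i = push l ρ' i := by
  simp [push, h]

theorem push_add {U : Type u} {l : List U} {ρ : ℕ → U} (i : ℕ) : push l ρ (i + l.length) = ρ i := by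
  simp [push]

theorem IsTuple.length_eq {Bs : List L.Base} {l : List M.U} (h : IsTuple M Bs l) :
    l.length = Bs.length :=
  List.Forall₂.length_eq h

theorem Term.eval_subst (ρ : ℕ → M.U) (τ : ℕ → Term L) (t : Term L) :
    (t.subst τ).eval M ρ = t.eval M (fun x => (τ x).eval M ρ) := by
  induction t with
  | fn f ts ih => simp only [Term.subst, Term.eval, ih]
  | _ => rfl

theorem Term.eval_ren (ρ : ℕ → M.U) (ξ : ℕ → ℕ) (t : Term L) :
    (t.ren ξ).eval M ρ = t.eval M (fun x => ρ (ξ x)) := by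
  rw [Term.ren_eq_subst, Term.eval_subst]; rfl

theorem push_liftRen {U : Type u} {l : List U} {ρ : ℕ → U} {k : ℕ} (h : l.length = k)
    (ξ : ℕ → ℕ) : (fun x => push l ρ (liftRen k ξ x)) = push l (fun x => ρ (ξ x)) := by
  subst h
  funext i
  by_cases hi : i < l.length
  · simp only [liftRen, hi, if_true]; exact push_lt hi
  · obtain ⟨j, rfl⟩ := Nat.exists_eq_add_of_le' (not_lt.mp hi)
    rw [liftRen_add, push_add, push_add]

mutual

theorem Formula.holds_ren (ξ η : ℕ → ℕ) : ∀ (φ : Formula L) (ρ : ℕ → M.U)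
    (θ : ℕ → List M.U → Prop),
    (φ.ren ξ η).Holds M ρ θ ↔ φ.Holds M (fun x => ρ (ξ x)) (fun X => θ (η X))
  | .tru, _, _ => Iff.rfl
  | .eq t s, ρ, _ => by simp only [Formula.ren, Formula.Holds, Term.eval_ren]
  | .app A ts, ρ, θ => by
      simp only [Formula.ren, Formula.Holds, List.map_map, Function.comp_def, Term.eval_ren,
        Pred.rel_ren ξ η A ρ θ]
  | .con o ts As, ρ, θ => by
      simp only [Formula.ren, Formula.Holds, List.map_map, Function.comp_def, Term.eval_ren,
        fun i => Pred.rel_ren ξ η (As i) ρ θ]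

theorem Pred.rel_ren (ξ η : ℕ → ℕ) : ∀ (A : Pred L) (ρ : ℕ → M.U)
    (θ : ℕ → List M.U → Prop) (l : List M.U),
    (A.ren ξ η).Rel M ρ θ l ↔ A.Rel M (fun x => ρ (ξ x)) (fun X => θ (η X)) l
  | .pvar _, _, _, _ => Iff.rfl
  | .abs Bs φ, ρ, θ, l => by
      simp only [Pred.ren, Pred.Rel]
      refine and_congr_right fun hl => ?_
      rw [Formula.holds_ren _ _ φ, push_liftRen hl.length_eq]

end

theorem push_liftTm {l : List M.U} {ρ : ℕ → M.U} {k : ℕ} (h : l.length = k)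
    (τ : ℕ → Term L) :
    (fun x => (liftTm k τ x).eval M (push l ρ)) = push l (fun x => (τ x).eval M ρ) := by
  subst h
  funext i
  by_cases hi : i < l.length
  · simp only [liftTm, hi, if_true]; exact push_lt hi
  · obtain ⟨j, rfl⟩ := Nat.exists_eq_add_of_le' (not_lt.mp hi)
    rw [liftTm_add, push_add, Term.eval_ren]
    simp only [push_add]

theorem rel_weakPr {l : List M.U} {ρ : ℕ → M.U} {θ : ℕ → List M.U → Prop} {k : ℕ}
    (h : l.length = k) (π : ℕ → Pred L) :
    (fun X l' => (weakPr k π X).Rel M (push l ρ) θ l') = fun X l' => (π X).Rel M ρ θ l' := by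
  subst h
  funext X l'
  simp only [weakPr, Pred.rel_ren, push_add, id]

mutual

theorem Formula.holds_subst : ∀ (φ : Formula L) (τ : ℕ → Term L) (π : ℕ → Pred L) (ρ : ℕ → M.U)
    (θ : ℕ → List M.U → Prop),
    (φ.subst τ π).Holds M ρ θ ↔
      φ.Holds M (fun x => (τ x).eval M ρ) (fun X l => (π X).Rel M ρ θ l)
  | .tru, _, _, _, _ => Iff.rfl
  | .eq t s, τ, π, ρ, _ => by simp only [Formula.subst, Formula.Holds, Term.eval_subst]
  | .app A ts, τ, π, ρ, θ => by
      simp only [Formula.subst, Formula.Holds, List.map_map, Function.comp_def, Term.eval_subst,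
        Pred.rel_subst A τ π ρ θ]
  | .con o ts As, τ, π, ρ, θ => by
      simp only [Formula.subst, Formula.Holds, List.map_map, Function.comp_def, Term.eval_subst,
        fun i => Pred.rel_subst (As i) τ π ρ θ]

theorem Pred.rel_subst : ∀ (A : Pred L) (τ : ℕ → Term L) (π : ℕ → Pred L) (ρ : ℕ → M.U)
    (θ : ℕ → List M.U → Prop) (l : List M.U),
    (A.subst τ π).Rel M ρ θ l ↔
      A.Rel M (fun x => (τ x).eval M ρ) (fun X l => (π X).Rel M ρ θ l) l
  | .pvar _, _, _, _, _, _ => Iff.rfl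
  | .abs Bs φ, τ, π, ρ, θ, l => by
      simp only [Pred.subst, Pred.Rel]
      refine and_congr_right fun hl => ?_
      rw [Formula.holds_subst φ, push_liftTm hl.length_eq, rel_weakPr hl.length_eq]

end

theorem eval_liftTm_one_succ (τ : ℕ → Term L) (ρ : ℕ → M.U) (n : ℕ) :
    (liftTm 1 τ (n + 1)).eval M ρ = (τ n).eval M (fun x => ρ (x + 1)) := by
  rw [liftTm_one_succ, Term.eval_ren]

theorem rel_weakPr_one (π : ℕ → Pred L) (ρ : ℕ → M.U) (θ : ℕ → List M.U → Prop) (X : ℕ)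
    (l : List M.U) : (weakPr 1 π X).Rel M ρ θ l ↔ (π X).Rel M (fun x => ρ (x + 1)) θ l := by
  rw [weakPr, Pred.rel_ren]; rfl

/-- The extension of an environment by one individual. -/
def econs {U : Type u} (u : U) (ρ : ℕ → U) : ℕ → U
  | 0 => u
  | n + 1 => ρ n

theorem econs_head_tail {U : Type u} (ρ : ℕ → U) : econs (ρ 0) (fun n => ρ (n + 1)) = ρ := by
  funext n; cases n <;> rfl

theorem eval_liftTm_econs (τ : ℕ → Term L) (u : M.U) (ρ : ℕ → M.U) :
    (fun x => (liftTm 1 τ x).eval M (econs u ρ)) = econs u (fun x => (τ x).eval M ρ) := by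
  funext x
  cases x with
  | zero => rfl
  | succ x => exact eval_liftTm_one_succ τ _ x

theorem rel_weakPr_econs (π : ℕ → Pred L) (u : M.U) (ρ : ℕ → M.U) (θ : ℕ → List M.U → Prop) :
    (fun X l => (weakPr 1 π X).Rel M (econs u ρ) θ l) = fun X l => (π X).Rel M ρ θ l := by
  funext X l; exact propext (rel_weakPr_one π _ θ X l)

theorem econs_liftRen_one {U : Type u} (ξ : ℕ → ℕ) (u : U) (ρ : ℕ → U) :
    (fun x => econs u ρ (liftRen 1 ξ x)) = econs u (fun x => ρ (ξ x)) := by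
  funext x
  cases x with
  | zero => rfl
  | succ x => rw [liftRen_one_succ]; rfl

theorem VTy.rfn_eq_up {B : L.Base} {φ : Formula L} {T : VTy L} {ξ η : ℕ → ℕ}
    (h : T.ren ξ η = .rfn B φ) : ∃ ψ, T = .rfn B ψ ∧ φ = ψ.ren (liftRen 1 ξ) η := by
  cases T with
  | rfn B' ψ => cases h; exact ⟨ψ, rfl, rfl⟩
  | arr => cases h

/-- Satisfaction of a context, read off the types of its variables. -/
theorem Ctx.sat_iff {Γ : Ctx L} {ρ : ℕ → M.U} {θ : ℕ → List M.U → Prop} :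
    Ctx.Sat M Γ ρ θ ↔
      (∀ x B φ, Γ.lookup x = some (.rfn B φ) →
        ρ x ∈ M.carrier B ∧ φ.Holds M (econs (ρ x) ρ) θ) ∧
      (∀ X Bs, Γ.plookup X = some Bs → ∀ l, θ X l → IsTuple M Bs l) := by
  induction Γ generalizing ρ θ with
  | nil => simp [Ctx.Sat, Ctx.lookup, Ctx.plookup]
  | cons e Γ ih =>
    -- The conditions at the older variables do not change when a value binding is added.
    have key : ∀ (ρ' : ℕ → M.U) (θ' : ℕ → List M.U → Prop) (T : VTy L) (Γ' : Ctx L)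
        (h : ∀ n, Ctx.lookup Γ' (n + 1) = (Ctx.lookup Γ n).map VTy.up),
        (∀ x B φ, Ctx.lookup Γ x = some (.rfn B φ) →
          ρ' (x + 1) ∈ M.carrier B ∧
            φ.Holds M (econs (ρ' (x + 1)) (fun n => ρ' (n + 1))) θ') ↔
        (∀ x B φ, Ctx.lookup Γ' (x + 1) = some (.rfn B φ) →
          ρ' (x + 1) ∈ M.carrier B ∧ φ.Holds M (econs (ρ' (x + 1)) ρ') θ') := by
      intro ρ' θ' T Γ' h
      constructor
      · intro H x B φ hx
        rw [h, Option.map_eq_some_iff] at hx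
        obtain ⟨T', hT', hx⟩ := hx
        obtain ⟨ψ, rfl, rfl⟩ := VTy.rfn_eq_up hx
        refine ⟨(H x B ψ hT').1, ?_⟩
        rw [Formula.holds_ren, econs_liftRen_one]
        exact (H x B ψ hT').2
      · intro H x B φ hx
        have h' := H x B (φ.ren (liftRen 1 (· + 1)) id) (by rw [h, hx]; rfl)
        rw [Formula.holds_ren, econs_liftRen_one] at h'
        exact h'
    cases e with
    | val T =>
      have hT := key ρ θ T (.val T :: Γ) (fun n => rfl)
      have h0 : (∀ x B φ, Ctx.lookup (.val T :: Γ) x = some (.rfn B φ) →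
          ρ x ∈ M.carrier B ∧ φ.Holds M (econs (ρ x) ρ) θ) ↔
          (∀ B φ, T = .rfn B φ → ρ 0 ∈ M.carrier B ∧ φ.Holds M ρ θ) ∧
          (∀ x B φ, Ctx.lookup (.val T :: Γ) (x + 1) = some (.rfn B φ) →
            ρ (x + 1) ∈ M.carrier B ∧ φ.Holds M (econs (ρ (x + 1)) ρ) θ) := by
        constructor
        · refine fun H => ⟨fun B φ h => ?_, fun x => H (x + 1)⟩
          subst h
          have h' := H 0 B (φ.ren (liftRen 1 (· + 1)) id) rfl
          rw [Formula.holds_ren, econs_liftRen_one, econs_head_tail] at h'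
          exact h'
        · rintro ⟨H₀, H⟩ (_ | x) B φ hx
          · obtain ⟨ψ, rfl, rfl⟩ := VTy.rfn_eq_up (Option.some.inj hx)
            rw [Formula.holds_ren, econs_liftRen_one, econs_head_tail]
            exact H₀ _ _ rfl
          · exact H x B φ hx
      rw [h0, ← hT, and_assoc, show (∀ X Bs, Ctx.plookup (.val T :: Γ) X = some Bs →
          ∀ l, θ X l → IsTuple M Bs l) ↔ ∀ X Bs, Ctx.plookup Γ X = some Bs →
          ∀ l, θ X l → IsTuple M Bs l from Iff.rfl, ← ih]
      cases T with
      | rfn B φ =>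
        simp only [Ctx.Sat, ← and_assoc]
        refine and_congr_left fun _ => ?_
        constructor
        · rintro h _ _ ⟨⟩; exact h
        · intro h; exact h _ _ rfl
      | arr T C => simp [Ctx.Sat]
    | pred Bs =>
      simp only [Ctx.Sat, ih]
      constructor
      · rintro ⟨h₀, h₁, h₂⟩
        refine ⟨fun x B φ hx => ?_, ?_⟩
        · simp only [Ctx.lookup, Option.map_eq_some_iff] at hx
          obtain ⟨T', hT', hx⟩ := hx
          obtain ⟨ψ, rfl, rfl⟩ := VTy.rfn_eq_up hx
          refine ⟨(h₁ x B ψ hT').1, ?_⟩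
          rw [Formula.holds_ren, econs_liftRen_one]
          exact (h₁ x B ψ hT').2
        · rintro (_ | X) Bs' hX
          · cases hX; exact h₀
          · exact h₂ X Bs' hX
      · rintro ⟨h₁, h₂⟩
        refine ⟨h₂ 0 Bs rfl, fun x B φ hx => ?_, fun X => h₂ (X + 1)⟩
        have h' := h₁ x B (φ.ren (liftRen 1 id) (· + 1)) (by simp only [Ctx.lookup, hx]; rfl)
        rw [Formula.holds_ren, econs_liftRen_one] at h'
        exact h'

/-! ### Subtyping under substitution -/

variable (M) in
/-- A substitution that is sound for the semantics: it turns satisfying assignments of `Γ'` into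
satisfying assignments of `Γ`.  Weakening, narrowing and the substitution of values and predicates
are all of this form. -/
def SemSubst (Γ' : Ctx L) (τ : ℕ → Term L) (π : ℕ → Pred L) (Γ : Ctx L) : Prop :=
  ∀ ρ θ, Ctx.Sat M Γ' ρ θ →
    Ctx.Sat M Γ (fun x => (τ x).eval M ρ) (fun X l => (π X).Rel M ρ θ l)

theorem Ctx.Sat.tail {Γ : Ctx L} {T : VTy L} {ρ : ℕ → M.U} {θ : ℕ → List M.U → Prop}
    (h : Ctx.Sat M (.val T :: Γ) ρ θ) : Ctx.Sat M Γ (fun n => ρ (n + 1)) θ := by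
  cases T with
  | rfn => exact h.2.2
  | arr => exact h

theorem SemSubst.val {Γ Γ' : Ctx L} {τ : ℕ → Term L} {π : ℕ → Pred L}
    (h : SemSubst M Γ' τ π Γ) (T : VTy L) :
    SemSubst M (.val (T.subst τ π) :: Γ') (liftTm 1 τ) (weakPr 1 π) (.val T :: Γ) := by
  intro ρ θ hs
  have ht := h _ _ hs.tail
  cases T with
  | rfn B φ =>
    refine ⟨hs.1, (Formula.holds_subst _ _ _ _ _).mp hs.2.1, ?_⟩
    simpa only [eval_liftTm_one_succ, rel_weakPr_one] using ht
  | arr => simpa only [Ctx.Sat, eval_liftTm_one_succ, rel_weakPr_one] using ht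

theorem liftPr_succ (n : ℕ) (π : ℕ → Pred L) : liftPr (n + 1) π = liftPr 1 (liftPr n π) := by
  funext i
  rcases i with _ | i
  · rfl
  · by_cases h : i < n
    · simp [liftPr, h, Pred.ren]
    · simp [liftPr, h, Pred.ren_ren]; rfl

theorem liftPr_zero (π : ℕ → Pred L) : liftPr 0 π = π := by
  funext i
  simp only [liftPr, Nat.not_lt_zero, if_false, Nat.sub_zero, Pred.ren_eq_subst]
  exact Pred.subst_id _

theorem SemSubst.addPreds {Γ Γ' : Ctx L} {τ : ℕ → Term L} {π : ℕ → Pred L}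
    (h : SemSubst M Γ' τ π Γ) (Bss : List (List L.Base)) :
    SemSubst M (Γ'.addPreds Bss) τ (liftPr Bss.length π) (Γ.addPreds Bss) := by
  induction Bss with
  | nil => rw [List.length_nil, liftPr_zero]; exact h
  | cons Bs Bss ih =>
    rintro ρ θ ⟨h₁, h₂⟩
    have ht := ih _ _ h₂
    refine ⟨h₁, ?_⟩
    have hX : ∀ X, liftPr (Bs :: Bss).length π (X + 1) =
        (liftPr Bss.length π X).ren id (· + 1) := by
      intro X
      rw [List.length_cons, liftPr_succ]; rfl
    simp only [hX, Pred.rel_ren, id]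
    exact ht

theorem ValidImp.subst {Γ Γ' : Ctx L} {τ : ℕ → Term L} {π : ℕ → Pred L} {φ ψ : Formula L}
    (h : SemSubst M Γ' τ π Γ) (hv : ValidImp M Γ φ ψ) :
    ValidImp M Γ' (φ.subst τ π) (ψ.subst τ π) := by
  intro ρ θ hs hφ
  rw [Formula.holds_subst] at hφ ⊢
  exact hv _ _ (h _ _ hs) hφ

mutual

theorem VSub.subst {Γ Γ' : Ctx L} {τ : ℕ → Term L} {π : ℕ → Pred L} {T₁ T₂ : VTy L}
    (h : SemSubst M Γ' τ π Γ) (hT : VSub M Γ T₁ T₂) : VSub M Γ' (T₁.subst τ π) (T₂.subst τ π) :=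
  match hT with
  | .rfn hv => .rfn (hv.subst (h.val (VTy.base _)))
  | .arr h₁ h₂ => .arr (h₁.subst h) (h₂.subst (h.val _))

theorem CSub.subst {Γ Γ' : Ctx L} {τ : ℕ → Term L} {π : ℕ → Pred L} {C₁ C₂ : CTy L}
    (h : SemSubst M Γ' τ π Γ) (hC : CSub M Γ C₁ C₂) : CSub M Γ' (C₁.subst τ π) (C₂.subst τ π) :=
  match hC with
  | .comp h₁ h₂ h₃ => .comp (h₁.subst h) (h₂.subst h) (h₃.subst h)

theorem SigSub.subst {Γ Γ' : Ctx L} {τ : ℕ → Term L} {π : ℕ → Pred L}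
    {Sg₁ Sg₂ : L.OpName → Scheme L} (h : SemSubst M Γ' τ π Γ) (hS : SigSub M Γ Sg₁ Sg₂) :
    SigSub M Γ' (fun o => (Sg₁ o).subst τ π) (fun o => (Sg₂ o).subst τ π) :=
  match hS with
  | .mk hs => .mk (fun o => (hs o).subst h)

theorem SchemeSub.subst {Γ Γ' : Ctx L} {τ : ℕ → Term L} {π : ℕ → Pred L} {s₁ s₂ : Scheme L}
    (h : SemSubst M Γ' τ π Γ) (hs : SchemeSub M Γ s₁ s₂) :
    SchemeSub M Γ' (s₁.subst τ π) (s₂.subst τ π) :=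
  match hs with
  | .absent => .absent
  | .present h₁ h₂ h₃ => by
      have h₂' := h₂.subst ((h.addPreds _).val _)
      simp only [VTy.subst, ← liftTm_two, ← weakPr_two] at h₂'
      exact .present (h₁.subst (h.addPreds _)) h₂' (h₃.subst ((h.addPreds _).val _))

theorem EffSub.subst {Γ Γ' : Ctx L} {τ : ℕ → Term L} {π : ℕ → Pred L} {T : VTy L} {S₁ S₂ : Eff L}
    (h : SemSubst M Γ' τ π Γ) (hS : EffSub M Γ T S₁ S₂) :
    EffSub M Γ' (T.subst τ π) (S₁.subst τ π) (S₂.subst τ π) :=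
  match hS with
  | .pure => .pure
  | .atm h₁ h₂ => .atm (h₁.subst (h.val _)) (h₂.subst h)
  | .embed h₁ => by
      have h₁' := h₁.subst (h.val _)
      rw [CTy.up_subst] at h₁'
      exact .embed h₁'

end

/-! ### Reflexivity, narrowing and transitivity of subtyping -/

variable (M) in
/-- Every satisfying assignment of `Γ'` satisfies `Γ`. -/
def Ctx.Entails (Γ' Γ : Ctx L) : Prop := ∀ ρ θ, Ctx.Sat M Γ' ρ θ → Ctx.Sat M Γ ρ θ

theorem Ctx.Entails.semSubst {Γ Γ' : Ctx L} (h : Ctx.Entails M Γ' Γ) :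
    SemSubst M Γ' .var .pvar Γ := h

theorem VSub.narrow {Γ Γ' : Ctx L} {T₁ T₂ : VTy L} (h : Ctx.Entails M Γ' Γ)
    (hT : VSub M Γ T₁ T₂) : VSub M Γ' T₁ T₂ := by
  simpa only [VTy.subst_id] using hT.subst h.semSubst

theorem CSub.narrow {Γ Γ' : Ctx L} {C₁ C₂ : CTy L} (h : Ctx.Entails M Γ' Γ)
    (hC : CSub M Γ C₁ C₂) : CSub M Γ' C₁ C₂ := by
  simpa only [CTy.subst_id] using hC.subst h.semSubst

/-- A smaller type for the innermost variable gives a stronger context. -/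
theorem VSub.entails {Γ : Ctx L} {T₁ T₂ : VTy L} (h : VSub M Γ T₁ T₂) :
    Ctx.Entails M (.val T₁ :: Γ) (.val T₂ :: Γ) := by
  intro ρ θ hs
  cases h with
  | rfn hv => exact ⟨hs.1, hv _ _ ⟨hs.1, trivial, hs.2.2⟩ hs.2.1, hs.2.2⟩
  | arr => exact hs

theorem SemSubst.succ (T : VTy L) (Γ : Ctx L) :
    SemSubst M (.val T :: Γ) (fun x => .var (x + 1)) .pvar Γ :=
  fun _ _ hs => hs.tail

theorem CSub.up {Γ : Ctx L} {C₁ C₂ : CTy L} (h : CSub M Γ C₁ C₂) (T : VTy L) :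
    CSub M (.val T :: Γ) C₁.up C₂.up := by
  simp only [CTy.up, CTy.ren_eq_subst]
  exact h.subst (SemSubst.succ T Γ)

variable (M) in
/-- Two substitutions with the same denotation under every satisfying assignment of `Γ`. -/
def SemEq (Γ : Ctx L) (τ τ' : ℕ → Term L) (π π' : ℕ → Pred L) : Prop :=
  ∀ ρ θ, Ctx.Sat M Γ ρ θ →
    (∀ x, (τ x).eval M ρ = (τ' x).eval M ρ) ∧
    (∀ X l, (π X).Rel M ρ θ l ↔ (π' X).Rel M ρ θ l)

theorem SemEq.symm {Γ : Ctx L} {τ τ' : ℕ → Term L} {π π' : ℕ → Pred L}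
    (h : SemEq M Γ τ τ' π π') : SemEq M Γ τ' τ π' π :=
  fun ρ θ hs => ⟨fun x => ((h ρ θ hs).1 x).symm, fun X l => ((h ρ θ hs).2 X l).symm⟩

theorem SemEq.val {Γ : Ctx L} {τ τ' : ℕ → Term L} {π π' : ℕ → Pred L}
    (h : SemEq M Γ τ τ' π π') (T : VTy L) :
    SemEq M (.val T :: Γ) (liftTm 1 τ) (liftTm 1 τ') (weakPr 1 π) (weakPr 1 π') := by
  intro ρ θ hs
  have ht := h _ _ hs.tail
  refine ⟨fun x => ?_, fun X l => ?_⟩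
  · cases x with
    | zero => rfl
    | succ x => rw [eval_liftTm_one_succ, eval_liftTm_one_succ]; exact ht.1 x
  · rw [rel_weakPr_one, rel_weakPr_one]; exact ht.2 X l

theorem SemEq.addPreds {Γ : Ctx L} {τ τ' : ℕ → Term L} {π π' : ℕ → Pred L}
    (h : SemEq M Γ τ τ' π π') (Bss : List (List L.Base)) :
    SemEq M (Γ.addPreds Bss) τ τ' (liftPr Bss.length π) (liftPr Bss.length π') := by
  induction Bss with
  | nil => rw [List.length_nil, liftPr_zero, liftPr_zero]; exact h
  | cons Bs Bss ih =>
    rintro ρ θ ⟨_, h₂⟩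
    have ht := ih _ _ h₂
    refine ⟨ht.1, fun X l => ?_⟩
    rw [List.length_cons]
    cases X with
    | zero => rfl
    | succ X =>
      have hX : ∀ π : ℕ → Pred L,
          liftPr (Bss.length + 1) π (X + 1) = (liftPr Bss.length π X).ren id (· + 1) :=
        fun π => by rw [liftPr_succ]; rfl
      rw [hX, hX, Pred.rel_ren, Pred.rel_ren]
      exact ht.2 X l

mutual

/-- Substitutions with the same denotation give mutual subtypes. -/
theorem VSub.of_semEq : ∀ (T : VTy L) {Γ : Ctx L} {τ τ' : ℕ → Term L} {π π' : ℕ → Pred L},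
    SemEq M Γ τ τ' π π' → VSub M Γ (T.subst τ π) (T.subst τ' π')
  | .rfn B φ, Γ, τ, τ', π, π', h => .rfn fun ρ θ hs hφ => by
      have h' := h.val (VTy.base B) ρ θ hs
      rw [Formula.holds_subst] at hφ ⊢
      rwa [← funext h'.1, ← funext₂ fun X l => propext (h'.2 X l)]
  | .arr T C, _, _, _, _, _, h => .arr (VSub.of_semEq T h.symm) (CSub.of_semEq C (h.val _))

theorem CSub.of_semEq : ∀ (C : CTy L) {Γ : Ctx L} {τ τ' : ℕ → Term L} {π π' : ℕ → Pred L},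
    SemEq M Γ τ τ' π π' → CSub M Γ (C.subst τ π) (C.subst τ' π')
  | .comp Sg T S, _, _, _, _, _, h =>
      .comp (.mk fun o => SchemeSub.of_semEq (Sg o) h.symm) (VSub.of_semEq T h)
        (EffSub.of_semEq S h)

theorem SchemeSub.of_semEq :
    ∀ (s : Scheme L) {Γ : Ctx L} {τ τ' : ℕ → Term L} {π π' : ℕ → Pred L},
      SemEq M Γ τ τ' π π' → SchemeSub M Γ (s.subst τ π) (s.subst τ' π')
  | .absent, _, _, _, _, _, _ => .absent
  | .present Bss T₁ T₂ C₁ C₂, _, _, _, _, _, h => by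
      have h₁ := h.addPreds Bss
      simp only [Scheme.subst, liftTm_two, weakPr_two]
      exact .present (VSub.of_semEq T₁ h₁.symm)
        (.arr (VSub.of_semEq T₂ (h₁.val _)) (CSub.of_semEq C₁ ((h₁.val _).val _).symm))
        (CSub.of_semEq C₂ (h₁.val _))

theorem EffSub.of_semEq :
    ∀ (S : Eff L) {Γ : Ctx L} {T : VTy L} {τ τ' : ℕ → Term L} {π π' : ℕ → Pred L},
      SemEq M Γ τ τ' π π' → EffSub M Γ T (S.subst τ π) (S.subst τ' π')
  | .pure, _, _, _, _, _, _, _ => .pure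
  | .atm C₁ C₂, _, _, _, _, _, _, h =>
      .atm (CSub.of_semEq C₁ (h.symm.val _)) (CSub.of_semEq C₂ h)

end

theorem SemEq.refl (Γ : Ctx L) (τ : ℕ → Term L) (π : ℕ → Pred L) : SemEq M Γ τ τ π π :=
  fun _ _ _ => ⟨fun _ => rfl, fun _ _ => Iff.rfl⟩

theorem VSub.refl (Γ : Ctx L) (T : VTy L) : VSub M Γ T T := by
  simpa only [VTy.subst_id] using VSub.of_semEq T (SemEq.refl Γ .var .pvar)

theorem CSub.refl (Γ : Ctx L) (C : CTy L) : CSub M Γ C C := by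
  simpa only [CTy.subst_id] using CSub.of_semEq C (SemEq.refl Γ .var .pvar)

theorem SigSub.refl (Γ : Ctx L) (Sg : L.OpName → Scheme L) : SigSub M Γ Sg Sg := by
  refine .mk fun o => ?_
  simpa only [Scheme.subst_id] using SchemeSub.of_semEq (Sg o) (SemEq.refl Γ .var .pvar)

theorem Ctx.Entails.val {Γ Γ' : Ctx L} (h : Ctx.Entails M Γ' Γ) (T : VTy L) :
    Ctx.Entails M (.val T :: Γ') (.val T :: Γ) := by
  intro ρ θ hs
  cases T with
  | rfn => exact ⟨hs.1, hs.2.1, h _ _ hs.2.2⟩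
  | arr => exact h _ _ hs

mutual

/-- Transitivity, by induction on the type in the middle; it is stated for all its substitution
instances because embedding a pure effect weakens the final answer type. -/
theorem VSub.trans_subst : ∀ (T : VTy L) {Γ : Ctx L} (τ : ℕ → Term L) (π : ℕ → Pred L)
    {T₁ T₃ : VTy L}, VSub M Γ T₁ (T.subst τ π) → VSub M Γ (T.subst τ π) T₃ → VSub M Γ T₁ T₃
  | .rfn _ _, _, _, _, _, _, h, h' => by
      cases h with
      | rfn h =>
        cases h' with
        | rfn h' => exact .rfn fun ρ θ hs hφ => h' ρ θ hs (h ρ θ hs hφ)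
  | .arr T C, _, τ, π, _, _, h, h' => by
      cases h with
      | arr h₁ h₂ =>
        cases h' with
        | arr h₁' h₂' =>
          exact .arr (VSub.trans_subst T τ π h₁' h₁)
            (CSub.trans_subst C (liftTm 1 τ) (weakPr 1 π) (h₂.narrow h₁'.entails) h₂')
termination_by structural T => T

theorem CSub.trans_subst : ∀ (C : CTy L) {Γ : Ctx L} (τ : ℕ → Term L) (π : ℕ → Pred L)
    {C₁ C₃ : CTy L}, CSub M Γ C₁ (C.subst τ π) → CSub M Γ (C.subst τ π) C₃ → CSub M Γ C₁ C₃
  | .comp Sg T S, _, τ, π, _, _, h, h' => by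
      cases h with
      | comp h₁ h₂ h₃ =>
        cases h₁ with
        | mk h₁ =>
          cases h' with
          | comp h₁' h₂' h₃' =>
            cases h₁' with
            | mk h₁' =>
              exact .comp (.mk fun o => SchemeSub.trans_subst (Sg o) τ π (h₁' o) (h₁ o))
                (VSub.trans_subst T τ π h₂ h₂') (EffSub.trans_subst S τ π h₂ h₃ h₃')
termination_by structural C => C

theorem SchemeSub.trans_subst : ∀ (s : Scheme L) {Γ : Ctx L} (τ : ℕ → Term L) (π : ℕ → Pred L)
    {s₁ s₃ : Scheme L}, SchemeSub M Γ s₁ (s.subst τ π) → SchemeSub M Γ (s.subst τ π) s₃ →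
      SchemeSub M Γ s₁ s₃
  | .absent, _, _, _, _, _, _, h => by cases h with | absent => exact .absent
  | .present Bss T₁ T₂ C₁ C₂, _, τ, π, _, _, h, h' => by
      cases h' with
      | absent => exact .absent
      | present h₁' h₂' h₃' =>
        cases h with
        | present h₁ h₂ h₃ =>
          cases h₂ with
          | arr h₂ h₂₂ =>
            cases h₂' with
            | arr h₂' h₂₂' =>
              exact .present (VSub.trans_subst T₁ τ (liftPr Bss.length π) h₁' h₁)
                (.arr (VSub.trans_subst T₂ (liftTm 1 τ) (weakPr 1 (liftPr Bss.length π))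
                    (h₂.narrow h₁'.entails) h₂')
                  (CSub.trans_subst C₁ (liftTm 2 τ) (weakPr 2 (liftPr Bss.length π))
                    (h₂₂'.narrow (h₂.narrow h₁'.entails).entails)
                    (h₂₂.narrow (h₁'.entails.val _))))
                (CSub.trans_subst C₂ (liftTm 1 τ) (weakPr 1 (liftPr Bss.length π))
                  (h₃.narrow h₁'.entails) h₃')
termination_by structural s => s

theorem EffSub.trans_subst : ∀ (S : Eff L) {Γ : Ctx L} {T₁ T₂ : VTy L} (τ : ℕ → Term L)
    (π : ℕ → Pred L) {S₁ S₃ : Eff L}, VSub M Γ T₁ T₂ → EffSub M Γ T₁ S₁ (S.subst τ π) →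
      EffSub M Γ T₂ (S.subst τ π) S₃ → EffSub M Γ T₁ S₁ S₃
  | .pure, _, _, _, _, _, _, _, hT, h, h' => by
      cases h with
      | pure =>
        cases h' with
        | pure => exact .pure
        | embed h' => exact .embed (h'.narrow hT.entails)
  | .atm C₁ C₂, _, T, _, τ, π, _, _, hT, h, h' => by
      cases h' with
      | atm h₁' h₂' =>
        cases h with
        | atm h₁ h₂ =>
          exact .atm (CSub.trans_subst C₁ (liftTm 1 τ) (weakPr 1 π) (h₁'.narrow hT.entails) h₁)
            (CSub.trans_subst C₂ τ π h₂ h₂')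
        | embed h₁ =>
          refine .embed ?_
          have h := CSub.trans_subst C₁ (liftTm 1 τ) (weakPr 1 π) (h₁'.narrow hT.entails) h₁
          have h' := h₂'.up T
          rw [CTy.up, CTy.subst_ren] at h h'
          exact CSub.trans_subst C₂ _ _ h h'
termination_by structural S => S

end

theorem VSub.trans {Γ : Ctx L} {T₁ T₂ T₃ : VTy L} (h₁ : VSub M Γ T₁ T₂) (h₂ : VSub M Γ T₂ T₃) :
    VSub M Γ T₁ T₃ :=
  VSub.trans_subst T₂ .var .pvar (by rwa [VTy.subst_id]) (by rwa [VTy.subst_id])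

theorem CSub.trans {Γ : Ctx L} {C₁ C₂ C₃ : CTy L} (h₁ : CSub M Γ C₁ C₂) (h₂ : CSub M Γ C₂ C₃) :
    CSub M Γ C₁ C₃ :=
  CSub.trans_subst C₂ .var .pvar (by rwa [CTy.subst_id]) (by rwa [CTy.subst_id])

/-! ### Values of refinement types -/

theorem VSub.rfn_inv {Γ : Ctx L} {T : VTy L} {B : L.Base} {φ : Formula L}
    (h : VSub M Γ T (.rfn B φ)) :
    ∃ ψ, T = .rfn B ψ ∧ ValidImp M (.val (VTy.base B) :: Γ) ψ φ := by
  cases h with | rfn h => exact ⟨_, rfl, h⟩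

/-- A value of a refinement type is a variable or a primitive value of the same base type. -/
theorem VTyping.rfn_cases {Γ : Ctx L} {v : Value L} {B : L.Base} {φ : Formula L}
    (h : VTyping M Γ v (.rfn B φ)) :
    (∃ x ψ, v = .var x ∧ Γ.lookup x = some (.rfn B ψ)) ∨ ∃ p ψ, v = .prim p ∧ M.ty p = .rfn B ψ := by
  generalize hT : VTy.rfn B φ = T at h
  exact go h hT
where
  go {Γ : Ctx L} {v : Value L} {T : VTy L} {B : L.Base} {φ : Formula L} :
      VTyping M Γ v T → VTy.rfn B φ = T →
      (∃ x ψ, v = .var x ∧ Γ.lookup x = some (.rfn B ψ)) ∨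
        ∃ p ψ, v = .prim p ∧ M.ty p = .rfn B ψ
    | .cvar _ hx, h => by cases h; exact .inl ⟨_, _, rfl, hx⟩
    | .var _ _ hn, h => absurd h.symm (hn _ _)
    | .prim (p := p) _, h => .inr ⟨p, φ, rfl, h.symm⟩
    | .fix _, h => by cases h
    | .sub h₁ hs _, h => by
        obtain ⟨ψ, hψ, _⟩ := VSub.rfn_inv (h ▸ hs)
        exact go h₁ hψ.symm

theorem VTyping.hasSort {Γ : Ctx L} {v : Value L} {B : L.Base} {φ : Formula L}
    (h : VTyping M Γ v (.rfn B φ)) : HasSort M Γ v.toTerm B := by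
  rcases h.rfn_cases with ⟨x, ψ, rfl, hx⟩ | ⟨p, ψ, rfl, hp⟩
  · exact .var hx
  · exact .prim hp

theorem VTyping.hasSort_of_sort {Γ : Ctx L} {v : Value L} {T : VTy L} (h : VTyping M Γ v T)
    {B : L.Base} (hT : T.sort = some B) : HasSort M Γ v.toTerm B := by
  obtain ⟨φ, rfl⟩ := VTy.sort_eq_some.mp hT
  exact h.hasSort

/-- The refinement in the type of a primitive value `p` holds of `p`. -/
theorem Calculus.Appropriate.holds (hM : M.Appropriate) {p : L.Prim} {B : L.Base} {φ : Formula L}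
    (hp : M.ty p = .rfn B φ) {ρ : ℕ → M.U} (θ : ℕ → List M.U → Prop) (h₀ : ρ 0 = M.den p) :
    φ.Holds M ρ θ :=
  (hM.base p B φ hp).2 ρ θ ⟨by rw [h₀]; exact M.den_mem p B φ hp, trivial, trivial⟩ h₀

/-- Under a satisfying assignment, a value of a refinement type denotes an element of the base type
with the property stated by the refinement. -/
theorem VTyping.sound (hM : M.Appropriate) {Γ : Ctx L} {v : Value L} {B : L.Base} {φ : Formula L}
    (h : VTyping M Γ v (.rfn B φ)) {ρ : ℕ → M.U} {θ : ℕ → List M.U → Prop}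
    (hs : Ctx.Sat M Γ ρ θ) :
    v.toTerm.eval M ρ ∈ M.carrier B ∧ φ.Holds M (econs (v.toTerm.eval M ρ) ρ) θ := by
  generalize hT : VTy.rfn B φ = T at h
  exact go h hT hs
where
  go {Γ : Ctx L} {v : Value L} {T : VTy L} {B : L.Base} {φ : Formula L} {ρ : ℕ → M.U}
      {θ : ℕ → List M.U → Prop} : VTyping M Γ v T → VTy.rfn B φ = T → Ctx.Sat M Γ ρ θ →
      v.toTerm.eval M ρ ∈ M.carrier B ∧ φ.Holds M (econs (v.toTerm.eval M ρ) ρ) θ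
    | .cvar _ hx, h, hs => by
        cases h
        exact ⟨((Ctx.sat_iff.mp hs).1 _ _ _ hx).1, rfl⟩
    | .var _ _ hn, h, _ => absurd h.symm (hn _ _)
    | .prim (p := p) _, h, _ => ⟨M.den_mem p B φ h.symm, hM.holds h.symm _ rfl⟩
    | .fix _, h, _ => by cases h
    | .sub h₁ hsub _, h, hs => by
        obtain ⟨ψ, hψ, hv⟩ := VSub.rfn_inv (h ▸ hsub)
        have ih := go h₁ hψ.symm hs
        exact ⟨ih.1, hv _ _ ⟨ih.1, trivial, hs⟩ ih.2⟩

/-! ### Regularity: the types assigned by the typing rules are well-formed -/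

theorem CtxWF.lookup {Γ : Ctx L} (h : CtxWF M Γ) {x : ℕ} {T : VTy L}
    (hx : Γ.lookup x = some T) : VTyWF M Γ T := by
  induction Γ generalizing x T with
  | nil => cases hx
  | cons e Γ ih =>
    cases e with
    | val T₀ =>
      cases x with
      | zero => cases hx; exact h.head.ren h (SortRen.succ T₀ Γ)
      | succ x =>
        obtain ⟨T', hT', rfl⟩ := Option.map_eq_some_iff.mp hx
        exact (ih h.tail hT').ren h (SortRen.succ T₀ Γ)
    | pred Bs =>
      obtain ⟨T', hT', rfl⟩ := Option.map_eq_some_iff.mp hx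
      cases h with
      | pred h' =>
        exact (ih h' hT').ren (.pred h') (SortRen.addPreds_add [Bs] Γ)

theorem SortSubst.nil (Γ : Ctx L) (τ : ℕ → Term L) (π : ℕ → Pred L) : SortSubst M Γ τ π [] where
  tm x B h := by simp at h
  pr X Bs h := by simp [Ctx.plookup] at h

theorem SortSubst.id (Γ : Ctx L) : SortSubst M Γ .var .pvar Γ where
  tm _ _ h := HasSort.var_iff.mpr h
  pr _ _ h := .pvar h

theorem SortSubst.inst {Γ Γ' : Ctx L} {π : ℕ → Pred L} (h : SortSubst M Γ' .var π Γ) {v : Value L}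
    {T : VTy L} (hv : ∀ B, T.sort = some B → HasSort M Γ' v.toTerm B) :
    SortSubst M Γ' (instTm v) π (.val T :: Γ) where
  tm x B hx := by
    cases x with
    | zero => exact hv B (by simpa using hx)
    | succ x => exact h.tm x B (by simpa using hx)
  pr := h.pr

theorem forall₂_instPr {Γ : Ctx L} {As : List (Pred L)} {Bss : List (List L.Base)}
    (h : List.Forall₂ (PredWF M Γ) As Bss) {X : ℕ} {Bs : List L.Base}
    (hX : (Γ.addPreds Bss).plookup X = some Bs) : PredWF M Γ (instPr As X) Bs := by
  by_cases hlt : X < Bss.length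
  · rw [Ctx.plookup_addPreds_lt _ _ hlt, List.getElem?_eq_getElem hlt] at hX
    cases hX
    have hlt' : X < As.length := h.length_eq ▸ hlt
    simp only [instPr, List.getElem?_eq_getElem hlt', Option.getD_some]
    exact h.get hlt' hlt
  · obtain ⟨Y, rfl⟩ := Nat.exists_eq_add_of_le' (not_lt.mp hlt)
    rw [Ctx.plookup_addPreds_add] at hX
    rw [← h.length_eq, instPr_add]
    exact .pvar hX

theorem SortSubst.instPr {Γ : Ctx L} {As : List (Pred L)} {Bss : List (List L.Base)}
    (h : List.Forall₂ (PredWF M Γ) As Bss) : SortSubst M Γ .var (instPr As) (Γ.addPreds Bss) where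
  tm x B hx := HasSort.var_iff.mpr (by rwa [Ctx.sort_addPreds] at hx)
  pr _ _ hX := forall₂_instPr h hX

theorem VTyWF.of_up {Γ : Ctx L} {T T₁ : VTy L} (h : VTyWF M (.val T₁ :: Γ) T.up) : VTyWF M Γ T :=
  h.of_ren h.ctxWF.tail (SortReflect.succ T₁ Γ)

theorem CTyWF.of_up {Γ : Ctx L} {C : CTy L} {T₁ : VTy L} (h : CTyWF M (.val T₁ :: Γ) C.up) :
    CTyWF M Γ C :=
  h.of_ren h.ctxWF.tail (SortReflect.succ T₁ Γ)

theorem CTyWF.of_upUnder {Γ : Ctx L} {C : CTy L} {T T₁ : VTy L}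
    (h : CTyWF M (.val T.up :: .val T₁ :: Γ) C.upUnder) : CTyWF M (.val T :: Γ) C :=
  h.of_ren (.val h.ctxWF.tail.tail h.ctxWF.head.of_up) ((SortReflect.succ T₁ Γ).val T.sort_up)

mutual

theorem VTyping.wf (hM : M.Appropriate) {Γ : Ctx L} {v : Value L} {T : VTy L}
    (h : VTyping M Γ v T) : VTyWF M Γ T :=
  match h with
  | .cvar hΓ hx =>
      .rfn hΓ (.eq (HasSort.var_iff.mpr (Ctx.sort_val_zero _ _)) (HasSort.var_iff.mpr
        ((Ctx.sort_val_succ _ _ _).trans (Ctx.sort_eq_some.mpr ⟨_, hx⟩))))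
  | .var hΓ hx _ => hΓ.lookup hx
  | .prim (p := p) hΓ => by
      rw [← (hM.wf p).subst_closed .var .pvar]
      exact (hM.wf p).subst hΓ (SortSubst.nil _ _ _)
  | .fix hc => (hc.wf hM).ctxWF.tail.head
  | .sub _ _ hT => hT

theorem CTyping.wf (hM : M.Appropriate) {Γ : Ctx L} {c : Comp L} {C : CTy L}
    (h : CTyping M Γ c C) : CTyWF M Γ C :=
  match h with
  | .ret hv =>
      .comp (.mk (by simp [emptySig]) (fun _ => .absent)) (hv.wf hM) (.pure (hv.wf hM).ctxWF)
  | .app h₁ h₂ =>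
      (h₁.wf hM).arr_inv.subst (h₁.wf hM).ctxWF
        ((SortSubst.id _).inst fun _ => h₂.hasSort_of_sort)
  | .ite _ h₁ _ => (h₁.wf hM).of_up
  | .sub _ _ hC => hC
  | .letP h₁ h₂ => .comp (h₁.wf hM).sig (h₂.wf hM).vty.of_up (.pure (h₁.wf hM).ctxWF)
  | .letIp h₁ h₂ =>
      .comp (h₁.wf hM).sig (h₂.wf hM).vty.of_up
        (.atm (h₂.wf hM).eff.arg.of_upUnder (h₁.wf hM).eff.ans)
  | .op (o := o) hS hSg hAs hv => by
      have hs := hSg.scheme o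
      rw [hS] at hs
      have hΓ := (hv.wf hM).ctxWF
      have h' := (SortSubst.instPr hAs).inst fun B hB =>
        hv.hasSort_of_sort ((VTy.sort_subst _ _ _).trans hB)
      have hT := hs.res.subst hΓ h'
      exact .comp hSg hT (.atm (hs.fn.arr_inv.subst (.val hΓ hT) (h'.val (VTy.sort_subst _ _ _)))
        (hs.ans.subst hΓ h'))
  | .handle h _ _ => (h.wf hM).eff.ans

end

theorem VTyping.ctxWF (hM : M.Appropriate) {Γ : Ctx L} {v : Value L} {T : VTy L}
    (h : VTyping M Γ v T) : CtxWF M Γ := (h.wf hM).ctxWF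

theorem CTyping.ctxWF (hM : M.Appropriate) {Γ : Ctx L} {c : Comp L} {C : CTy L}
    (h : CTyping M Γ c C) : CtxWF M Γ := (h.wf hM).ctxWF

/-! ### Typing under substitution -/

/-- A variable has its declared type. -/
theorem VTyping.of_lookup {Γ : Ctx L} {x : ℕ} {T : VTy L} (hΓ : CtxWF M Γ)
    (hx : Γ.lookup x = some T) : VTyping M Γ (.var x) T := by
  cases T with
  | rfn B φ =>
    refine .sub (.cvar hΓ hx) (.rfn fun ρ θ hs h => ?_) (hΓ.lookup hx)
    have h' : ρ 0 = ρ (x + 1) := h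
    have := ((Ctx.sat_iff.mp hs.tail).1 x B φ hx).2
    rwa [← h', econs_head_tail] at this
  | arr T C => exact .var hΓ hx (by simp)

/-- A value of a refinement type also has the singleton type of its denotation. -/
theorem VTyping.self (hM : M.Appropriate) {Γ : Ctx L} {v : Value L} {B : L.Base} {φ : Formula L}
    (h : VTyping M Γ v (.rfn B φ)) :
    VTyping M Γ v (.rfn B (.eq (.var 0) (v.toTerm.ren (· + 1)))) := by
  have hΓ := h.ctxWF hM
  have hv := h.hasSort
  rcases h.rfn_cases with ⟨x, ψ, rfl, hx⟩ | ⟨p, ψ, rfl, hp⟩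
  · exact .cvar hΓ hx
  · have h' : VTyping M Γ (.prim p) (.rfn B ψ) := hp ▸ .prim hΓ
    exact .sub h' (.rfn fun ρ θ hs hψ => (hM.base p B ψ hp).1 ρ θ ⟨hs.1, trivial, trivial⟩ hψ)
      (.rfn hΓ (.eq (HasSort.var_iff.mpr (Ctx.sort_val_zero _ _))
        (hv.ren (SortRen.succ _ Γ))))

variable (M) in
/-- A renaming from `Γ` to the well-formed context `Δ` that respects the declared types. -/
structure CtxRen (Δ : Ctx L) (ξ η : ℕ → ℕ) (Γ : Ctx L) : Prop where
  wf : CtxWF M Δ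
  val : ∀ x T, Γ.lookup x = some T → Δ.lookup (ξ x) = some (T.ren ξ η)
  pr : ∀ X Bs, Γ.plookup X = some Bs → Δ.plookup (η X) = some Bs

theorem CtxRen.sortRen {Γ Δ : Ctx L} {ξ η : ℕ → ℕ} (h : CtxRen M Δ ξ η Γ) : SortRen Δ ξ η Γ where
  tm x B hx := by
    obtain ⟨φ, hφ⟩ := Ctx.sort_eq_some.mp hx
    exact Ctx.sort_eq_some.mpr ⟨_, h.val _ _ hφ⟩
  pr := h.pr

theorem CtxRen.id {Γ : Ctx L} (h : CtxWF M Γ) : CtxRen M Γ (fun x => x) (fun X => X) Γ where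
  wf := h
  val x T hx := by rw [VTy.ren_id]; exact hx
  pr _ _ h := h

theorem CtxRen.comp_succ {Γ Δ : Ctx L} {ξ η : ℕ → ℕ} {T : VTy L}
    (h : CtxRen M Δ ξ η (.val T :: Γ)) : CtxRen M Δ (fun x => ξ (x + 1)) η Γ where
  wf := h.wf
  val x T' hx := by
    have := h.val (x + 1) T'.up (by simp only [Ctx.lookup, hx]; rfl)
    rw [this, VTy.up, VTy.ren_ren]; rfl
  pr := h.pr

theorem CtxRen.comp_addPreds {Γ Δ : Ctx L} {ξ η : ℕ → ℕ} {Bss : List (List L.Base)}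
    (h : CtxRen M Δ ξ η (Γ.addPreds Bss)) : CtxRen M Δ ξ (fun X => η (X + Bss.length)) Γ where
  wf := h.wf
  val x T hx := by
    have := h.val x (T.ren _root_.id (· + Bss.length)) (by rw [Ctx.lookup_addPreds, hx]; rfl)
    rw [this, VTy.ren_ren]; rfl
  pr X Bs hX := h.pr _ _ ((Ctx.plookup_addPreds_add _ _ _).trans hX)

variable (M) in
/-- A well-typed substitution from `Γ` to `Γ'`.  Typing of the substituted values is required in
every renaming of `Γ'`, so that substitutions can be extended below binders before weakening of
typing derivations is available. -/
structure TySubst (Γ' : Ctx L) (σ : ℕ → Value L) (π : ℕ → Pred L) (Γ : Ctx L) : Prop where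
  wf : CtxWF M Γ'
  val : ∀ x T, Γ.lookup x = some T → ∀ Δ ξ η, CtxRen M Δ ξ η Γ' →
    VTyping M Δ ((σ x).ren ξ) ((T.subst (toTm σ) π).ren ξ η)
  pr : ∀ X Bs, Γ.plookup X = some Bs → PredWF M Γ' (π X) Bs

theorem TySubst.typing {Γ Γ' : Ctx L} {σ : ℕ → Value L} {π : ℕ → Pred L}
    (h : TySubst M Γ' σ π Γ) {x : ℕ} {T : VTy L} (hx : Γ.lookup x = some T) :
    VTyping M Γ' (σ x) (T.subst (toTm σ) π) := by
  simpa only [Value.ren_id, VTy.ren_id] using h.val x T hx _ _ _ (CtxRen.id h.wf)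

theorem TySubst.sortSubst {Γ Γ' : Ctx L} {σ : ℕ → Value L} {π : ℕ → Pred L}
    (h : TySubst M Γ' σ π Γ) : SortSubst M Γ' (toTm σ) π Γ where
  tm x B hx := by
    obtain ⟨φ, hφ⟩ := Ctx.sort_eq_some.mp hx
    exact (h.typing hφ).hasSort
  pr := h.pr

theorem PredWF.isTuple {Γ : Ctx L} {A : Pred L} {Bs : List L.Base} (hA : PredWF M Γ A Bs)
    {ρ : ℕ → M.U} {θ : ℕ → List M.U → Prop} (hs : Ctx.Sat M Γ ρ θ) {l : List M.U}
    (hl : A.Rel M ρ θ l) : IsTuple M Bs l := by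
  cases hA with
  | pvar hX => exact (Ctx.sat_iff.mp hs).2 _ _ hX l hl
  | abs => exact hl.1

/-- Well-typed substitutions are semantically sound.  At variables of function types nothing is
needed, since satisfaction of a context does not constrain them. -/
theorem TySubst.semSubst (hM : M.Appropriate) {Γ Γ' : Ctx L} {σ : ℕ → Value L} {π : ℕ → Pred L}
    (h : TySubst M Γ' σ π Γ) : SemSubst M Γ' (toTm σ) π Γ := by
  intro ρ θ hs
  refine Ctx.sat_iff.mpr ⟨fun x B φ hx => ?_, fun X Bs hX l hl => (h.pr X Bs hX).isTuple hs hl⟩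
  have := (h.typing hx).sound hM hs
  rw [Formula.holds_subst, eval_liftTm_econs, rel_weakPr_econs] at this
  exact this

theorem TySubst.lift {Γ Γ' : Ctx L} {σ : ℕ → Value L} {π : ℕ → Pred L}
    (h : TySubst M Γ' σ π Γ) {T : VTy L} (hT : VTyWF M Γ T) :
    TySubst M (.val (T.subst (toTm σ) π) :: Γ') (liftVal 1 σ) (weakPr 1 π) (.val T :: Γ) where
  wf := .val h.wf (hT.subst h.wf h.sortSubst)
  val x T' hx Δ ξ η hΔ := by
    cases x with
    | zero =>
      cases hx
      rw [toTm_liftVal, VTy.up_subst]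
      exact .of_lookup hΔ.wf (hΔ.val 0 _ rfl)
    | succ x =>
      obtain ⟨T'', hT'', rfl⟩ := Option.map_eq_some_iff.mp hx
      rw [toTm_liftVal, VTy.up_subst, liftVal_one_succ, Value.ren_ren, VTy.up, VTy.ren_ren]
      exact h.val x T'' hT'' _ _ _ hΔ.comp_succ
  pr X Bs hX := (h.pr X Bs hX).ren (SortRen.succ _ _)

theorem TySubst.addPreds {Γ Γ' : Ctx L} {σ : ℕ → Value L} {π : ℕ → Pred L}
    (h : TySubst M Γ' σ π Γ) (Bss : List (List L.Base)) :
    TySubst M (Γ'.addPreds Bss) σ (liftPr Bss.length π) (Γ.addPreds Bss) where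
  wf := h.wf.addPreds Bss
  val x T hx Δ ξ η hΔ := by
    rw [Ctx.lookup_addPreds] at hx
    obtain ⟨T', hT', rfl⟩ := Option.map_eq_some_iff.mp hx
    rw [VTy.pup_subst, VTy.ren_ren]
    exact h.val x T' hT' _ _ _ hΔ.comp_addPreds
  pr := (h.sortSubst.addPreds Bss).pr

theorem Ctx.assume_subst (σ : ℕ → Value L) (π : ℕ → Pred L) (v : Value L) (p : L.Prim) :
    (VTy.rfn L.bool (.eq (v.toTerm.ren (· + 1)) (.prim p))).subst (toTm σ) π =
      .rfn L.bool (.eq ((v.subst σ).toTerm.ren (· + 1)) (.prim p)) := by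
  simp only [VTy.subst, Formula.subst, Term.subst, Value.toTerm_subst, Term.ren_subst,
    Term.subst_ren, liftTm_one_succ]

mutual

theorem VTyping.subst (hM : M.Appropriate) {Γ Γ' : Ctx L} {σ : ℕ → Value L} {π : ℕ → Pred L}
    {v : Value L} {T : VTy L} (h : TySubst M Γ' σ π Γ) (hv : VTyping M Γ v T) :
    VTyping M Γ' (v.subst σ) (T.subst (toTm σ) π) :=
  match hv with
  | .cvar (x := x) _ hx => by
      have := (h.typing hx).self hM
      simp only [VTy.subst, Formula.subst, Term.subst, liftTm_one_succ]
      exact this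
  | .var _ hx _ => h.typing hx
  | .prim (p := p) _ => by rw [(hM.wf p).subst_closed]; exact .prim h.wf
  | .fix hc => by
      have hΓ := hc.ctxWF hM
      have ih := hc.subst hM ((h.lift hΓ.tail.head).lift hΓ.head)
      simp only [toTm_liftVal, VTy.up_subst, CTy.upUnder_subst] at ih
      rw [← liftVal_two] at ih
      exact .fix ih
  | .sub hv hs hT =>
      .sub (hv.subst hM h) (hs.subst (h.semSubst hM)) (hT.subst h.wf h.sortSubst)

/-- The substitution lemma. -/
theorem CTyping.subst (hM : M.Appropriate) {Γ Γ' : Ctx L} {σ : ℕ → Value L} {π : ℕ → Pred L}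
    {c : Comp L} {C : CTy L} (h : TySubst M Γ' σ π Γ) (hc : CTyping M Γ c C) :
    CTyping M Γ' (c.subst σ) (C.subst (toTm σ) π) :=
  match hc with
  | .ret hv => .ret (hv.subst hM h)
  | .app h₁ h₂ => by
      rw [CTy.inst_subst]
      exact .app (h₁.subst hM h) (h₂.subst hM h)
  | .ite hv h₁ h₂ => by
      have ih₁ := h₁.subst hM (h.lift (h₁.ctxWF hM).head)
      have ih₂ := h₂.subst hM (h.lift (h₂.ctxWF hM).head)
      rw [toTm_liftVal, CTy.up_subst, Comp.ren_succ_subst, Ctx.assume_subst] at ih₁ ih₂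
      exact .ite (hv.subst hM h) ih₁ ih₂
  | .sub hc hs hC =>
      .sub (hc.subst hM h) (hs.subst (h.semSubst hM)) (hC.subst h.wf h.sortSubst)
  | .letP h₁ h₂ => by
      have ih₂ := h₂.subst hM (h.lift (h₂.ctxWF hM).head)
      simp only [toTm_liftVal, CTy.subst, Scheme.up_subst, VTy.up_subst] at ih₂
      exact .letP (h₁.subst hM h) ih₂
  | .letIp h₁ h₂ => by
      have ih₂ := h₂.subst hM (h.lift (h₂.ctxWF hM).head)
      simp only [toTm_liftVal, CTy.subst, Scheme.up_subst, VTy.up_subst, Eff.subst,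
        CTy.upUnder_subst] at ih₂
      exact .letIp (h₁.subst hM h) ih₂
  | .op (o := o) (v := v) (Sg := Sg) (As := As) hS hSg hAs hv => by
      have hAs' : List.Forall₂ (PredWF M Γ') (As.map (Pred.subst (toTm σ) π)) _ :=
        List.forall₂_map_left_iff.mpr (hAs.imp fun _ _ hA => hA.subst h.sortSubst)
      have hv' := hv.subst hM h
      rw [VTy.inst_arg_subst, hAs.length_eq] at hv'
      have hS' := congrArg (Scheme.subst (toTm σ) π) hS
      rw [Scheme.subst] at hS'
      have := CTyping.op (Sg := fun o => (Sg o).subst (toTm σ) π) hS'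
        (hSg.subst h.wf h.sortSubst) hAs' hv'
      simp only [CTy.subst, Eff.subst, VTy.inst_op_subst, CTy.inst_op_subst,
        CTy.inst_op_subst_lift, hAs.length_eq]
      exact this
  | .handle h₁ h₂ h₃ =>  by
      have ih₂ := h₂.subst hM (h.lift (h₂.ctxWF hM).head)
      rw [toTm_liftVal] at ih₂
      exact .handle (h₁.subst hM h) ih₂ (fun o => (h₃ o).subst hM h)

theorem ClauseTyping.subst (hM : M.Appropriate) {Γ Γ' : Ctx L} {σ : ℕ → Value L} {π : ℕ → Pred L}
    {s : Scheme L} {d : Clause L} (h : TySubst M Γ' σ π Γ) (hd : ClauseTyping M Γ s d) :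
    ClauseTyping M Γ' (s.subst (toTm σ) π) (d.subst σ) :=
  match hd with
  | .absent => .absent
  | .present (Bss := Bss) hc => by
      have hΓ := hc.ctxWF hM
      have ih := hc.subst hM (((h.addPreds Bss).lift hΓ.tail.head).lift hΓ.head)
      simp only [toTm_liftVal, CTy.up_subst] at ih
      rw [← liftVal_two] at ih
      simp only [VTy.subst, ← liftTm_two, ← weakPr_two] at ih
      exact .present ih

end

/-! ### Instances of the substitution lemma -/

/-- Renamings are well-typed substitutions, so weakening is a case of the substitution lemma. -/
theorem CtxRen.tySubst {Γ Δ : Ctx L} {ξ η : ℕ → ℕ} (h : CtxRen M Δ ξ η Γ) :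
    TySubst M Δ (fun x => .var (ξ x)) (fun X => .pvar (η X)) Γ where
  wf := h.wf
  val x T hx Δ' ξ' η' h' := by
    refine .of_lookup h'.wf (h'.val (ξ x) _ ?_)
    rw [h.val x T hx, VTy.ren_eq_subst]; rfl
  pr X Bs hX := .pvar (h.pr X Bs hX)

theorem VTyping.ren (hM : M.Appropriate) {Γ Δ : Ctx L} {ξ η : ℕ → ℕ} {v : Value L} {T : VTy L}
    (h : CtxRen M Δ ξ η Γ) (hv : VTyping M Γ v T) : VTyping M Δ (v.ren ξ) (T.ren ξ η) := by
  rw [Value.ren_eq_subst, VTy.ren_eq_subst]; exact hv.subst hM h.tySubst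

theorem CTyping.ren (hM : M.Appropriate) {Γ Δ : Ctx L} {ξ η : ℕ → ℕ} {c : Comp L} {C : CTy L}
    (h : CtxRen M Δ ξ η Γ) (hc : CTyping M Γ c C) : CTyping M Δ (c.ren ξ) (C.ren ξ η) := by
  rw [Comp.ren_eq_subst, CTy.ren_eq_subst]; exact hc.subst hM h.tySubst

theorem ClauseTyping.ren (hM : M.Appropriate) {Γ Δ : Ctx L} {ξ η : ℕ → ℕ} {s : Scheme L}
    {d : Clause L} (h : CtxRen M Δ ξ η Γ) (hd : ClauseTyping M Γ s d) :
    ClauseTyping M Δ (s.ren ξ η) (d.ren ξ) := by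
  rw [Clause.ren_eq_subst, Scheme.ren_eq_subst]; exact hd.subst hM h.tySubst

/-- Now that typing is stable under renaming, it is enough to type the substituted values in the
target context. -/
theorem TySubst.of_typing (hM : M.Appropriate) {Γ Γ' : Ctx L} {σ : ℕ → Value L} {π : ℕ → Pred L}
    (hΓ : CtxWF M Γ')
    (hσ : ∀ x T, Γ.lookup x = some T → VTyping M Γ' (σ x) (T.subst (toTm σ) π))
    (hπ : ∀ X Bs, Γ.plookup X = some Bs → PredWF M Γ' (π X) Bs) : TySubst M Γ' σ π Γ where
  wf := hΓ
  val x T hx _ _ _ h := (hσ x T hx).ren hM h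
  pr := hπ

/-- Extends a substitution by a value for variable `0`. -/
def vcons (v : Value L) (σ : ℕ → Value L) : ℕ → Value L
  | 0 => v
  | n + 1 => σ n

theorem inst1_eq_vcons (v : Value L) : inst1 v = vcons v .var := by
  funext x; cases x <;> rfl

theorem inst2_eq_vcons (v w : Value L) : inst2 v w = vcons v (vcons w .var) := by
  funext x; rcases x with _ | _ | x <;> rfl

theorem VTy.up_subst_vcons (v : Value L) (σ : ℕ → Value L) (π : ℕ → Pred L) (T : VTy L) :
    T.up.subst (toTm (vcons v σ)) π = T.subst (toTm σ) π := by
  rw [VTy.up, VTy.ren_subst]; rfl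

theorem CTy.up_subst_vcons (v : Value L) (σ : ℕ → Value L) (π : ℕ → Pred L) (C : CTy L) :
    C.up.subst (toTm (vcons v σ)) π = C.subst (toTm σ) π := by
  rw [CTy.up, CTy.ren_subst]; rfl

theorem toTm_vcons_var (v : Value L) : toTm (vcons v .var) = instTm v := by
  rw [← inst1_eq_vcons, toTm_inst1]

theorem TySubst.cons (hM : M.Appropriate) {Γ Γ' : Ctx L} {σ : ℕ → Value L} {π : ℕ → Pred L}
    (h : TySubst M Γ' σ π Γ) {v : Value L} {T : VTy L}
    (hv : VTyping M Γ' v (T.subst (toTm σ) π)) : TySubst M Γ' (vcons v σ) π (.val T :: Γ) := by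
  refine .of_typing hM h.wf (fun x T' hx => ?_) h.pr
  cases x with
  | zero => cases hx; rw [VTy.up_subst_vcons]; exact hv
  | succ x =>
    obtain ⟨T'', hT'', rfl⟩ := Option.map_eq_some_iff.mp hx
    rw [VTy.up_subst_vcons]; exact h.typing hT''

theorem TySubst.id {Γ : Ctx L} (h : CtxWF M Γ) : TySubst M Γ .var .pvar Γ :=
  (CtxRen.id h).tySubst

theorem TySubst.instPr (hM : M.Appropriate) {Γ : Ctx L} (hΓ : CtxWF M Γ) {As : List (Pred L)}
    {Bss : List (List L.Base)} (h : List.Forall₂ (PredWF M Γ) As Bss) :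
    TySubst M Γ .var (instPr As) (Γ.addPreds Bss) := by
  refine .of_typing hM hΓ (fun x T hx => ?_) (fun _ _ hX => forall₂_instPr h hX)
  rw [Ctx.lookup_addPreds] at hx
  obtain ⟨T', hT', rfl⟩ := Option.map_eq_some_iff.mp hx
  have : (T'.ren _root_.id (· + Bss.length)).subst (toTm .var) (ARM.instPr As) = T' := by
    rw [VTy.ren_subst, ← h.length_eq]
    simp only [instPr_add]
    exact T'.subst_id
  rw [this]
  exact .of_lookup hΓ hT'

theorem TySubst.inst1 (hM : M.Appropriate) {Γ : Ctx L} {v : Value L} {T : VTy L}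
    (hv : VTyping M Γ v T) : TySubst M Γ (inst1 v) .pvar (.val T :: Γ) := by
  rw [inst1_eq_vcons]
  exact (TySubst.id (hv.ctxWF hM)).cons hM (by rw [toTm_var, VTy.subst_id]; exact hv)

theorem CtxRen.succ {Γ : Ctx L} {T : VTy L} (h : CtxWF M (.val T :: Γ)) :
    CtxRen M (.val T :: Γ) (· + 1) _root_.id Γ where
  wf := h
  val x T' hx := by simp only [Ctx.lookup, hx]; rfl
  pr _ _ h := h

/-- Narrowing, as the substitution lemma for the identity substitution. -/
theorem CTyping.narrow (hM : M.Appropriate) {Γ : Ctx L} {T T' : VTy L} {c : Comp L} {C : CTy L}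
    (hT : VSub M Γ T' T) (hT' : VTyWF M Γ T') (hc : CTyping M (.val T :: Γ) c C) :
    CTyping M (.val T' :: Γ) c C := by
  have hΓ : CtxWF M (.val T' :: Γ) := .val hT'.ctxWF hT'
  have h : TySubst M (.val T' :: Γ) .var .pvar (.val T :: Γ) := by
    refine .of_typing hM hΓ (fun x T₁ hx => ?_) (fun _ _ hX => .pvar hX)
    rw [toTm_var, VTy.subst_id]
    cases x with
    | zero =>
      cases hx
      refine .sub (.of_lookup hΓ rfl) ?_ ((hc.ctxWF hM).head.ren hΓ (SortRen.succ T' Γ))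
      simp only [VTy.up, VTy.ren_eq_subst]
      exact hT.subst (SemSubst.succ T' Γ)
    | succ x => exact .of_lookup hΓ hx
  simpa only [Comp.subst_id, toTm_var, CTy.subst_id] using hc.subst hM h

/-! ### Inversion of typing -/

variable (M) in
/-- `v` has the type `T` by the typing rule for its outermost construct, without subsumption.  Of a
variable it is only recorded that it is declared, which excludes variables in closed values. -/
def VSyntaxTyping (Γ : Ctx L) : Value L → VTy L → Prop
  | .var x, _ => (Γ.lookup x).isSome
  | .prim p, T => T = M.ty p
  | .fix c, T₀ => ∃ T C, T₀ = .arr T C ∧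
      CTyping M (.val T.up :: .val (.arr T C) :: Γ) c C.upUnder

/-- Up to a subtyping step, a value has its type by a syntax-directed rule. -/
theorem VTyping.inv {Γ : Ctx L} {v : Value L} {T : VTy L} (h : VTyping M Γ v T) :
    ∃ T₀, VSub M Γ T₀ T ∧ VSyntaxTyping M Γ v T₀ :=
  match h with
  | .cvar _ hx => ⟨_, .refl _ _, by simp [VSyntaxTyping, hx]⟩
  | .var _ hx _ => ⟨_, .refl _ _, by simp [VSyntaxTyping, hx]⟩
  | .prim _ => ⟨_, .refl _ _, rfl⟩
  | .fix hc => ⟨_, .refl _ _, _, _, rfl, hc⟩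
  | .sub h hs _ =>
      have ⟨T₀, h₀, hi⟩ := h.inv
      ⟨T₀, h₀.trans hs, hi⟩

variable (M) in
/-- `c` has the type `C` by a typing rule for its outermost construct, without subsumption. -/
def CSyntaxTyping (Γ : Ctx L) : Comp L → CTy L → Prop
  | .ret v, C₀ => ∃ T, C₀ = .comp emptySig T .pure ∧ VTyping M Γ v T
  | .op o v, C₀ => ∃ Sg Bss T₁ T₂ C₁ C₂ As, C₀ = .comp Sg (T₂.subst (instTm v) (instPr As))
        ((Eff.atm C₁ C₂).subst (instTm v) (instPr As)) ∧
      Sg o = .present Bss T₁ T₂ C₁ C₂ ∧ SigWF M Γ Sg ∧ List.Forall₂ (PredWF M Γ) As Bss ∧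
      VTyping M Γ v (T₁.subst .var (instPr As))
  | .app v₁ v₂, C₀ => ∃ T C, C₀ = C.subst (instTm v₂) .pvar ∧ VTyping M Γ v₁ (.arr T C) ∧
      VTyping M Γ v₂ T
  | .ite v c₁ c₂, C₀ => ∃ φ, VTyping M Γ v (.rfn L.bool φ) ∧
      CTyping M (Ctx.assume Γ v L.tt) (c₁.ren (· + 1)) C₀.up ∧
      CTyping M (Ctx.assume Γ v L.ff) (c₂.ren (· + 1)) C₀.up
  | .letIn c₁ c₂, C₀ =>
      (∃ Sg T₁ T₂, C₀ = .comp Sg T₂ .pure ∧ CTyping M Γ c₁ (.comp Sg T₁ .pure) ∧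
        CTyping M (.val T₁ :: Γ) c₂ (.comp (fun o => (Sg o).ren (· + 1) id) T₂.up .pure)) ∨
      (∃ Sg T₁ T₂ C C₁₂ C₂₁, C₀ = .comp Sg T₂ (.atm C₂₁ C₁₂) ∧
        CTyping M Γ c₁ (.comp Sg T₁ (.atm C C₁₂)) ∧
        CTyping M (.val T₁ :: Γ) c₂
          (.comp (fun o => (Sg o).ren (· + 1) id) T₂.up (.atm C₂₁.upUnder C)))
  | .handle cr cls c, C₀ => ∃ Sg T C₁, CTyping M Γ c (.comp Sg T (.atm C₁ C₀)) ∧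
      CTyping M (.val T :: Γ) cr C₁ ∧ ∀ o, ClauseTyping M Γ (Sg o) (cls o)

/-- Up to a subtyping step, a computation has its type by a syntax-directed rule: consecutive uses of
subsumption are merged by transitivity of subtyping. -/
theorem CTyping.inv {Γ : Ctx L} {c : Comp L} {C : CTy L} (h : CTyping M Γ c C) :
    ∃ C₀, CSub M Γ C₀ C ∧ CSyntaxTyping M Γ c C₀ :=
  match h with
  | .ret hv => ⟨_, .refl _ _, _, rfl, hv⟩
  | .app h₁ h₂ => ⟨_, .refl _ _, _, _, rfl, h₁, h₂⟩
  | .ite hv h₁ h₂ => ⟨_, .refl _ _, _, hv, h₁, h₂⟩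
  | .sub h hs _ =>
      have ⟨C₀, h₀, hi⟩ := h.inv
      ⟨C₀, h₀.trans hs, hi⟩
  | .letP h₁ h₂ => ⟨_, .refl _ _, .inl ⟨_, _, _, rfl, h₁, h₂⟩⟩
  | .letIp h₁ h₂ => ⟨_, .refl _ _, .inr ⟨_, _, _, _, _, _, rfl, h₁, h₂⟩⟩
  | .op hS hSg hAs hv => ⟨_, .refl _ _, _, _, _, _, _, _, _, rfl, hS, hSg, hAs, hv⟩
  | .handle h₁ h₂ h₃ => ⟨_, .refl _ _, _, _, _, h₁, h₂, h₃⟩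

theorem CTyping.ret_inv (hM : M.Appropriate) {Γ : Ctx L} {v : Value L}
    {Sg : L.OpName → Scheme L} {T : VTy L} {S : Eff L}
    (h : CTyping M Γ (.ret v) (.comp Sg T S)) : VTyping M Γ v T := by
  obtain ⟨_, hs, T₀, rfl, hv⟩ := h.inv
  cases hs with
  | comp _ hT _ => exact .sub hv hT (h.wf hM).vty

/-- A returned value of an impure type satisfies the answer type of its continuation: the initial
answer type, at that value, is below the final one. -/
theorem CTyping.ret_ans (hM : M.Appropriate) {Γ : Ctx L} {v : Value L}
    {Sg : L.OpName → Scheme L} {T : VTy L} {C₁ C₂ : CTy L}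
    (h : CTyping M Γ (.ret v) (.comp Sg T (.atm C₁ C₂))) :
    CSub M Γ (C₁.subst (instTm v) .pvar) C₂ := by
  obtain ⟨_, hs, T₀, rfl, hv⟩ := h.inv
  cases hs with
  | comp _ _ hS =>
    cases hS with
    | embed hC =>
      have := hC.subst ((TySubst.inst1 hM hv).semSubst hM)
      rwa [toTm_inst1, CTy.up_inst, CTy.subst_id] at this

/-! ### Operations in evaluation contexts -/

theorem ECtx.plug_ren (ξ : ℕ → ℕ) (K : ECtx L) (c : Comp L) :
    (K.plug c).ren ξ = (K.ren ξ).plug (c.ren ξ) := by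
  induction K with
  | hole => rfl
  | letIn K c₂ ih => simp only [ECtx.plug, ECtx.ren, Comp.ren, ih]

theorem liftRen_one_comp (ξ ξ' : ℕ → ℕ) :
    (fun x => liftRen 1 ξ' (liftRen 1 ξ x)) = liftRen 1 (fun x => ξ' (ξ x)) := by
  funext x
  cases x with
  | zero => rfl
  | succ x => simp only [liftRen_one_succ]

theorem ECtx.ren_ren (ξ ξ' : ℕ → ℕ) (K : ECtx L) :
    (K.ren ξ).ren ξ' = K.ren (fun x => ξ' (ξ x)) := by
  induction K with
  | hole => rfl
  | letIn K c₂ ih => simp only [ECtx.ren, ih, Comp.ren_ren, liftRen_one_comp]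

theorem CtxRen.lift {Γ Δ : Ctx L} {ξ η : ℕ → ℕ} (h : CtxRen M Δ ξ η Γ) {T : VTy L}
    (hT : VTyWF M Δ (T.ren ξ η)) :
    CtxRen M (.val (T.ren ξ η) :: Δ) (liftRen 1 ξ) η (.val T :: Γ) where
  wf := .val h.wf hT
  val x T' hx := by
    have hup : ∀ T : VTy L, T.up.ren (liftRen 1 ξ) η = (T.ren ξ η).up := fun T => by
      simp only [VTy.up, VTy.ren_ren, liftRen_one_succ]; rfl
    cases x with
    | zero => cases hx; rw [hup]; rfl
    | succ x =>
      obtain ⟨T'', hT'', rfl⟩ := Option.map_eq_some_iff.mp hx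
      rw [hup, liftRen_one_succ]
      simp only [Ctx.lookup, h.val x T'' hT'']; rfl
  pr := h.pr

theorem CtxRen.comp {Γ Δ Δ' : Ctx L} {ξ η ξ' η' : ℕ → ℕ} (h' : CtxRen M Δ' ξ' η' Δ)
    (h : CtxRen M Δ ξ η Γ) : CtxRen M Δ' (fun x => ξ' (ξ x)) (fun X => η' (η X)) Γ where
  wf := h'.wf
  val x T hx := by rw [h'.val _ _ (h.val x T hx), VTy.ren_ren]
  pr X Bs hX := h'.pr _ _ (h.pr X Bs hX)

/-- The identity continuation: below `y : T`, returning `y` turns the answer type `D(y)` into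
itself.  If `T` is a refinement type, this rests on the singleton type of `y`; if it is a function
type, `D` does not depend on `y`. -/
theorem CTyping.ret_var_zero {Γ : Ctx L} {Sg : L.OpName → Scheme L} {T : VTy L} {D E : CTy L}
    (h : CTyWF M Γ (.comp Sg T (.atm D E))) :
    CTyping M (.val T :: Γ) (.ret (.var 0))
      (.comp (fun o => (Sg o).ren (· + 1) id) T.up (.atm D.upUnder D)) := by
  have hΓ : CtxWF M (.val T :: Γ) := h.eff.arg.ctxWF
  have hw := h.ren hΓ (SortRen.succ T Γ)
  have hwf : CTyWF M (.val T :: Γ)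
      (.comp (fun o => (Sg o).ren (· + 1) id) T.up (.atm D.upUnder D)) :=
    .comp hw.sig hw.vty (.atm hw.eff.arg h.eff.arg)
  cases T with
  | rfn B φ =>
    refine .sub (.ret (.cvar (x := 0) hΓ rfl))
      (.comp (.mk fun _ => .absent) (.rfn fun ρ θ hs hz => ?_) (.embed ?_)) hwf
    · have hz : ρ 0 = ρ 1 := hz
      rw [Formula.holds_ren]
      have h' := hs.2.2.2.1
      have hρ : (fun x => ρ (liftRen 1 (· + 1) x)) = fun n => ρ (n + 1) := by
        funext x
        cases x with
        | zero => exact hz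
        | succ x => rw [liftRen_one_succ]
      rw [hρ]
      exact h'
    · simp only [CTy.up, CTy.upUnder, CTy.ren_eq_subst]
      refine CSub.of_semEq D fun ρ θ hs => ⟨fun x => ?_, fun _ _ => Iff.rfl⟩
      have hz : ρ 0 = ρ 1 := hs.2.1
      cases x with
      | zero => exact hz
      | succ x => rw [liftRen_one_succ]
  | arr T' C' =>
    refine .sub (.ret (.of_lookup hΓ rfl))
      (.comp (.mk fun _ => .absent) (.refl _ _) (.embed ?_)) hwf
    have : D.upUnder = D.up := by
      simp only [CTy.up, CTy.upUnder, CTy.ren_eq_subst]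
      refine h.eff.arg.subst_congr ⟨fun x B hx => ?_, fun _ _ _ => rfl⟩
      cases x with
      | zero => simp [VTy.sort] at hx
      | succ x => rw [liftRen_one_succ]
    rw [this]
    exact .refl _ _

/-- What the typing of `K[op v]` at the type `⟨Sg⟩ T / S` reveals: `op` belongs to `Sg`, at some
instance of its scheme the argument `v` has the required type and the final answer type of the
operation is below that of `S`, and the captured continuation `λ y. K[return y]` is typed
with the answer type that the operation expects of its continuation. -/
structure OpInContext (M : Calculus L) (Γ : Ctx L) (K : ECtx L) (o : L.OpName) (v : Value L)
    (Sg : L.OpName → Scheme L) (T : VTy L) (C₁ C₂ : CTy L) (Bss : List (List L.Base))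
    (T₁ T₂ : VTy L) (D₁ D₂ : CTy L) (As : List (Pred L)) : Prop where
  scheme : Sg o = .present Bss T₁ T₂ D₁ D₂
  preds : List.Forall₂ (PredWF M Γ) As Bss
  arg : VTyping M Γ v (T₁.subst .var (instPr As))
  ans : CSub M Γ (D₂.subst (instTm v) (instPr As)) C₂
  cont : CTyping M (.val (T₂.subst (instTm v) (instPr As)) :: Γ)
    ((K.ren (· + 1)).plug (.ret (.var 0)))
    (.comp (fun o => (Sg o).ren (· + 1) id) T.up
      (.atm C₁.upUnder (D₁.subst (liftTm 1 (instTm v)) (weakPr 1 (instPr As)))))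

/-- The instantiation of an operation's scheme at the predicates `As` and the argument `v`. -/
theorem TySubst.op (hM : M.Appropriate) {Γ : Ctx L} {v : Value L} {As : List (Pred L)}
    {Bss : List (List L.Base)} {T₁ : VTy L} (hAs : List.Forall₂ (PredWF M Γ) As Bss)
    (hv : VTyping M Γ v (T₁.subst .var (ARM.instPr As))) :
    TySubst M Γ (vcons v .var) (ARM.instPr As) (.val T₁ :: Γ.addPreds Bss) :=
  (TySubst.instPr hM (hv.ctxWF hM) hAs).cons hM (by rwa [toTm_var])

/-- Subsumption refines the instance of the scheme.  The signature of the supertype is the smaller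
one, so its scheme for the operation takes more arguments and assigns a larger type to the continuation,
which is thus narrowed to a smaller type of its own argument. -/
theorem OpInContext.sub (hM : M.Appropriate) {Γ : Ctx L} {K : ECtx L} {o : L.OpName}
    {v : Value L} {Sg Sg' : L.OpName → Scheme L} {T T' : VTy L} {C₁ C₂ : CTy L} {S' : Eff L}
    {Bss : List (List L.Base)} {T₁ T₂ : VTy L} {D₁ D₂ : CTy L} {As : List (Pred L)}
    (h : OpInContext M Γ K o v Sg T C₁ C₂ Bss T₁ T₂ D₁ D₂ As)
    (hs : CSub M Γ (.comp Sg T (.atm C₁ C₂)) (.comp Sg' T' S'))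
    (hwf : CTyWF M Γ (.comp Sg' T' S')) :
    ∃ C₁ C₂ Bss T₁ T₂ D₁ D₂ As, S' = .atm C₁ C₂ ∧
      OpInContext M Γ K o v Sg' T' C₁ C₂ Bss T₁ T₂ D₁ D₂ As := by
  obtain ⟨hS, hAs, hv, hans, hcont⟩ := h
  have hsup := hs
  cases hs with
  | comp hSg hT hE =>
  cases hE with
  | atm hE₁ hE₂ =>
  cases hSg with
  | mk hSg =>
  have hso := hSg o
  have hwo := hwf.sig.scheme o
  rw [hS] at hso
  generalize hS' : Sg' o = s' at hso hwo
  cases hso with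
  | present hs₁ hs₂ hs₃ =>
  cases hs₂ with
  | arr hs₂ hs₂' =>
  rename_i T₁' T₂' D₁' D₂'
  have hΓ := hwf.ctxWF
  have hσ := (TySubst.op hM hAs hv).semSubst hM
  rw [toTm_vcons_var] at hσ
  have hv' : VTyping M Γ v (T₁'.subst .var (instPr As)) :=
    .sub hv (hs₁.subst ((TySubst.instPr hM hΓ hAs).semSubst hM))
      (hwo.arg.subst hΓ (SortSubst.instPr hAs))
  have hw := (TySubst.op hM hAs hv').sortSubst
  rw [toTm_vcons_var] at hw
  have hT₂' := hwo.res.subst hΓ hw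
  have hΓ' := CtxWF.val hΓ hT₂'
  refine ⟨_, _, _, T₁', T₂', D₁', D₂', _, rfl, hS', hAs, hv', (hs₃.subst hσ).trans (hans.trans hE₂), ?_⟩
  have hup := hsup.up (T₂'.subst (instTm v) (instPr As))
  have hwup := hwf.ren hΓ' (SortRen.succ _ Γ)
  refine (hcont.narrow hM (hs₂.subst hσ) hT₂').sub ?_ (.comp hwup.sig hwup.vty
    (.atm hwup.eff.arg (hwo.fn.arr_inv.subst hΓ' (hw.val (VTy.sort_subst _ _ _)))))
  cases hup with
  | comp h₁ h₂ h₃ =>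
  cases h₃ with
  | atm h₃ _ => exact .comp h₁ h₂ (.atm h₃ (hs₂'.subst (hσ.val _)))

/-- Inversion for an operation in an evaluation context; its type is never pure. -/
theorem CTyping.plug_op_inv (hM : M.Appropriate) {Γ : Ctx L} (K : ECtx L) {o : L.OpName}
    {v : Value L} {Sg : L.OpName → Scheme L} {T : VTy L} {S : Eff L}
    (h : CTyping M Γ (K.plug (.op o v)) (.comp Sg T S)) :
    ∃ C₁ C₂ Bss T₁ T₂ D₁ D₂ As, S = .atm C₁ C₂ ∧
      OpInContext M Γ K o v Sg T C₁ C₂ Bss T₁ T₂ D₁ D₂ As := by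
  induction K generalizing Sg T S with
  | hole =>
    obtain ⟨C₀, hs, Sg₀, Bss, T₁, T₂, D₁, D₂, As, rfl, hS, hSg, hAs, hv⟩ := h.inv
    have hwf₀ := (CTyping.op hS hSg hAs hv).wf hM
    exact OpInContext.sub hM ⟨hS, hAs, hv, .refl _ _, CTyping.ret_var_zero hwf₀⟩ hs (h.wf hM)
  | letIn K c₂ ih =>
    obtain ⟨C₀, hs, ⟨Sg₀, T₁, T₂, rfl, h₁, -⟩ | ⟨Sg₀, T₁, T₂, C, C₁₂, C₂₁, rfl, h₁, h₂⟩⟩ := h.inv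
    · obtain ⟨_, _, _, _, _, _, _, _, hE, -⟩ := ih h₁
      cases hE
    · obtain ⟨_, _, Bss, T₁', T₂', D₁, D₂, As, hE, hS, hAs, hv, hans, hcont⟩ := ih h₁
      cases hE
      refine OpInContext.sub hM ⟨hS, hAs, hv, hans, ?_⟩ hs (h.wf hM)
      have hΓ' := hcont.ctxWF hM
      have h₂' := h₂.ren hM ((CtxRen.succ hΓ').lift (hcont.wf hM).vty)
      refine .letIp hcont ?_
      simp only [CTy.ren, Eff.ren, VTy.up, CTy.upUnder, Scheme.ren_ren, VTy.ren_ren, CTy.ren_ren,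
        liftRen_one_comp, liftRen_one_succ] at h₂' ⊢
      exact h₂'

/-! ### Preservation -/

/-- The captured continuation, as a function, has the type required by the operation clause. -/
theorem OpInContext.contFun_typing (hM : M.Appropriate) {Γ : Ctx L} {K : ECtx L} {o : L.OpName}
    {v : Value L} {Sg : L.OpName → Scheme L} {T : VTy L} {C₁ C₂ : CTy L}
    {Bss : List (List L.Base)} {T₁ T₂ : VTy L} {D₁ D₂ : CTy L} {As : List (Pred L)}
    (h : OpInContext M Γ K o v Sg T C₁ C₂ Bss T₁ T₂ D₁ D₂ As) {cr : Comp L}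
    {cls : L.OpName → Clause L} (hcr : CTyping M (.val T :: Γ) cr C₁)
    (hcls : ∀ o, ClauseTyping M Γ (Sg o) (cls o)) :
    VTyping M Γ (contFun cr cls K) ((VTy.arr T₂ D₁).subst (instTm v) (instPr As)) := by
  obtain ⟨-, -, -, -, hcont⟩ := h
  rw [VTy.subst]
  generalize T₂.subst (instTm v) (instPr As) = T₂ at hcont ⊢
  generalize D₁.subst (liftTm 1 (instTm v)) (weakPr 1 (instPr As)) = D at hcont ⊢
  have hΓ₂ := hcont.ctxWF hM
  have hΓ₁ : CtxWF M (.val (.arr T₂ D) :: Γ) := .val hΓ₂.tail (.arr (hcont.wf hM).eff.ans)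
  have hr₁ := CtxRen.succ hΓ₁
  have hT₂ := hΓ₂.head.ren hΓ₁ hr₁.sortRen
  have hr := (CtxRen.succ (.val hΓ₁ hT₂)).comp hr₁
  have hcont' := hcont.ren hM (hr₁.lift hT₂)
  rw [ECtx.plug_ren, ECtx.ren_ren] at hcont'
  have hcr' := hcr.ren hM (hr.lift ((hcr.ctxWF hM).head.ren hr.wf hr.sortRen))
  refine .fix (.handle (Sg := fun o => (Sg o).ren (· + 2) id) (T := T.ren (· + 2) id)
    (C₁ := C₁.ren (liftRen 1 (· + 2)) id) ?_ hcr' (fun o => (hcls o).ren hM hr))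
  simp only [CTy.ren, Eff.ren, VTy.up, CTy.upUnder, Scheme.ren_ren, VTy.ren_ren, CTy.ren_ren,
    liftRen_one_comp, liftRen_one_succ] at hcont' ⊢
  exact hcont'

/-- The equation `p = p` that the rule for `if` adds for the branch taken at `p` is witnessed by `p`
itself. -/
theorem VTyping.prim_eq {p : L.Prim} {φ : Formula L}
    (hp : M.ty p = .rfn L.bool φ) :
    VTyping M [] (.prim p)
      (.rfn L.bool (.eq ((Value.prim p).toTerm.ren (· + 1)) (.prim p))) :=
  .sub (.prim .nil) (by rw [hp]; exact .rfn fun _ _ _ _ => rfl)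
    (.rfn .nil (.eq (.prim hp) (.prim hp)))

/-- The assumption `p = p` can be discharged, for a truth value `p`. -/
theorem CTyping.of_assume (hM : M.Appropriate) {p : L.Prim} (hp : p = L.tt ∨ p = L.ff)
    {c : Comp L} {C : CTy L}
    (h : CTyping M (Ctx.assume [] (.prim p) p) (c.ren (· + 1)) C.up) : CTyping M [] c C := by
  obtain ⟨φ, hφ⟩ := (hM.bool p).mpr hp
  have := h.subst hM (TySubst.inst1 hM (VTyping.prim_eq hφ))
  rwa [Comp.ren_succ_inst, toTm_inst1, CTy.up_inst, CTy.subst_id] at this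

/-- A closed application of a primitive function reduces, with the type that the application has. -/
theorem Calculus.Appropriate.zeta_typing (hM : M.Appropriate) {p : L.Prim} {v : Value L} {T : VTy L}
    {C : CTy L} (hp : VTyping M [] (.prim p) (.arr T C)) (hv : VTyping M [] v T) :
    ∃ c, M.zeta p v = some c ∧ CTyping M [] c (C.subst (instTm v) .pvar) := by
  obtain ⟨T₀, hs, rfl : T₀ = M.ty p⟩ := hp.inv
  generalize hty : M.ty p = T₀ at hs
  cases hs with
  | arr hT hC =>
    have hwf := hty ▸ hM.wf p
    obtain ⟨c, hc, hcT⟩ := hM.arr p _ _ hty v (.sub hv hT hwf.arr_inv.ctxWF.head)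
    have hσ := TySubst.inst1 hM hv
    have hC' := hC.subst (hσ.semSubst hM)
    have hwf' := (hp.wf hM).arr_inv.subst .nil hσ.sortSubst
    rw [toTm_inst1] at hC' hwf'
    exact ⟨c, hc, hcT.sub hC' hwf'⟩

/-- Evaluation preserves the types of closed computations. -/
theorem Step.preservation (hM : M.Appropriate) {c c' : Comp L} (hstep : Step M c c') :
    ∀ {C : CTy L}, CTyping M [] c C → CTyping M [] c' C := by
  suffices key : ∀ {C₀ C : CTy L}, CSyntaxTyping M [] c C₀ → CSub M [] C₀ C → CTyWF M [] C →
      CTyping M [] c' C by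
    intro C h
    obtain ⟨C₀, hs, hi⟩ := h.inv
    exact key hi hs (h.wf hM)
  induction hstep with
  | letIn hstep ih =>
    have ih' : ∀ {C : CTy L}, CTyping M [] _ C → CTyping M [] _ C := fun h =>
      have ⟨_, hs, hi⟩ := h.inv
      ih hi hs (h.wf hM)
    rintro C₀ C (⟨Sg, T₁, T₂, rfl, h₁, h₂⟩ | ⟨Sg, T₁, T₂, C, C₁₂, C₂₁, rfl, h₁, h₂⟩) hs hwf
    · exact .sub (.letP (ih' h₁) h₂) hs hwf
    · exact .sub (.letIp (ih' h₁) h₂) hs hwf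
  | @letRet v c₂ =>
    rintro C₀ C (⟨Sg, T₁, T₂, rfl, h₁, h₂⟩ | ⟨Sg, T₁, T₂, C, C₁₂, C₂₁, rfl, h₁, h₂⟩) hs hwf
    · have h := h₂.subst hM (TySubst.inst1 hM (h₁.ret_inv hM))
      simp only [toTm_inst1, CTy.subst, Scheme.up_inst, VTy.up_inst, VTy.subst_id, Eff.subst] at h
      exact .sub h hs hwf
    · have h := h₂.subst hM (TySubst.inst1 hM (h₁.ret_inv hM))
      simp only [toTm_inst1, CTy.subst, Scheme.up_inst, VTy.up_inst, VTy.subst_id, Eff.subst,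
        weakPr_id, CTy.upUnder_inst] at h
      exact .sub h (CSub.trans (.comp (.refl _ _) (.refl _ _)
        (.atm (.refl _ _) (h₁.ret_ans hM))) hs) hwf
  | iteT =>
    rintro C₀ C ⟨φ, -, h, -⟩ hs hwf
    exact .sub (.of_assume hM (.inl rfl) h) hs hwf
  | iteF =>
    rintro C₀ C ⟨φ, -, -, h⟩ hs hwf
    exact .sub (.of_assume hM (.inr rfl) h) hs hwf
  | @app c v =>
    rintro C₀ C ⟨T, C', rfl, hf, hv⟩ hs hwf
    obtain ⟨_, hsf, T₀, C₀, rfl, hc⟩ := hf.inv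
    cases hsf with
    | arr hT hC =>
      have hwf₀ : VTyWF M [] (.arr T₀ C₀) := (hc.ctxWF hM).tail.head
      have hv₀ : VTyping M [] v T₀ := .sub hv hT hwf₀.arr_inv.ctxWF.head
      have hσ := (TySubst.id (M := M) .nil).cons hM (v := .fix c) (T := .arr T₀ C₀)
        (by rw [toTm_var, VTy.subst_id]; exact .fix hc)
      have h := hc.subst hM (hσ.cons hM (v := v) (T := T₀.up)
        (by rw [VTy.up_subst_vcons, toTm_var, VTy.subst_id]; exact hv₀))
      have hC' := hC.subst ((TySubst.inst1 hM hv).semSubst hM)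
      rw [toTm_inst1] at hC'
      have hσ' : C₀.upUnder.subst (toTm (vcons v (vcons (.fix c) .var))) .pvar =
          C₀.subst (instTm v) .pvar := by
        rw [CTy.upUnder, CTy.ren_subst]
        congr 1
        funext x
        cases x with
        | zero => rfl
        | succ x => rw [liftRen_one_succ]; rfl
      rw [hσ', ← inst2_eq_vcons] at h
      exact .sub h (hC'.trans hs) hwf
  | prim hz =>
    rintro C₀ C ⟨T, C', rfl, hp, hv⟩ hs hwf
    obtain ⟨c, hc, hcT⟩ := hM.zeta_typing hp hv
    rw [hz] at hc
    cases hc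
    exact .sub hcT hs hwf
  | handle hstep ih =>
    rintro C₀ C ⟨Sg, T, C₁, h₁, h₂, h₃⟩ hs hwf
    obtain ⟨_, hs', hi⟩ := h₁.inv
    exact .sub (.handle (ih hi hs' (h₁.wf hM)) h₂ h₃) hs hwf
  | @handleRet cr cls v =>
    rintro C₀ C ⟨Sg, T, C₁, h₁, h₂, h₃⟩ hs hwf
    have h := h₂.subst hM (TySubst.inst1 hM (h₁.ret_inv hM))
    rw [toTm_inst1] at h
    exact .sub h ((h₁.ret_ans hM).trans hs) hwf
  | @handleOp cr cls K o v c hcl =>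
    rintro C₀ C ⟨Sg, T, C₁, h₁, h₂, h₃⟩ hs hwf
    obtain ⟨_, _, Bss, T₁, T₂, D₁, D₂, As, hE, h⟩ := h₁.plug_op_inv hM K
    cases hE
    have hc := h₃ o
    rw [h.scheme, hcl] at hc
    cases hc with
    | present hc =>
      have hk := h.contFun_typing hM h₂ h₃
      rw [← toTm_vcons_var] at hk
      have h' := hc.subst hM ((TySubst.op hM h.preds h.arg).cons hM hk)
      rw [CTy.up_subst_vcons, toTm_vcons_var, ← inst2_eq_vcons] at h'
      exact .sub h' (h.ans.trans hs) hwf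

/-! ### Progress -/

/-- A closed well-typed computation returns a value, performs an operation in an evaluation
context, or evaluates further. -/
theorem CTyping.progress (hM : M.Appropriate) : ∀ {c : Comp L} {C : CTy L}, CTyping M [] c C →
    (∃ v, c = .ret v) ∨ (∃ K o v, c = ECtx.plug K (.op o v)) ∨ ∃ c', Step M c c'
  | .ret v, _, _ => .inl ⟨v, rfl⟩
  | .op o v, _, _ => .inr (.inl ⟨.hole, o, v, rfl⟩)
  | .app v₁ v₂, _, h => by
      obtain ⟨_, _, T, C, rfl, h₁, h₂⟩ := h.inv
      refine .inr (.inr ?_)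
      cases v₁ with
      | var x =>
        obtain ⟨_, _, hx⟩ := h₁.inv
        simp [VSyntaxTyping, Ctx.lookup] at hx
      | prim p =>
        obtain ⟨c, hc, -⟩ := hM.zeta_typing h₁ h₂
        exact ⟨c, .prim hc⟩
      | fix c => exact ⟨_, .app⟩
  | .ite v c₁ c₂, _, h => by
      obtain ⟨_, _, φ, hv, -, -⟩ := h.inv
      refine .inr (.inr ?_)
      obtain ⟨x, ψ, rfl, hx⟩ | ⟨p, ψ, rfl, hp⟩ := hv.rfn_cases
      · simp [Ctx.lookup] at hx
      · obtain rfl | rfl := (hM.bool p).mp ⟨ψ, hp⟩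
        · exact ⟨_, .iteT⟩
        · exact ⟨_, .iteF⟩
  | .letIn c₁ c₂, _, h => by
      obtain ⟨C₁, h₁⟩ : ∃ C₁, CTyping M [] c₁ C₁ := by
        obtain ⟨_, _, ⟨_, _, _, _, h₁, _⟩ | ⟨_, _, _, _, _, _, _, h₁, _⟩⟩ := h.inv
        · exact ⟨_, h₁⟩
        · exact ⟨_, h₁⟩
      obtain ⟨v, rfl⟩ | ⟨K, o, v, rfl⟩ | ⟨c', hc'⟩ := CTyping.progress hM h₁
      · exact .inr (.inr ⟨_, .letRet⟩)
      · exact .inr (.inl ⟨.letIn K c₂, o, v, rfl⟩)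
      · exact .inr (.inr ⟨_, .letIn hc'⟩)
  | .handle cr cls c, _, h => by
      obtain ⟨_, _, Sg, T, C₁, h₁, h₂, h₃⟩ := h.inv
      refine .inr (.inr ?_)
      obtain ⟨v, rfl⟩ | ⟨K, o, v, rfl⟩ | ⟨c', hc'⟩ := CTyping.progress hM h₁
      · exact ⟨_, .handleRet⟩
      · obtain ⟨_, _, _, _, _, _, _, _, _, hop⟩ := h₁.plug_op_inv hM K
        have hc := h₃ o
        rw [hop.scheme] at hc
        generalize hcl : cls o = d at hc
        cases hc with
        | present => exact ⟨_, .handleOp hcl⟩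
      · exact ⟨_, .handle hc'⟩
termination_by structural c => c

end ARM

theorem theorem1 {L : ARM.Language.{u}} (M : ARM.Calculus L) (hM : M.Appropriate)
    (Sg : L.OpName → ARM.Scheme L) (T : ARM.VTy L) (S : ARM.Eff L) (c c' : ARM.Comp L)
    (hc : ARM.CTyping M [] c (.comp Sg T S))
    (hstep : Relation.ReflTransGen (ARM.Step M) c c') :
    (∃ v, c' = .ret v ∧ ARM.VTyping M [] v T) ∨
    (∃ K o v, c' = ARM.ECtx.plug K (.op o v) ∧ Sg o ≠ .absent) ∨
    (∃ c'', ARM.Step M c' c'' ∧ ARM.CTyping M [] c'' (.comp Sg T S)) := by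
  have hc' : ARM.CTyping M [] c' (.comp Sg T S) := by
    induction hstep with
    | refl => exact hc
    | tail _ h ih => exact h.preservation hM ih
  obtain ⟨v, rfl⟩ | ⟨K, o, v, rfl⟩ | ⟨c'', h⟩ := hc'.progress hM
  · exact .inl ⟨v, rfl, hc'.ret_inv hM⟩
  · obtain ⟨_, _, _, _, _, _, _, _, _, hop⟩ := hc'.plug_op_inv hM K
    exact .inr (.inl ⟨K, o, v, rfl, by rw [hop.scheme]; simp⟩)
  · exact .inr (.inr ⟨c'', h, h.preservation hM hc'⟩)
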